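/- **Model.** A dynamic network has $n \ge 2$ nodes with distinct identifiers of $O(\log n)$ bits. Every node knows $b$, $d$ and a common estimate $N$ of $n$ with $n/2 \le N \le 2n$, where $b \ge \log n$ and $d \le b$ (logarithms to base 2); local computation is unrestricted. Before the first round, an adversary gives each node a (possibly empty) set of $d$-bit tokens; let $k \le n$ be the number of distinct tokens in the union of these sets ($k$ is not known to the nodes). In each synchronous round the adversary first chooses a connected graph on the nodes, which may depend on the inputs and on all random choices, actions and states of the nodes up to the end of the previous round. Then each node, without knowing its neighbours, draws fresh independent randomness and broadcasts an $O(b)$-bit message, which may be an arbitrary (randomized) function of all it knows (so tokens may be coded together); it receives the messages of its neighbours in the graph, without sender information. A node that has terminated sends nothing more. A (Las Vegas) algorithm *solves $k$-token dissemination* if in every execution every node eventually terminates, with the union of all tokens as its output. **Theorem.** For all constants $c, u \in \mathbb{N}$ there are a constant $C$ and a randomized (network coding) algorithm with $O(b)$-bit messages which, for all $n \ge 2$, $N$, $b$, $d$, $k$ as above, all distinct identifiers in $\{0,\dots,n^u-1\}$, all initial token distributions and every adaptive adversary, solves $k$-token dissemination and such that, with probability at least $1 - n^{-c}$, all nodes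 terminate within $$C \cdot \min\Big\{ \frac{1}{b}\cdot\frac{nkd}{b} + nb,\ \ \frac{\log n}{b}\cdot\frac{nkd}{b} + n\log n \Big\}$$ rounds. Here $C$ and the constant in the message size depend only on $c$ and $u$. -/

import Mathlib

/-- A token of `d` bits. -/
abbrev Token (d : ℕ) : Type := Fin d → Bool

/-- A message of `m` bits. -/
abbrev Message (m : ℕ) : Type := Fin m → Bool

/-- A randomized distributed algorithm for nodes that broadcast `m`-bit messages and start with
sets of `d`-bit tokens. Every node runs the same algorithm; local computation is unrestricted and
a message may be any function of the node's state and of its random choice.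
In each round a node draws a fresh, uniformly distributed element of the finite set `Coin`,
computes its message from its state and this element, and then computes its new state from its
state, the same element and the multiset of the messages of its neighbours
(without information about the senders). -/
structure Algorithm (m d : ℕ) where
  State : Type
  Coin : Type
  coinFintype : Fintype Coin
  coinNonempty : Nonempty Coin
  /-- initial state of a node, from its UID and the tokens that it holds -/
  init : ℕ → Finset (Token d) → State
  message : State → Coin → Message m
  update : State → Coin → Multiset (Message m) → State
  /-- `none` while the node is running; `some S` if it has terminated with the token set `S` -/
  output : State → Option (Finset (Token d))

attribute [instance] Algorithm.coinFintype Algorithm.coinNonempty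

/-- An adaptive adversary for a network with `n` nodes: the (connected) graph of round `t` is
a function of all random choices of all nodes in the rounds before `t`. As the inputs are fixed,
these determine all past actions and the current states; the random choices of round `t` itself
are not available. -/
structure Adversary (n : ℕ) (Coin : Type) where
  graph : (t : ℕ) → (Fin t → Fin n → Coin) → SimpleGraph (Fin n)
  connected : ∀ (t : ℕ) (h : Fin t → Fin n → Coin), (graph t h).Connected

namespace Algorithm

variable {m d n : ℕ}

/-- The node in state `s` has terminated. -/
def Halted (A : Algorithm m d) (s : A.State) : Prop :=
  (A.output s).isSome = true

open Classical in
/-- One round on the graph `G`, from the states `s` with the random choices `x`.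
A node that has terminated sends nothing and keeps its state. -/
noncomputable def step (A : Algorithm m d) (G : SimpleGraph (Fin n)) (s : Fin n → A.State)
    (x : Fin n → A.Coin) : Fin n → A.State := fun v =>
  if A.Halted (s v) then s v
  else A.update (s v) (x v)
    ((Finset.univ.filter fun w => G.Adj v w ∧ ¬ A.Halted (s w)).val.map
      fun w => A.message (s w) (x w))

/-- The states of all nodes after `t` rounds, given the random choices of these rounds. -/
noncomputable def run (A : Algorithm m d) (uid : Fin n → ℕ) (tok : Fin n → Finset (Token d))
    (adv : Adversary n A.Coin) : (t : ℕ) → (Fin t → Fin n → A.Coin) → Fin n → A.State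
  | 0, _ => fun v => A.init (uid v) (tok v)
  | t + 1, x =>
      A.step (adv.graph t (Fin.init x)) (run A uid tok adv t (Fin.init x)) (x (Fin.last t))

/-- All nodes have terminated after `t` rounds. -/
def AllHalted (A : Algorithm m d) (uid : Fin n → ℕ) (tok : Fin n → Finset (Token d))
    (adv : Adversary n A.Coin) (t : ℕ) (x : Fin t → Fin n → A.Coin) : Prop :=
  ∀ v, A.Halted (A.run uid tok adv t x v)

/-- Las Vegas token dissemination: whatever the random choices are, a node that terminates outputs
exactly the union of all initial token sets, and eventually all nodes terminate. -/
structure Disseminates (A : Algorithm m d) (uid : Fin n → ℕ) (tok : Fin n → Finset (Token d))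
    (adv : Adversary n A.Coin) : Prop where
  correct : ∀ (t : ℕ) (x : Fin t → Fin n → A.Coin) (v : Fin n) (S : Finset (Token d)),
    A.output (A.run uid tok adv t x v) = some S → S = Finset.univ.biUnion tok
  terminates : ∀ x : ℕ → Fin n → A.Coin, ∃ t : ℕ, A.AllHalted uid tok adv t fun i => x i

/-- The probability that all nodes have terminated after at most `t` rounds, where the random
choices of all nodes in all rounds are independent and uniform. (As terminated nodes stay
terminated, this is the proportion of the outcomes of the first `t` rounds after which all nodes
have terminated.) -/
noncomputable def haltProb (A : Algorithm m d) (uid : Fin n → ℕ) (tok : Fin n → Finset (Token d))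
    (adv : Adversary n A.Coin) (t : ℕ) : ℝ :=
  (Nat.card {x : Fin t → Fin n → A.Coin // A.AllHalted uid tok adv t x} : ℝ) /
    (Nat.card (Fin t → Fin n → A.Coin) : ℝ)

end Algorithm

/-- `min {(1/b)·(nkd/b) + nb, (log n/b)·(nkd/b) + n log n}`, with the logarithm to base 2. -/
noncomputable def roundBound (n k d b : ℕ) : ℝ :=
  min (1 / (b : ℝ) * ((n : ℝ) * k * d / b) + (n : ℝ) * b)
    (Real.logb 2 n / (b : ℝ) * ((n : ℝ) * k * d / b) + (n : ℝ) * Real.logb 2 n)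

/-! The algorithm runs in phases of O(n) rounds. A block holds s tokens, about b/d, so that it fits
into one message, and g is about min(b, n / log n); O(g) blocks can be coded together. It is shown
that O(kd/b² + log n) phases suffice with high probability. The resulting bound O(n (kd/b² + log n))
lies below both terms of the minimum, since 1 ≤ log n ≤ b (`le_roundBound`, `div_gs_le`).

A phase begins with random forwarding of blocks. If afterwards some node is heavy (it knows more
than g·s undelivered tokens), one heavy node is elected by flooding and broadcasts g of its blocks
by network coding. If no node is heavy, every undelivered token is known to at least n/g nodes with
high probability (`upper_fwd_le`), and forwarding is switched off for good. From then on every node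
selects its blocks at random with probability about g/Φ, where Φ, the number of pairs of a node and
a nonempty block of it, is estimated from the maximum of random keys (`half_le_expect_key`). The
O(g) selected blocks are spread by random linear coding over the field with two elements.

Nobody knows which blocks were selected, so there are no indices to put into the vectors. A block x
carries the hash value 1/(a+x) for a common random seed a instead. Reciprocals of distinct linear
functions are linearly independent, so for most a the only vectors of blocks in the span are those
of the selected blocks (`card_sum_inv_eq_inv_le`, `GoodSeed.mem_of_mem_span`). A leader can
therefore read off the selected set, number it, and broadcast it with indices. Coding works because
a functional that is nonzero at some node spreads like a rumour, each contact succeeding with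
probability 1/2; a union bound over functionals follows (`upper_code_le`).

Progress is measured by potentials. With heavy nodes, exp(rate · #undelivered) shrinks by a constant
factor in expectation (`upper_exp_le`). Without them, the same exponential times the mass, the
number of pairs of a node and an undelivered token it knows, does (`upper_mass_le`). Indeed Φ ≤
mass/s + n. If n dominates, a token at n/g nodes is selected with constant probability, so mass is
lost; if mass/s dominates, about g·s tokens are expected to be delivered, so the exponential drops.
One weight per token covers both cases (`gain_le`, `le_gain`).

The output is never wrong: the leader tests the seed on all candidates, and every node checks that
its own selected blocks were broadcast (`remSet_subset`). Termination is certain since every phase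
with undelivered tokens also delivers the largest of them. The adaptive adversary is handled by
`upper`, a supremum over graphs alternating with an expectation over the fresh coins of a round. All
coins that decide the selection are drawn in one round, and the result of flooding does not depend
on the graphs. -/

namespace NetCoding

open Finset BigOperators

/-! ### Upper expectations over adaptively chosen connected graphs -/

/-- Connected graphs on `Fin n`. -/
abbrev CGraph (n : ℕ) : Type := {G : SimpleGraph (Fin n) // G.Connected}

instance (n : ℕ) : Finite (CGraph n) := by
  classical
  exact Subtype.finite

theorem nonempty_cgraph {n : ℕ} (hn : 0 < n) : Nonempty (CGraph n) := by
  have : Nonempty (Fin n) := ⟨⟨0, hn⟩⟩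
  exact ⟨⟨⊤, SimpleGraph.connected_top⟩⟩

open Classical in
/-- The indicator of a proposition. -/
noncomputable def ind (P : Prop) : ℝ := if P then 1 else 0

theorem ind_pos {P : Prop} (h : P) : ind P = 1 := if_pos h

theorem ind_neg {P : Prop} (h : ¬ P) : ind P = 0 := if_neg h

theorem ind_nonneg (P : Prop) : 0 ≤ ind P := by
  unfold ind; split_ifs <;> norm_num

theorem ind_le_one (P : Prop) : ind P ≤ 1 := by
  unfold ind; split_ifs <;> norm_num

theorem ind_mono {P Q : Prop} (h : P → Q) : ind P ≤ ind Q := by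
  by_cases hP : P
  · rw [ind_pos hP, ind_pos (h hP)]
  · rw [ind_neg hP]; exact ind_nonneg Q

section Reachability

variable {n : ℕ} {K S X : Type} (step : K → SimpleGraph (Fin n) → S → X → S)

/-- The state `m'` can be reached from `m` in rounds of the listed kinds. -/
def Reach : List K → S → S → Prop
  | [], m, m' => m' = m
  | k :: l, m, m' => ∃ (G : CGraph n) (x : X), Reach l (step k G.1 m x) m'

variable {step}

theorem Reach.append {l₁ l₂ : List K} {m m' : S} :
    Reach step (l₁ ++ l₂) m m' ↔ ∃ m₁, Reach step l₁ m m₁ ∧ Reach step l₂ m₁ m' := by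
  induction l₁ generalizing m with
  | nil => simp [Reach]
  | cons k l ih =>
    simp only [List.cons_append, Reach, ih]
    constructor
    · rintro ⟨G, x, m₁, h, h'⟩
      exact ⟨m₁, ⟨G, x, h⟩, h'⟩
    · rintro ⟨m₁, ⟨G, x, h⟩, h'⟩
      exact ⟨G, x, m₁, h, h'⟩

theorem Reach.invariant {I : S → Prop} {l : List K}
    (hI : ∀ k ∈ l, ∀ (G : CGraph n) m x, I m → I (step k G.1 m x)) {m m' : S}
    (h : Reach step l m m') (hm : I m) : I m' := by
  induction l generalizing m with
  | nil => rw [show m' = m from h]; exact hm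
  | cons k l ih =>
    obtain ⟨G, x, h⟩ := h
    exact ih (fun k hk => hI k (List.mem_cons_of_mem _ hk)) h (hI k (by simp) G m x hm)

end Reachability

section Upper

variable {n : ℕ} {K S X : Type} [Fintype X] (step : K → SimpleGraph (Fin n) → S → X → S)

/-- The largest expectation of `f` that an adaptive adversary can enforce in the rounds whose
kinds are listed in `l`, from the state `m`. -/
noncomputable def upper : List K → (S → ℝ) → S → ℝ
  | [], f, m => f m
  | k :: l, f, m => ⨆ G : CGraph n, 𝔼 x, upper l f (step k G.1 m x)

variable {step}

theorem upper_append (l₁ l₂ : List K) (f : S → ℝ) (m : S) :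
    upper step (l₁ ++ l₂) f m = upper step l₁ (upper step l₂ f) m := by
  induction l₁ generalizing m with
  | nil => rfl
  | cons k l ih => simp only [List.cons_append, upper, ih]

theorem expect_le_upper_cons (k : K) (l : List K) (f : S → ℝ) (m : S) (G : CGraph n) :
    𝔼 x, upper step l f (step k G.1 m x) ≤ upper step (k :: l) f m :=
  le_ciSup (f := fun G : CGraph n => 𝔼 x, upper step l f (step k G.1 m x))
    (Set.finite_range _).bddAbove G

variable [Nonempty (CGraph n)]

theorem upper_cons_le {k : K} {l : List K} {f : S → ℝ} {m : S} {c : ℝ}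
    (h : ∀ G : CGraph n, 𝔼 x, upper step l f (step k G.1 m x) ≤ c) :
    upper step (k :: l) f m ≤ c :=
  ciSup_le h

/-- Comparison is needed only at reachable states. This is how deterministic facts about a stage
(`Reach`) enter the probability estimates. -/
theorem upper_mono {l : List K} {f h : S → ℝ} {m : S}
    (hfh : ∀ m', Reach step l m m' → f m' ≤ h m') : upper step l f m ≤ upper step l h m := by
  induction l generalizing m with
  | nil => exact hfh m rfl
  | cons k l ih =>
    refine upper_cons_le fun G => le_trans ?_ (expect_le_upper_cons k l h m G)
    exact expect_le_expect fun x _ => ih fun m' hm' => hfh m' ⟨G, x, hm'⟩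

theorem upper_add_le (l : List K) (f h : S → ℝ) (m : S) :
    upper step l (fun m => f m + h m) m ≤ upper step l f m + upper step l h m := by
  induction l generalizing m with
  | nil => exact le_rfl
  | cons k l ih =>
    refine upper_cons_le fun G => ?_
    calc 𝔼 x, upper step l (fun m => f m + h m) (step k G.1 m x)
        ≤ 𝔼 x, (upper step l f (step k G.1 m x) + upper step l h (step k G.1 m x)) :=
          expect_le_expect fun x _ => ih _
      _ = _ := expect_add_distrib _ _ _
      _ ≤ _ := add_le_add (expect_le_upper_cons k l f m G) (expect_le_upper_cons k l h m G)

theorem upper_mul_le (l : List K) {a : ℝ} (ha : 0 ≤ a) (f : S → ℝ) (m : S) :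
    upper step l (fun m => a * f m) m ≤ a * upper step l f m := by
  induction l generalizing m with
  | nil => exact le_rfl
  | cons k l ih =>
    refine upper_cons_le fun G => ?_
    calc 𝔼 x, upper step l (fun m => a * f m) (step k G.1 m x)
        ≤ 𝔼 x, a * upper step l f (step k G.1 m x) := expect_le_expect fun x _ => ih _
      _ = a * 𝔼 x, upper step l f (step k G.1 m x) := (mul_expect _ _ _).symm
      _ ≤ _ := mul_le_mul_of_nonneg_left (expect_le_upper_cons k l f m G) ha

/-- A nonnegative function that shrinks by the factor `ρ` in expectation in each round. -/
theorem upper_replicate_le {k : K} {I : S → Prop} {V : S → ℝ} {ρ : ℝ} (hρ : 0 ≤ ρ)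
    (hI : ∀ (G : CGraph n) m x, I m → I (step k G.1 m x))
    (hV : ∀ (G : CGraph n) m, I m → 𝔼 x, V (step k G.1 m x) ≤ ρ * V m) (r : ℕ) {m : S}
    (hm : I m) : upper step (List.replicate r k) V m ≤ ρ ^ r * V m := by
  induction r generalizing m with
  | zero => simp [upper]
  | succ r ih =>
    rw [List.replicate_succ]
    refine upper_cons_le fun G => ?_
    calc 𝔼 x, upper step (List.replicate r k) V (step k G.1 m x)
        ≤ 𝔼 x, ρ ^ r * V (step k G.1 m x) := expect_le_expect fun x _ => ih (hI G m x hm)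
      _ = ρ ^ r * 𝔼 x, V (step k G.1 m x) := (mul_expect _ _ _).symm
      _ ≤ ρ ^ r * (ρ * V m) := by gcongr; exact hV G m hm
      _ = ρ ^ (r + 1) * V m := by ring

variable [Nonempty X]

theorem upper_le_of_forall {l : List K} {f : S → ℝ} {m : S} {c : ℝ}
    (h : ∀ m', Reach step l m m' → f m' ≤ c) : upper step l f m ≤ c := by
  induction l generalizing m with
  | nil => exact h m rfl
  | cons k l ih =>
    exact upper_cons_le fun G => expect_le univ_nonempty fun x _ => ih fun m' hm' => h m' ⟨G, x, hm'⟩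

theorem upper_sum_le {ι : Type*} (s : Finset ι) (l : List K) (f : ι → S → ℝ) (m : S) :
    upper step l (fun m => ∑ i ∈ s, f i m) m ≤ ∑ i ∈ s, upper step l (f i) m := by
  classical
  induction s using Finset.induction_on with
  | empty =>
    simp only [sum_empty]
    exact upper_le_of_forall fun _ _ => le_rfl
  | insert i s hi ih =>
    simp only [sum_insert hi]
    exact (upper_add_le l (f i) _ m).trans (add_le_add_right ih _)

/-- `upper` of an affine combination with nonnegative coefficients. -/
theorem upper_affine_le {ι : Type*} (s : Finset ι) (l : List K) (c : ℝ) (a : ι → ℝ)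
    (ha : ∀ i ∈ s, 0 ≤ a i) (f : ι → S → ℝ) (m : S) :
    upper step l (fun m => c + ∑ i ∈ s, a i * f i m) m ≤
      c + ∑ i ∈ s, a i * upper step l (f i) m := by
  refine (upper_add_le l (fun _ => c) _ m).trans (add_le_add ?_ ?_)
  · exact upper_le_of_forall fun _ _ => le_rfl
  · exact (upper_sum_le s l _ m).trans (sum_le_sum fun i hi => upper_mul_le l (ha i hi) _ m)

end Upper

/-! ### Spreading in connected graphs -/

theorem exists_adj_mem_not_mem {n : ℕ} (G : CGraph n) {s : Finset (Fin n)} (hs : s.Nonempty)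
    (hs' : s ≠ univ) : ∃ w ∈ s, ∃ v, v ∉ s ∧ G.1.Adj v w := by
  obtain ⟨u, hu⟩ := hs
  obtain ⟨v, hv⟩ : ∃ v, v ∉ s := by
    by_contra! h
    exact hs' (eq_univ_iff_forall.2 h)
  obtain ⟨p⟩ := G.2.preconnected u v
  obtain ⟨e, -, h1, h2⟩ := p.exists_boundary_dart (s : Set (Fin n)) (by simpa using hu)
    (by simpa using hv)
  exact ⟨e.fst, by simpa using h1, e.snd, by simpa using h2, e.adj.symm⟩

section Spread

variable {n : ℕ} {K S X : Type} {step : K → SimpleGraph (Fin n) → S → X → S}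

/-- If in every round some node outside the set `A m` joins it, it grows by one per round. -/
theorem Reach.card_spread {k : K} {I : S → Prop} {A : S → Finset (Fin n)}
    (hI : ∀ (G : CGraph n) m x, I m → I (step k G.1 m x))
    (hA : ∀ (G : CGraph n) m x, I m → A m ⊆ A (step k G.1 m x))
    (hne : ∀ m, I m → (A m).Nonempty)
    (hs : ∀ (G : CGraph n) m x v w, I m → w ∈ A m → G.1.Adj v w → v ∈ A (step k G.1 m x))
    (r : ℕ) {m m' : S} (hm : I m) (h : Reach step (List.replicate r k) m m') :
    A m' = univ ∨ (A m).card + r ≤ (A m').card := by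
  induction r generalizing m with
  | zero => right; rw [show m' = m from h]; simp
  | succ r ih =>
    obtain ⟨G, x, h⟩ := h
    rcases ih (hI G m x hm) h with h1 | h1
    · exact Or.inl h1
    · by_cases hu : A m = univ
      · left
        have hmono : A m ⊆ A m' := by
          refine (hA G m x hm).trans ?_
          exact (Reach.invariant (I := fun m₁ => I m₁ ∧ A (step k G.1 m x) ⊆ A m₁)
            (fun k' hk' G' m₁ x' h' => by
              rw [List.eq_of_mem_replicate hk']
              exact ⟨hI _ _ _ h'.1, h'.2.trans (hA _ _ _ h'.1)⟩) h
            ⟨hI G m x hm, Subset.rfl⟩).2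
        rw [hu] at hmono
        exact univ_subset_iff.1 hmono
      · right
        obtain ⟨w, hw, v, hv, hvw⟩ := exists_adj_mem_not_mem G (hne m hm) hu
        have : (A m).card < (A (step k G.1 m x)).card := by
          refine card_lt_card ((ssubset_iff_of_subset (hA G m x hm)).2 ⟨v, ?_, hv⟩)
          exact hs G m x v w hm hw hvw
        omega

variable [Fintype X] [Nonempty X] [Nonempty (CGraph n)]

/-- If in every round, as long as the process has not stopped, each node that is adjacent to the
set `A m` joins it with probability at least `q`, then `A m` is unlikely to stay small. -/
theorem upper_spread_le {k : K} {I : S → Prop} {quit : S → Prop} {A : S → Finset (Fin n)} {q : ℝ}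
    (hq1 : q ≤ 1)
    (hI : ∀ (G : CGraph n) m x, I m → I (step k G.1 m x))
    (hquit : ∀ (G : CGraph n) m x, I m → quit m → quit (step k G.1 m x))
    (hA : ∀ (G : CGraph n) m x, I m → A m ⊆ A (step k G.1 m x))
    (hne : ∀ m, I m → (A m).Nonempty)
    (hs : ∀ (G : CGraph n) m v w, I m → ¬ quit m → w ∈ A m → v ∉ A m → G.1.Adj v w →
      q ≤ 𝔼 x, ind (v ∈ A (step k G.1 m x)))
    (r h : ℕ) {m : S} (hm : I m) :
    upper step (List.replicate r k)
      (fun m => ind (¬ quit m ∧ A m ≠ univ ∧ (A m).card ≤ h)) m ≤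
      2 ^ h * (1 - q / 2) ^ r := by
  classical
  -- Each node that joins halves this potential, and one joins with probability at least q, which
  -- gives the factor 1 - q/2. Stopping sets it to 0, and a set of size at most h still has
  -- potential at least 2^(-h), so Markov's inequality finishes.
  set V : S → ℝ := fun m => if quit m ∨ A m = univ then 0 else (1 / 2) ^ (A m).card with hVdef
  have hV0 : ∀ m, 0 ≤ V m := fun m => by
    simp only [hVdef]; split_ifs <;> positivity
  have hV1 : V m ≤ 1 := by
    simp only [hVdef]
    split_ifs
    · exact zero_le_one
    · exact pow_le_one₀ (by norm_num) (by norm_num)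
  have key : upper step (List.replicate r k) V m ≤ (1 - q / 2) ^ r * V m := by
    refine upper_replicate_le (by linarith) hI ?_ r hm
    intro G m hm
    by_cases hst : quit m ∨ A m = univ
    · have : ∀ x, V (step k G.1 m x) = 0 := fun x => by
        simp only [hVdef]
        rw [if_pos]
        rcases hst with h | h
        · exact Or.inl (hquit G m x hm h)
        · exact Or.inr (univ_subset_iff.1 (h ▸ hA G m x hm))
      have h0 : V m = 0 := by simp [hVdef, hst]
      simp [this, h0]
    · have hVm : V m = (1 / 2) ^ (A m).card := by simp only [hVdef]; rw [if_neg hst]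
      push Not at hst
      obtain ⟨w, hw, v, hv, hvw⟩ := exists_adj_mem_not_mem G (hne m hm) hst.2
      have h1 := hs G m v w hm hst.1 hw hv hvw
      have h2 : ∀ x, V (step k G.1 m x) ≤
          V m * (1 - (1 / 2) * ind (v ∈ A (step k G.1 m x))) := fun x => by
        have hle : V (step k G.1 m x) ≤ (1 / 2) ^ (A (step k G.1 m x)).card := by
          simp only [hVdef]; split_ifs
          · positivity
          · exact le_rfl
        rw [hVm]
        refine hle.trans ?_
        by_cases hvm : v ∈ A (step k G.1 m x)
        · rw [ind_pos hvm]
          have : (A m).card + 1 ≤ (A (step k G.1 m x)).card :=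
            card_lt_card ((ssubset_iff_of_subset (hA G m x hm)).2 ⟨v, hvm, hv⟩)
          calc ((1 : ℝ) / 2) ^ (A (step k G.1 m x)).card ≤ (1 / 2) ^ ((A m).card + 1) :=
                pow_le_pow_of_le_one (by norm_num) (by norm_num) this
            _ = _ := by ring
        · rw [ind_neg hvm]
          have : (A m).card ≤ (A (step k G.1 m x)).card := card_le_card (hA G m x hm)
          calc ((1 : ℝ) / 2) ^ (A (step k G.1 m x)).card ≤ (1 / 2) ^ (A m).card :=
                pow_le_pow_of_le_one (by norm_num) (by norm_num) this
            _ = _ := by ring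
      calc 𝔼 x, V (step k G.1 m x)
          ≤ 𝔼 x, V m * (1 - (1 / 2) * ind (v ∈ A (step k G.1 m x))) :=
            expect_le_expect fun x _ => h2 x
        _ = V m * (1 - (1 / 2) * 𝔼 x, ind (v ∈ A (step k G.1 m x))) := by
            rw [← mul_expect, expect_sub_distrib, ← mul_expect, Fintype.expect_const]
        _ ≤ V m * (1 - (1 / 2) * q) := by
            have := hV0 m
            gcongr
        _ = (1 - q / 2) * V m := by ring
  calc _ ≤ upper step (List.replicate r k) (fun m => 2 ^ h * V m) m := by
        refine upper_mono fun m' _ => ?_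
        by_cases hc : ¬ quit m' ∧ A m' ≠ univ ∧ (A m').card ≤ h
        · rw [ind_pos hc]
          simp only [hVdef]
          rw [if_neg (by tauto), one_div, inv_pow, ← div_eq_mul_inv, le_div_iff₀ (by positivity),
            one_mul]
          exact pow_le_pow_right₀ (by norm_num) hc.2.2
        · rw [ind_neg hc]
          exact mul_nonneg (by positivity) (hV0 m')
    _ ≤ 2 ^ h * upper step (List.replicate r k) V m := upper_mul_le _ (by positivity) _ _
    _ ≤ 2 ^ h * ((1 - q / 2) ^ r * V m) := by gcongr
    _ ≤ 2 ^ h * ((1 - q / 2) ^ r * 1) := by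
        have : 0 ≤ 1 - q / 2 := by linarith
        gcongr
    _ = _ := by ring

end Spread

/-! ### The algorithm -/

open Classical in
/-- An injection of `α` into `β`, if there is one. -/
noncomputable def someInj (α β : Type) [Nonempty β] : α → β :=
  if h : ∃ f : α → β, Function.Injective f then h.choose else fun _ => Classical.arbitrary β

theorem someInj_injective {α β : Type} [Fintype α] [Fintype β] [Nonempty β]
    (h : Fintype.card α ≤ Fintype.card β) : Function.Injective (someInj α β) := by
  have h' : ∃ f : α → β, Function.Injective f :=
    let ⟨f⟩ := Function.Embedding.nonempty_of_card_le h
    ⟨f, f.injective⟩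
  rw [someInj, dif_pos h']
  exact h'.choose_spec

open Classical in
/-- The position of `a` in a fixed enumeration of `T`. -/
noncomputable def rank {α : Type} (T : Finset α) (a : α) : ℕ :=
  if h : a ∈ T then T.equivFin ⟨a, h⟩ else 0

theorem rank_lt {α : Type} {T : Finset α} {a : α} (h : a ∈ T) : rank T a < T.card := by
  rw [rank, dif_pos h]; exact Fin.is_lt _

theorem rank_injOn {α : Type} (T : Finset α) : Set.InjOn (rank T) T := by
  intro a ha b hb h
  rw [rank, rank, dif_pos (mem_coe.1 ha), dif_pos (mem_coe.1 hb)] at h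
  simpa using T.equivFin.injective (Fin.ext h)

/-- Parameters: tokens have `d` bits, a block has at most `s` tokens, a node that knows more than
`g * s` undelivered tokens is heavy, `G` is the number of blocks that can be coded together, keys
are drawn from `Fin Q`, hash values from the field with `2 ^ r` elements, identifiers are smaller
than `U`, and `L`, `F`, `H` are the lengths of the flooding, forwarding and coding stages. -/
structure Par where
  d : ℕ
  s : ℕ
  g : ℕ
  G : ℕ
  Q : ℕ
  r : ℕ
  U : ℕ
  L : ℕ
  F : ℕ
  H : ℕ
  s_pos : 0 < s
  g_pos : 0 < g
  Q_pos : 0 < Q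
  U_pos : 0 < U
  r_ne : r ≠ 0

namespace Par

variable (p : Par)

instance : NeZero p.g := ⟨p.g_pos.ne'⟩
instance : NeZero p.Q := ⟨p.Q_pos.ne'⟩
instance : NeZero p.U := ⟨p.U_pos.ne'⟩

abbrev Tok : Type := Token p.d

/-- A set of at most `s` tokens. -/
abbrev Block : Type := {B : Finset p.Tok // B.card ≤ p.s}

/-- The field of the hash values. -/
abbrev Fd : Type := GaloisField 2 p.r

noncomputable instance : Fintype p.Fd := Fintype.ofFinite _

noncomputable instance : DecidableEq p.Fd := Classical.decEq _

/-- The vectors that are coded together: an index part, a block, and a hash value. -/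
abbrev Vec : Type := (Fin p.G → ZMod 2) × p.Fd × p.Fd

/-- The values that are flooded: the largest identifier of a heavy node, the largest identifier
of a node with undelivered tokens, the largest undelivered token, the largest key, the largest
seed, and a failure flag. -/
abbrev Fl : Type :=
  WithBot (Fin p.U) × WithBot (Fin p.U) × WithBot (Fin (Fintype.card p.Tok)) × WithBot (Fin p.Q) ×
    WithBot (Fin (Fintype.card p.Fd)) × Bool

abbrev Msg : Type := p.Block ⊕ p.Fl ⊕ p.Vec

/-- The random choice of a node in a round: a block number, keys, sampling values, a seed, and
coefficients. -/
@[ext]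
structure Coin where
  idx : Fin p.g
  key : Fin p.g → Fin p.Q
  smp : Fin p.g → Fin p.Q
  seed : Fin (Fintype.card p.Fd)
  coef : p.Vec → ZMod 2

instance : Nonempty (Fin (Fintype.card p.Fd)) := ⟨⟨0, Fintype.card_pos⟩⟩

def coinEquiv : p.Coin ≃ Fin p.g × (Fin p.g → Fin p.Q) × (Fin p.g → Fin p.Q) ×
    Fin (Fintype.card p.Fd) × (p.Vec → ZMod 2) where
  toFun x := (x.idx, x.key, x.smp, x.seed, x.coef)
  invFun y := ⟨y.1, y.2.1, y.2.2.1, y.2.2.2.1, y.2.2.2.2⟩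

noncomputable instance : Fintype p.Coin := Fintype.ofEquiv _ p.coinEquiv.symm

instance : Nonempty p.Coin := p.coinEquiv.symm.nonempty_congr.1 inferInstance

/-- The memory of a node. -/
structure Mem where
  uid : Fin p.U
  /-- known tokens that are not yet delivered -/
  T : Finset p.Tok
  /-- delivered tokens -/
  Del : Finset p.Tok
  /-- tokens are still being forwarded -/
  mode : Bool
  acc : p.Fl
  led : p.Fl
  smp : Fin p.g → Fin p.Q
  X : Finset p.Block
  R : Finset p.Vec
  D : Fin p.G → p.Block
  out : Option (Finset p.Tok)

/-- The kinds of rounds. -/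
inductive Kind
  | fwd | draw | flood | sample | code | lead | decode | finish

def phase : List Kind :=
  List.replicate p.F .fwd ++ ([.draw] ++ (List.replicate p.L .flood ++ ([.sample] ++
    (List.replicate p.H .code ++ ([.lead] ++ (List.replicate p.H .code ++ ([.decode] ++
      (List.replicate p.L .flood ++ [.finish]))))))))

theorem phase_ne_nil : p.phase ≠ [] := by simp [phase]

def emptyBlock : p.Block := ⟨∅, by simp⟩

open Classical in
/-- The `i`-th block of the token set `T`. -/
noncomputable def blk (T : Finset p.Tok) (i : ℕ) : p.Block :=
  ⟨T.filter fun τ => rank T τ / p.s = i, by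
    calc _ = ((T.filter fun τ => rank T τ / p.s = i).image (rank T)).card :=
          (card_image_of_injOn ((rank_injOn T).mono (coe_subset.2 (filter_subset _ _)))).symm
      _ ≤ (Finset.Ico (i * p.s) (i * p.s + p.s)).card := by
          refine card_le_card fun j hj => ?_
          obtain ⟨τ, hτ, rfl⟩ := mem_image.1 hj
          have h := (mem_filter.1 hτ).2
          have := Nat.div_add_mod (rank T τ) p.s
          have h2 := Nat.mod_lt (rank T τ) p.s_pos
          rw [h, mul_comm] at this
          rw [mem_Ico]
          omega
      _ = p.s := by simp⟩

/-- Blocks as elements of the field. -/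
noncomputable def toFd : p.Block → p.Fd := someInj _ _

/-- The vector of a block, with the hash value for the seed `a`. -/
noncomputable def hashVec (a : p.Fd) (B : p.Block) : p.Vec := (0, p.toFd B, (a + p.toFd B)⁻¹)

/-- The vector of a block, with an index. -/
noncomputable def idxVec (j : Fin p.G) (B : p.Block) : p.Vec := (Pi.single j 1, p.toFd B, 0)

/-- No sum of vectors of blocks in `X`, except the trivial ones, is the vector of a block. -/
def GoodSeed (a : p.Fd) (X : Finset p.Block) : Prop :=
  ∀ S ⊆ X, ∀ z : p.Block, ∑ B ∈ S, p.hashVec a B = p.hashVec a z → ∃ B, S = {B}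

noncomputable abbrev spanOf (R : Finset p.Vec) : Submodule (ZMod 2) p.Vec :=
  Submodule.span (ZMod 2) (R : Set p.Vec)

open Classical in
/-- All blocks whose vector is in the span of `R`. -/
noncomputable def decSet (a : p.Fd) (R : Finset p.Vec) : Finset p.Block :=
  univ.filter fun B => p.hashVec a B ∈ p.spanOf R

open Classical in
/-- An enumeration of `Y`, filled up with empty blocks. -/
noncomputable def enum (Y : Finset p.Block) : Fin p.G → p.Block :=
  if h : ∃ f : Fin p.G → p.Block,
      (∀ B ∈ Y, ∃ j, f j = B) ∧ ∀ j, f j ∈ Y ∨ f j = p.emptyBlock then h.choose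
  else fun _ => p.emptyBlock

noncomputable def tokCode : p.Tok ≃ Fin (Fintype.card p.Tok) := Fintype.equivFin _

open Classical in
/-- The token with the given code. -/
noncomputable def tokSet (i : WithBot (Fin (Fintype.card p.Tok))) : Finset p.Tok :=
  univ.filter fun τ => (p.tokCode τ : WithBot (Fin (Fintype.card p.Tok))) = i

/-- The seed in a flooded value. -/
noncomputable def seedOf (a : p.Fl) : p.Fd :=
  (Fintype.equivFin p.Fd).symm (WithBot.unbotD ⟨0, Fintype.card_pos⟩ a.2.2.2.2.1)

/-- A sampling value is selected if it is at least `Q - width`. -/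
def width (a : p.Fl) : ℕ := p.g * (p.Q - (WithBot.unbotD 0 a.2.2.2.1 : Fin p.Q))

def flag (f : Bool) : p.Fl := (⊥, ⊥, ⊥, ⊥, ⊥, f)

open Classical in
noncomputable def recvTok (M : Multiset p.Msg) : Finset p.Tok :=
  M.toFinset.biUnion fun μ => match μ with
    | .inl B => B.1
    | _ => ∅

noncomputable def recvFl (M : Multiset p.Msg) : p.Fl :=
  (M.map fun μ => match μ with
    | .inr (.inl a) => a
    | _ => (⊥ : p.Fl)).sup

open Classical in
noncomputable def recvVec (M : Multiset p.Msg) : Finset p.Vec :=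
  M.toFinset.biUnion fun μ => match μ with
    | .inr (.inr w) => {w}
    | _ => ∅

variable {p}

/-- The message of a node. -/
noncomputable def msg (k : Kind) (m : p.Mem) (x : p.Coin) : p.Msg :=
  match k with
  | .fwd => .inl (p.blk m.T x.idx)
  | .flood => .inr (.inl m.acc)
  | .code => .inr (.inr (∑ w ∈ m.R, x.coef w • w))
  | _ => .inl p.emptyBlock

/-! ### State changes of a single node -/

namespace Mem

variable (m : p.Mem)

open Classical in
/-- What a node contributes to the first flooding of a phase. -/
noncomputable def drawn (x : p.Coin) : p.Fl :=
  (if p.g * p.s < m.T.card then (m.uid : WithBot (Fin p.U)) else ⊥,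
    if m.T.Nonempty then (m.uid : WithBot (Fin p.U)) else ⊥,
    m.T.sup fun τ => (p.tokCode τ : WithBot (Fin (Fintype.card p.Tok))),
    (univ.filter fun i : Fin p.g => (p.blk m.T i).1.Nonempty).sup fun i =>
      (x.key i : WithBot (Fin p.Q)),
    (x.seed : WithBot (Fin (Fintype.card p.Fd))), false)

open Classical in
/-- The sampled blocks. -/
noncomputable def sampled : Finset p.Block :=
  if m.acc.1 = ⊥ then
    (univ.filter fun i : Fin p.g =>
      (p.blk m.T i).1.Nonempty ∧ p.Q ≤ m.smp i + p.width m.acc).image fun i : Fin p.g => p.blk m.T i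
  else ∅

-- Forwarding stops for good in the first phase without heavy nodes; the flooded value makes this
-- decision common to all nodes.
open Classical in
noncomputable def doSample : p.Mem :=
  { m with
    led := m.acc
    mode := m.mode && decide (m.acc.1 ≠ ⊥)
    X := m.sampled
    R := m.sampled.image (p.hashVec (p.seedOf m.acc)) }

open Classical in
/-- The identifier of the node that broadcasts. -/
noncomputable def leader : WithBot (Fin p.U) := if m.led.1 = ⊥ then m.led.2.1 else m.led.1

open Classical in
/-- The blocks that a leader broadcasts. -/
noncomputable def bcast : Fin p.G → p.Block :=
  if m.led.1 = ⊥ then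
    -- The leader does not know the selected set, so goodness is tested on all candidates in its
    -- span. This test is part of what makes the output certain.
    if p.GoodSeed (p.seedOf m.led) (p.decSet (p.seedOf m.led) m.R) then
      p.enum (p.decSet (p.seedOf m.led) m.R)
    else fun _ => p.emptyBlock
  else fun j => if (j : ℕ) < p.g then p.blk m.T j else p.emptyBlock

open Classical in
noncomputable def doLead : p.Mem :=
  { m with
    R := if m.leader = m.uid then univ.image fun j => p.idxVec j (m.bcast j) else ∅ }

open Classical in
noncomputable def decoded (j : Fin p.G) : p.Block :=
  if h : ∃ B, p.idxVec j B ∈ p.spanOf m.R then h.choose else p.emptyBlock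

/-- Together with the leader's test of the seed, the second clause certifies that the broadcast set
is exactly the selected set. -/
def DecodeOk : Prop :=
  (∀ j, ∃ B, p.idxVec j B ∈ p.spanOf m.R) ∧ ∀ B ∈ m.X, ∃ j, m.decoded j = B

open Classical in
noncomputable def doDecode : p.Mem :=
  { m with
    D := m.decoded
    acc := p.flag (decide (¬ m.DecodeOk)) }

open Classical in
/-- The tokens that are delivered in a phase. -/
noncomputable def removed : Finset p.Tok :=
  (if m.acc.2.2.2.2.2 then ∅ else univ.biUnion fun j => (m.D j).1) ∪ p.tokSet m.led.2.2.1

open Classical in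
-- Both the value tested here and the removed set agree at all nodes, so all nodes terminate in the
-- same round.
noncomputable def doFinish : p.Mem :=
  if m.led.2.1 = ⊥ then { m with out := some m.Del }
  else { m with T := m.T \ m.removed, Del := m.Del ∪ m.removed }

end Mem

open Classical in
/-- The new memory of a node. -/
noncomputable def upd (k : Kind) (m : p.Mem) (x : p.Coin) (M : Multiset p.Msg) : p.Mem :=
  match k with
  | .fwd => { m with T := if m.mode then m.T ∪ p.recvTok M else m.T }
  | .draw => { m with acc := m.drawn x, smp := x.smp }
  | .flood => { m with acc := m.acc ⊔ p.recvFl M }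
  | .sample => m.doSample
  | .code => { m with R := m.R ∪ p.recvVec M }
  | .lead => m.doLead
  | .decode => m.doDecode
  | .finish => m.doFinish

variable (p)

/-- The kind of round `t`. -/
def sched (t : ℕ) : Kind :=
  p.phase[t % p.phase.length]'(Nat.mod_lt _ (List.length_pos_of_ne_nil p.phase_ne_nil))

def initMem (u : ℕ) (S : Finset p.Tok) : p.Mem where
  uid := Fin.ofNat p.U u
  T := S
  Del := ∅
  mode := true
  acc := ⊥
  led := ⊥
  smp := fun _ => 0
  X := ∅
  R := ∅
  D := fun _ => p.emptyBlock
  out := none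

noncomputable def enc (b : ℕ) : p.Msg → Message b := someInj _ _

instance : Nonempty p.Msg := ⟨.inl p.emptyBlock⟩

noncomputable def dec (b : ℕ) : Message b → p.Msg := Function.invFun (p.enc b)

/-- The algorithm with `b`-bit messages. -/
noncomputable def machine (b : ℕ) : Algorithm b p.d where
  State := ℕ × p.Mem
  Coin := p.Coin
  coinFintype := inferInstance
  coinNonempty := inferInstance
  init u S := (0, p.initMem u S)
  message s x := p.enc b (msg (p.sched s.1) s.2 x)
  update s x M := (s.1 + 1, upd (p.sched s.1) s.2 x (M.map (p.dec b)))
  output s := s.2.out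

variable {p} {n : ℕ}

open Classical in
/-- A round of kind `k` on the graph `G`. -/
noncomputable def gstep (k : Kind) (G : SimpleGraph (Fin n)) (m : Fin n → p.Mem)
    (x : Fin n → p.Coin) : Fin n → p.Mem := fun v =>
  if (m v).out.isSome then m v
  else upd k (m v) (x v)
    ((univ.filter fun w => G.Adj v w ∧ ¬ (m w).out.isSome).val.map fun w => msg k (m w) (x w))

variable (p)

/-- The kinds of the first `t` rounds. -/
def pre : ℕ → List Kind
  | 0 => []
  | t + 1 => pre t ++ [p.sched t]

variable {p}

/-! ### From executions of the machine to upper expectations -/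

section Simulation

variable {b : ℕ} (uid : Fin n → ℕ)
  (tok : Fin n → Finset (Token p.d)) (adv : Adversary n p.Coin)

/-- The memories of all nodes after `t` rounds. -/
noncomputable def mems (b : ℕ) (t : ℕ) (x : Fin t → Fin n → p.Coin) (v : Fin n) : p.Mem :=
  ((p.machine b).run uid tok adv t x v).2

/-- The clock of a terminated node stands still, hence the hypothesis. All running nodes thus agree
on the kind of the round. -/
theorem run_clock (t : ℕ) (x : Fin t → Fin n → p.Coin) (v : Fin n)
    (h : (mems uid tok adv b t x v).out.isSome = false) :
    ((p.machine b).run uid tok adv t x v).1 = t := by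
  induction t generalizing v with
  | zero => rfl
  | succ t ih =>
    have h0 := h
    simp only [mems, Algorithm.run, Algorithm.step] at h
    simp only [Algorithm.run, Algorithm.step]
    split_ifs at h ⊢ with hh
    · exfalso
      have hh' : ((p.machine b).run uid tok adv t (Fin.init x) v).2.out.isSome = true := hh
      exact Bool.false_ne_true (h.symm.trans hh')
    · have hh' : ¬ ((p.machine b).run uid tok adv t (Fin.init x) v).2.out.isSome = true := hh
      exact congrArg (· + 1) (ih (Fin.init x) v ((Bool.not_eq_true _).mp hh'))

theorem mems_succ (henc : Function.Injective (p.enc b)) (t : ℕ) (x : Fin (t + 1) → Fin n → p.Coin) :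
    mems uid tok adv b (t + 1) x =
      gstep (p.sched t) (adv.graph t (Fin.init x)) (mems uid tok adv b t (Fin.init x))
        (x (Fin.last t)) := by
  classical
  funext v
  have hc := run_clock (b := b) uid tok adv t (Fin.init x)
  set s := (p.machine b).run uid tok adv t (Fin.init x) with hs
  have hm : ∀ w, mems uid tok adv b t (Fin.init x) w = (s w).2 := fun w => rfl
  simp only [hm] at hc
  have hH : ∀ w, (p.machine b).Halted (s w) ↔ (s w).2.out.isSome = true := fun w => Iff.rfl
  change (Algorithm.step (p.machine b) _ s _ v).2 = _
  simp only [Algorithm.step, gstep, hm]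
  by_cases h : (s v).2.out.isSome = true
  · rw [if_pos ((hH v).2 h), if_pos h]
  · rw [if_neg (fun h' => h ((hH v).1 h')), if_neg h]
    change upd (p.sched (s v).1) (s v).2 (x (Fin.last t) v) _ = _
    rw [hc v (by simpa using h)]
    refine congrArg (upd (p.sched t) (s v).2 (x (Fin.last t) v)) ?_
    refine (Multiset.map_map _ _ _).trans ?_
    have hf : (univ.filter fun w => (adv.graph t (Fin.init x)).Adj v w ∧
        ¬ (p.machine b).Halted (s w)) = univ.filter fun w =>
          (adv.graph t (Fin.init x)).Adj v w ∧ ¬ (s w).2.out.isSome = true := by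
      ext w; simp [hH]
    refine Multiset.map_congr (congrArg Finset.val hf) fun w hw => ?_
    have hw' : ¬ (s w).2.out.isSome = true := (hH w).not.1 (mem_filter.1 (mem_def.2 hw)).2.2
    change p.dec b (p.enc b (msg (p.sched (s w).1) (s w).2 _)) = _
    rw [hc w (by simpa using hw'), dec, Function.leftInverse_invFun henc]

theorem mems_reach (henc : Function.Injective (p.enc b)) (t : ℕ) (x : Fin t → Fin n → p.Coin) :
    Reach gstep (p.pre t) (fun v => p.initMem (uid v) (tok v)) (mems uid tok adv b t x) := by
  induction t with
  | zero => rfl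
  | succ t ih =>
    rw [pre, Reach.append]
    refine ⟨_, ih (Fin.init x), ⟨_, adv.connected t (Fin.init x)⟩, x (Fin.last t), ?_⟩
    exact mems_succ uid tok adv henc t x

/-- The graph of the last round depends on the past but not on the coins of that round. Splitting
these coins off leaves a fixed graph for each past, which the supremum in `upper` covers. -/
theorem expect_mems_le (henc : Function.Injective (p.enc b)) (t : ℕ) (f : (Fin n → p.Mem) → ℝ) [Nonempty (CGraph n)] :
    𝔼 x : Fin t → Fin n → p.Coin, f (mems uid tok adv b t x) ≤
      upper gstep (p.pre t) f (fun v => p.initMem (uid v) (tok v)) := by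
  induction t generalizing f with
  | zero =>
    rw [Fintype.expect_eq_sum_div_card]
    simp only [pre, upper, Fintype.card_unique, Finset.univ_unique, sum_singleton]
    simp only [Nat.cast_one, div_one]
    exact le_rfl
  | succ t ih =>
    rw [pre, upper_append]
    calc 𝔼 x : Fin (t + 1) → Fin n → p.Coin, f (mems uid tok adv b (t + 1) x)
        = 𝔼 y : (Fin n → p.Coin) × (Fin t → Fin n → p.Coin),
            f (gstep (p.sched t) (adv.graph t y.2) (mems uid tok adv b t y.2) y.1) := by
          refine (Fintype.expect_equiv (Fin.snocEquiv fun _ => Fin n → p.Coin) _ _ fun y => ?_).symm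
          rw [mems_succ uid tok adv henc]
          simp [Fin.snocEquiv]
      _ = 𝔼 x : Fin t → Fin n → p.Coin, 𝔼 y : Fin n → p.Coin,
            f (gstep (p.sched t) (adv.graph t x) (mems uid tok adv b t x) y) := by
          rw [← univ_product_univ, expect_product, expect_comm]
      _ ≤ 𝔼 x : Fin t → Fin n → p.Coin, upper gstep [p.sched t] f (mems uid tok adv b t x) :=
          expect_le_expect fun x _ =>
            expect_le_upper_cons (p.sched t) [] f _ ⟨adv.graph t x, adv.connected t x⟩
      _ ≤ _ := ih _

theorem one_sub_upper_le_haltProb (henc : Function.Injective (p.enc b)) (t : ℕ) [Nonempty (CGraph n)] :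
    1 - upper gstep (p.pre t) (fun m => ind (¬ ∀ v, (m v).out.isSome = true))
      (fun v => p.initMem (uid v) (tok v)) ≤ (p.machine b).haltProb uid tok adv t := by
  have h := expect_mems_le uid tok adv henc t
    (fun m => ind (¬ ∀ v, (m v).out.isSome = true))
  have h2 : (p.machine b).haltProb uid tok adv t = 1 - 𝔼 x : Fin t → Fin n → p.Coin,
      ind (¬ ∀ v, (mems uid tok adv b t x v).out.isSome = true) := by
    classical
    have h3 : (p.machine b).haltProb uid tok adv t =
        (Nat.card {x : Fin t → Fin n → p.Coin //
          ∀ v, (mems uid tok adv b t x v).out.isSome = true} : ℝ) /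
          (Nat.card (Fin t → Fin n → p.Coin) : ℝ) := rfl
    have h4 : (1 : ℝ) = 𝔼 _x : Fin t → Fin n → p.Coin, (1 : ℝ) := (Fintype.expect_const _).symm
    conv_rhs => rw [h4]
    rw [h3, ← expect_sub_distrib, Fintype.expect_eq_sum_div_card]
    congr 1
    · rw [Nat.card_eq_fintype_card, Fintype.card_subtype, card_filter, Nat.cast_sum]
      refine sum_congr rfl fun x _ => ?_
      by_cases hx : ∀ v, (mems uid tok adv b t x v).out.isSome = true
      · rw [if_pos hx, ind_neg (not_not.2 hx)]; simp
      · rw [if_neg hx, ind_pos hx]; simp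
    · rw [Nat.card_eq_fintype_card]
  rw [h2]
  linarith

end Simulation

end Par

/-! ### Hash values -/

open Classical in
/-- Since reciprocals of distinct linear functions are linearly independent, a sum of reciprocals
is rarely a reciprocal. -/
theorem card_sum_inv_eq_inv_le {F : Type*} [Field F] [Fintype F] (S : Finset F) (hS : S.card ≠ 1) :
    (univ.filter fun a : F => ∑ x ∈ S, (a + x)⁻¹ = (a + ∑ x ∈ S, x)⁻¹).card ≤ 2 * S.card + 1 := by
  set z := ∑ x ∈ S, x with hz
  -- The equation with denominators cleared; it is equivalent to the original one away from the
  -- poles.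
  set P : Polynomial F := (Polynomial.X + Polynomial.C z) *
    (∑ x ∈ S, ∏ y ∈ S.erase x, (Polynomial.X + Polynomial.C y)) -
      ∏ y ∈ S, (Polynomial.X + Polynomial.C y) with hP
  have heval : ∀ a, P.eval a =
      (a + z) * (∑ x ∈ S, ∏ y ∈ S.erase x, (a + y)) - ∏ y ∈ S, (a + y) := fun a => by
    simp [hP, Polynomial.eval_finsetSum, Polynomial.eval_prod]
  have hP0 : P ≠ 0 := by
    intro h0
    rcases S.eq_empty_or_nonempty with rfl | hne
    · have := heval 0
      rw [h0] at this
      simp at this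
    -- At -x₀ all products vanish except the one that omits x₀, and the factor x₀ - z cannot vanish
    -- either; so P is not the zero polynomial. Such an x₀ needs at least two elements, and a
    -- singleton satisfies the equation identically.
    · obtain ⟨x₀, hx₀, hne'⟩ : ∃ x₀ ∈ S, x₀ ≠ z :=
        Finset.exists_mem_ne (by have := hne.card_pos; omega) z
      have h1 := heval (-x₀)
      rw [h0, Polynomial.eval_zero, Finset.prod_eq_zero hx₀ (by simp), sub_zero,
        Finset.sum_eq_single x₀] at h1
      · rcases mul_eq_zero.1 h1.symm with h2 | h2
        · exact hne' (by linear_combination -h2)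
        · obtain ⟨y, hy, hy0⟩ := Finset.prod_eq_zero_iff.1 h2
          exact (mem_erase.1 hy).1 (by linear_combination hy0)
      · intro x hx hxx
        exact Finset.prod_eq_zero (mem_erase.2 ⟨hxx.symm, hx₀⟩) (by simp)
      · intro h; exact absurd hx₀ h
  have hdegp : ∀ s : Finset F, (∏ y ∈ s, (Polynomial.X + Polynomial.C y)).natDegree ≤ s.card :=
    fun s => (Polynomial.natDegree_prod_le _ _).trans (by simp)
  have hdeg : P.natDegree ≤ S.card := by
    refine (Polynomial.natDegree_sub_le _ _).trans (max_le ?_ (hdegp S))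
    rcases S.eq_empty_or_nonempty with rfl | hne
    · simp
    · refine Polynomial.natDegree_mul_le.trans ?_
      have h1 : (∑ x ∈ S, ∏ y ∈ S.erase x, (Polynomial.X + Polynomial.C y)).natDegree ≤
          S.card - 1 :=
        Polynomial.natDegree_sum_le_of_forall_le _ _ fun x hx =>
          (hdegp _).trans (card_erase_of_mem hx).le
      have := hne.card_pos
      rw [Polynomial.natDegree_X_add_C]
      omega
  -- At most |S| roots, plus the poles, where the convention 0⁻¹ = 0 makes the equation meaningless.
  have hsub : (univ.filter fun a : F => ∑ x ∈ S, (a + x)⁻¹ = (a + z)⁻¹) ⊆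
      P.roots.toFinset ∪ (S.image (fun x => -x) ∪ {-z}) := by
    intro a ha
    have ha := (mem_filter.1 ha).2
    by_cases h1 : a ∈ S.image (fun x => -x) ∪ {-z}
    · exact mem_union_right _ h1
    · refine mem_union_left _ ?_
      simp only [mem_union, mem_image, mem_singleton, not_or, not_exists, not_and] at h1
      have hx : ∀ x ∈ S, a + x ≠ 0 := fun x hx h => h1.1 x hx (by linear_combination -h)
      have hz' : a + z ≠ 0 := fun h => h1.2 (by linear_combination h)
      rw [Multiset.mem_toFinset, Polynomial.mem_roots hP0, Polynomial.IsRoot, heval]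
      have h2 : ∑ x ∈ S, ∏ y ∈ S.erase x, (a + y) =
          (∏ y ∈ S, (a + y)) * ∑ x ∈ S, (a + x)⁻¹ := by
        rw [mul_sum]
        refine sum_congr rfl fun x hx' => ?_
        rw [← mul_prod_erase S _ hx']
        field_simp [hx x hx']
      rw [h2, ha]
      field_simp
      ring
  calc _ ≤ (P.roots.toFinset ∪ (S.image (fun x => -x) ∪ {-z})).card := card_le_card hsub
    _ ≤ P.roots.toFinset.card + ((S.image (fun x => -x)).card + 1) :=
        (card_union_le _ _).trans (Nat.add_le_add_left (card_union_le _ _) _)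
    _ ≤ S.card + (S.card + 1) := by
        have h1 : P.roots.toFinset.card ≤ S.card :=
          (Multiset.toFinset_card_le _).trans ((Polynomial.card_roots' P).trans hdeg)
        have h2 : (S.image (fun x => -x)).card ≤ S.card := card_image_le
        omega
    _ = _ := by ring

/-! ### Blocks -/

theorem exists_rank_eq {α : Type} (T : Finset α) {i : ℕ} (hi : i < T.card) :
    ∃ a ∈ T, rank T a = i := by
  refine ⟨(T.equivFin.symm ⟨i, hi⟩ : T), (T.equivFin.symm ⟨i, hi⟩).2, ?_⟩
  rw [rank, dif_pos (T.equivFin.symm ⟨i, hi⟩).2]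
  simp

namespace Par

variable {p : Par}

theorem mem_blk {T : Finset p.Tok} {i : ℕ} {τ : p.Tok} :
    τ ∈ (p.blk T i).1 ↔ τ ∈ T ∧ rank T τ / p.s = i := by
  classical
  simp [blk]

theorem exists_mem_blk {T : Finset p.Tok} (hT : T.card ≤ p.g * p.s) {τ : p.Tok} (hτ : τ ∈ T) :
    ∃ i : Fin p.g, τ ∈ (p.blk T i).1 := by
  have h := (rank_lt hτ).trans_le hT
  exact ⟨⟨rank T τ / p.s, Nat.div_lt_of_lt_mul (by rwa [mul_comm])⟩, mem_blk.2 ⟨hτ, rfl⟩⟩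

open Classical in
theorem card_nonempty_blk_le (T : Finset p.Tok) :
    (univ.filter fun i : Fin p.g => (p.blk T i).1.Nonempty).card ≤ T.card / p.s + 1 := by
  calc _ = ((univ.filter fun i : Fin p.g => (p.blk T i).1.Nonempty).image
          (fun i : Fin p.g => (i : ℕ))).card :=
        (card_image_of_injective _ Fin.val_injective).symm
    _ ≤ (range (T.card / p.s + 1)).card := by
        refine card_le_card fun j hj => ?_
        obtain ⟨i, hi, rfl⟩ := mem_image.1 hj
        obtain ⟨τ, hτ⟩ := (mem_filter.1 hi).2
        obtain ⟨hτ, h⟩ := mem_blk.1 hτ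
        rw [mem_range, ← h]
        exact Nat.lt_succ_of_le (Nat.div_le_div_right (rank_lt hτ).le)
    _ = _ := card_range _

open Classical in
-- Ranks enumerate T without gaps, and the ranks below g·s are exactly those of the first g blocks.
theorem le_card_biUnion_blk {T : Finset p.Tok} (hT : p.g * p.s ≤ T.card) :
    p.g * p.s ≤ (univ.biUnion fun i : Fin p.g => (p.blk T i).1).card := by
  calc p.g * p.s = (range (p.g * p.s)).card := (card_range _).symm
    _ ≤ ((univ.biUnion fun i : Fin p.g => (p.blk T i).1).image (rank T)).card := by
        refine card_le_card fun j hj => ?_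
        rw [mem_range] at hj
        obtain ⟨τ, hτ, rfl⟩ := exists_rank_eq T (hj.trans_le hT)
        refine mem_image_of_mem _ (mem_biUnion.2 ⟨⟨rank T τ / p.s, ?_⟩, mem_univ _,
          mem_blk.2 ⟨hτ, rfl⟩⟩)
        exact Nat.div_lt_of_lt_mul (by rwa [mul_comm])
    _ ≤ _ := card_image_le

theorem enum_spec {Y : Finset p.Block} (hY : Y.card ≤ p.G) :
    (∀ B ∈ Y, ∃ j, p.enum Y j = B) ∧ ∀ j, p.enum Y j ∈ Y ∨ p.enum Y j = p.emptyBlock := by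
  classical
  have h : ∃ f : Fin p.G → p.Block,
      (∀ B ∈ Y, ∃ j, f j = B) ∧ ∀ j, f j ∈ Y ∨ f j = p.emptyBlock := by
    refine ⟨fun j => if h : (j : ℕ) < Y.card then (Y.equivFin.symm ⟨j, h⟩ : Y) else p.emptyBlock,
      fun B hB => ?_, fun j => ?_⟩
    · refine ⟨⟨Y.equivFin ⟨B, hB⟩, (Fin.is_lt _).trans_le hY⟩, ?_⟩
      simp
    · dsimp only
      split_ifs with h
      · exact Or.inl (Y.equivFin.symm ⟨j, h⟩).2
      · exact Or.inr rfl
  rw [enum, dif_pos h]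
  exact h.choose_spec

theorem enum_mem (Y : Finset p.Block) (j : Fin p.G) :
    p.enum Y j ∈ Y ∨ p.enum Y j = p.emptyBlock := by
  classical
  rw [enum]
  split_ifs with h
  · exact h.choose_spec.2 j
  · exact Or.inr rfl

/-! ### Linear algebra -/

/-- Over the field with two elements a linear combination is a subset sum, and a good seed allows
only one-element subsets. Goodness is assumed for a superset Y since this is what the leader can
test. -/
theorem GoodSeed.mem_of_mem_span {a : p.Fd} {X Y : Finset p.Block} (hY : p.GoodSeed a Y)
    (hinj : Function.Injective p.toFd) (hXY : X ⊆ Y) {B : p.Block}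
    (hB : p.hashVec a B ∈ p.spanOf (X.image (p.hashVec a))) : B ∈ X := by
  classical
  have hinj' : Function.Injective (p.hashVec a) := fun B B' h => by
    simp only [hashVec, Prod.mk.injEq] at h
    exact hinj h.2.1
  obtain ⟨f, -, hf⟩ := Submodule.mem_span_finset.1 hB
  rw [sum_image hinj'.injOn] at hf
  have h01 : ∀ c : ZMod 2, c = 0 ∨ c = 1 := by decide
  have hs : ∑ B ∈ X.filter (fun B => f (p.hashVec a B) = 1), p.hashVec a B = p.hashVec a B := by
    rw [← hf, sum_filter]
    refine sum_congr rfl fun C _ => ?_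
    rcases h01 (f (p.hashVec a C)) with h | h <;> simp [h]
  obtain ⟨C, hC⟩ := hY _ ((filter_subset _ _).trans hXY) B hs
  rw [hC, sum_singleton] at hs
  have hCX : C ∈ X.filter (fun B => f (p.hashVec a B) = 1) := by rw [hC]; simp
  exact hinj' hs ▸ (mem_filter.1 hCX).1

theorem eq_of_idxVec_mem_span {D : Fin p.G → p.Block} (hinj : Function.Injective p.toFd)
    {R : Finset p.Vec} (hR : ∀ w ∈ R, w ∈ p.spanOf (univ.image fun j => p.idxVec j (D j)))
    {j : Fin p.G} {B : p.Block} (hB : p.idxVec j B ∈ p.spanOf R) : B = D j := by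
  classical
  -- φ(e, f, h) = f - ∑ eᵢ · D i kills every broadcast vector, hence the whole span, and takes the
  -- value B - D j at the vector of B with index j.
  let φ : p.Vec →ₗ[ZMod 2] p.Fd :=
    LinearMap.fst (ZMod 2) p.Fd p.Fd ∘ₗ LinearMap.snd (ZMod 2) _ _ -
      (∑ i, (LinearMap.proj i : (Fin p.G → ZMod 2) →ₗ[ZMod 2] ZMod 2).smulRight (p.toFd (D i))) ∘ₗ
        LinearMap.fst (ZMod 2) _ _
  have hφ : ∀ j B, φ (p.idxVec j B) = p.toFd B - p.toFd (D j) := fun j B => by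
    simp [φ, idxVec, Pi.single_apply]
  have h1 : p.spanOf (univ.image fun j => p.idxVec j (D j)) ≤ LinearMap.ker φ := by
    refine Submodule.span_le.2 fun w hw => ?_
    obtain ⟨i, -, rfl⟩ := mem_image.1 (mem_coe.1 hw)
    simp [hφ]
  have h2 : p.spanOf R ≤ LinearMap.ker φ := Submodule.span_le.2 fun w hw => h1 (hR w hw)
  have h3 : φ (p.idxVec j B) = 0 := h2 hB
  rw [hφ, sub_eq_zero] at h3
  exact hinj h3

/-- Union bound over the subsets S that are not singletons. The second component of a relation
forces z to be the sum of S, so the third is the equation bounded in `card_sum_inv_eq_inv_le`. -/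
theorem card_not_goodSeed_le (hinj : Function.Injective p.toFd) {X : Finset p.Block}
    (hX : X.card ≤ p.G) [DecidablePred fun a => ¬ p.GoodSeed a X] :
    (univ.filter fun a : p.Fd => ¬ p.GoodSeed a X).card ≤ 2 ^ p.G * (2 * p.G + 1) := by
  classical
  calc _ ≤ ((X.powerset.filter fun S => S.card ≠ 1).biUnion fun S =>
        univ.filter fun a : p.Fd => ∑ x ∈ S.image p.toFd, (a + x)⁻¹ =
          (a + ∑ x ∈ S.image p.toFd, x)⁻¹).card := by
        refine card_le_card fun a ha => ?_
        have ha := (mem_filter.1 ha).2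
        simp only [GoodSeed] at ha
        push Not at ha
        obtain ⟨S, hS, z, hz, hne⟩ := ha
        refine mem_biUnion.2 ⟨S, mem_filter.2 ⟨mem_powerset.2 hS, ?_⟩, mem_filter.2 ⟨mem_univ _, ?_⟩⟩
        · intro h
          obtain ⟨B, hB⟩ := card_eq_one.1 h
          exact hne B hB
        · rw [sum_image hinj.injOn, sum_image hinj.injOn]
          have h1 := congrArg (fun w : p.Vec => w.2.1) hz
          have h2 := congrArg (fun w : p.Vec => w.2.2) hz
          simp only [Prod.snd_sum, Prod.fst_sum, hashVec] at h1 h2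
          rw [h2, h1]
    _ ≤ ∑ S ∈ X.powerset.filter fun S => S.card ≠ 1, (2 * p.G + 1) := by
        refine card_biUnion_le.trans (sum_le_sum fun S hS => ?_)
        obtain ⟨hS, h1⟩ := mem_filter.1 hS
        have hc : (S.image p.toFd).card = S.card := card_image_of_injective _ hinj
        refine (card_sum_inv_eq_inv_le _ (by rwa [hc])).trans ?_
        have := card_le_card (mem_powerset.1 hS)
        omega
    _ ≤ ∑ S ∈ X.powerset, (2 * p.G + 1) := sum_le_sum_of_subset (filter_subset _ _)
    _ = 2 ^ X.card * (2 * p.G + 1) := by rw [sum_const, card_powerset, smul_eq_mul]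
    _ ≤ _ := Nat.mul_le_mul_right _ (Nat.pow_le_pow_right (by norm_num) hX)

end Par

/-! ### Expectations over product spaces -/

theorem expect_eval {ι Ω : Type} [Fintype ι] [DecidableEq ι] [Fintype Ω] [Nonempty Ω] (w : ι)
    (f : Ω → ℝ) : 𝔼 x : ι → Ω, f (x w) = 𝔼 y, f y := by
  rw [Fintype.expect_equiv (Equiv.funSplitAt w Ω) (fun x => f (x w)) (fun y => f y.1)
    (fun x => by simp [Equiv.funSplitAt]), ← univ_product_univ, expect_product]
  simp

theorem expect_ind_eq {Ω : Type} [Fintype Ω] (i : Ω) :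
    (𝔼 y : Ω, ind (y = i)) = 1 / Fintype.card Ω := by
  classical
  rw [Fintype.expect_eq_sum_div_card]
  simp [ind]

/-- Averaging over the pairs x, e x. -/
theorem expect_half_of_flip {Ω : Type} [Fintype Ω] [Nonempty Ω] (e : Ω ≃ Ω) (f : Ω → ℝ)
    (h : ∀ x, f x + f (e x) = 1) : 𝔼 x, f x = 1 / 2 := by
  have h1 : 𝔼 x, f (e x) = 𝔼 x, f x := Fintype.expect_equiv e _ _ fun _ => rfl
  have h2 : 𝔼 x, (f x + f (e x)) = 1 := by simp [h]
  rw [expect_add_distrib, h1] at h2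
  linarith

namespace Par

variable {p : Par} {n : ℕ}

theorem expect_coin_idx (f : Fin p.g → ℝ) : 𝔼 y : p.Coin, f y.idx = 𝔼 i, f i := by
  rw [Fintype.expect_equiv p.coinEquiv (fun y => f y.idx) (fun y => f y.1) (fun _ => rfl),
    ← univ_product_univ, expect_product]
  simp

theorem expect_coin_coef (f : (p.Vec → ZMod 2) → ℝ) : 𝔼 y : p.Coin, f y.coef = 𝔼 i, f i := by
  rw [Fintype.expect_equiv p.coinEquiv (fun y => f y.coef) (fun y => f y.2.2.2.2) (fun _ => rfl)]
  simp only [← univ_product_univ, expect_product]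
  simp

/-- No node has terminated. -/
def Running (m : Fin n → p.Mem) : Prop := ∀ v, (m v).out = none

open Classical in
/-- The messages that `v` receives if no node has terminated. -/
noncomputable def inbox (k : Kind) (G : SimpleGraph (Fin n)) (m : Fin n → p.Mem)
    (x : Fin n → p.Coin) (v : Fin n) : Multiset p.Msg :=
  (univ.filter fun w => G.Adj v w).val.map fun w => msg k (m w) (x w)

theorem gstep_apply {m : Fin n → p.Mem} (hm : Running m) (k : Kind) (G : SimpleGraph (Fin n))
    (x : Fin n → p.Coin) (v : Fin n) :
    gstep k G m x v = upd k (m v) (x v) (inbox k G m x v) := by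
  classical
  have hf : (univ.filter fun w => G.Adj v w ∧ ¬ (m w).out.isSome) =
      univ.filter fun w => G.Adj v w := by
    ext w; simp [hm w]
  rw [gstep, if_neg (by simp [hm v]), inbox]
  convert rfl using 4
  convert hf.symm

theorem mem_inbox {k : Kind} {G : SimpleGraph (Fin n)} {m : Fin n → p.Mem}
    {x : Fin n → p.Coin} {v : Fin n} {μ : p.Msg} :
    μ ∈ inbox k G m x v ↔ ∃ w, G.Adj v w ∧ msg k (m w) (x w) = μ := by
  classical
  simp [inbox]

theorem mem_recvTok_inbox {G : SimpleGraph (Fin n)} {m : Fin n → p.Mem}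
    {x : Fin n → p.Coin} {v : Fin n} {τ : p.Tok} :
    τ ∈ p.recvTok (inbox .fwd G m x v) ↔
      ∃ w, G.Adj v w ∧ τ ∈ (p.blk (m w).T (x w).idx).1 := by
  classical
  simp only [recvTok, mem_biUnion, Multiset.mem_toFinset, mem_inbox, msg]
  constructor
  · rintro ⟨_, ⟨w, hw, rfl⟩, h⟩
    exact ⟨w, hw, h⟩
  · rintro ⟨w, hw, h⟩
    exact ⟨_, ⟨w, hw, rfl⟩, h⟩

theorem mem_recvVec_inbox {G : SimpleGraph (Fin n)} {m : Fin n → p.Mem}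
    {x : Fin n → p.Coin} {v : Fin n} {e : p.Vec} :
    e ∈ p.recvVec (inbox .code G m x v) ↔
      ∃ w, G.Adj v w ∧ e = ∑ w' ∈ (m w).R, (x w).coef w' • w' := by
  classical
  simp only [recvVec, mem_biUnion, Multiset.mem_toFinset, mem_inbox, msg]
  constructor
  · rintro ⟨_, ⟨w, hw, rfl⟩, h⟩
    exact ⟨w, hw, by simpa using h⟩
  · rintro ⟨w, hw, h⟩
    exact ⟨_, ⟨w, hw, rfl⟩, by simpa using h⟩

theorem recvFl_inbox_le {G : SimpleGraph (Fin n)} {m : Fin n → p.Mem}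
    {x : Fin n → p.Coin} {v : Fin n} {a : p.Fl} :
    p.recvFl (inbox .flood G m x v) ≤ a ↔ ∀ w, G.Adj v w → (m w).acc ≤ a := by
  classical
  simp only [recvFl, Multiset.sup_le, Multiset.mem_map, mem_inbox, msg]
  constructor
  · intro h w hw
    exact h _ ⟨_, ⟨w, hw, rfl⟩, rfl⟩
  · rintro h _ ⟨_, ⟨w, hw, rfl⟩, rfl⟩
    exact h w hw

/-! ### Flooding -/

/-- For each u, the nodes whose value dominates that of u increase by one per round in any connected
graph, so n rounds give the supremum everywhere. The final state depends neither on the graphs nor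
on coins, so the adversary gains nothing here. -/
theorem flood_reach {L : ℕ} (hL : n ≤ L) {m m' : Fin n → p.Mem} (hm : Running m)
    (h : Reach gstep (List.replicate L Kind.flood) m m') :
    m' = fun v => { m v with acc := univ.sup fun w => (m w).acc } := by
  classical
  set S := univ.sup fun w => (m w).acc with hS
  let I : (Fin n → p.Mem) → Prop := fun m₁ =>
    ∃ a : Fin n → p.Fl, m₁ = (fun v => { m v with acc := a v }) ∧ ∀ v, (m v).acc ≤ a v ∧ a v ≤ S
  have hrun : ∀ m₁, I m₁ → Running m₁ := by
    rintro _ ⟨a, rfl, -⟩ v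
    exact hm v
  have hstep : ∀ (G : CGraph n) m₁ x, I m₁ → ∀ v, gstep .flood G.1 m₁ x v =
      { m₁ v with acc := (m₁ v).acc ⊔ p.recvFl (inbox .flood G.1 m₁ x v) } :=
    fun G m₁ x hI v => gstep_apply (hrun m₁ hI) _ _ _ _
  have hI : ∀ (G : CGraph n) m₁ x, I m₁ → I (gstep .flood G.1 m₁ x) := by
    intro G m₁ x hI'
    have h1 := hstep G m₁ x hI'
    obtain ⟨a, rfl, ha⟩ := hI'
    refine ⟨_, funext h1, fun v => ⟨(ha v).1.trans le_sup_left, sup_le (ha v).2 ?_⟩⟩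
    exact recvFl_inbox_le.2 fun w _ => (ha w).2
  have hI0 : I m := ⟨fun v => (m v).acc, rfl, fun v => ⟨le_rfl, le_sup (f := fun w => (m w).acc)
    (mem_univ v)⟩⟩
  have hspread : ∀ u v, (m u).acc ≤ (m' v).acc := by
    intro u v
    have h1 := Reach.card_spread (k := Kind.flood) (I := I)
      (A := fun m₁ => univ.filter fun v => (m u).acc ≤ (m₁ v).acc) hI
      (fun G m₁ x hI' v hv => by
        rw [mem_filter] at hv ⊢
        rw [hstep G m₁ x hI' v]
        exact ⟨mem_univ _, hv.2.trans le_sup_left⟩)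
      (by
        rintro _ ⟨a, rfl, ha⟩
        exact ⟨u, mem_filter.2 ⟨mem_univ _, (ha u).1⟩⟩)
      (fun G m₁ x v w hI' hw hvw => by
        rw [mem_filter] at hw ⊢
        rw [hstep G m₁ x hI' v]
        exact ⟨mem_univ _, (hw.2.trans (recvFl_inbox_le.1 le_rfl w hvw)).trans le_sup_right⟩)
      L hI0 h
    have h2 : (univ.filter fun v => (m u).acc ≤ (m' v).acc) = univ := by
      rcases h1 with h1 | h1
      · exact h1
      · exfalso
        have h3 : 0 < (univ.filter fun v => (m u).acc ≤ (m v).acc).card :=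
          card_pos.2 ⟨u, by simp⟩
        have h4 := card_le_univ (univ.filter fun v => (m u).acc ≤ (m' v).acc)
        rw [Fintype.card_fin] at h4
        omega
    have h3 : v ∈ univ.filter fun v => (m u).acc ≤ (m' v).acc := h2.symm ▸ mem_univ v
    exact (mem_filter.1 h3).2
  obtain ⟨a, rfl, ha⟩ := Reach.invariant (I := I) (fun k hk G m₁ x hI' => by
    rw [List.eq_of_mem_replicate hk]; exact hI G m₁ x hI') h hI0
  funext v
  have : a v = S := le_antisymm (ha v).2 (Finset.sup_le fun u _ => hspread u v)
  rw [this]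

/-! ### Forwarding -/

theorem fwd_reach {F : ℕ} {m m' : Fin n → p.Mem} (hm : Running m)
    (h : Reach gstep (List.replicate F Kind.fwd) m m') :
    ∃ T : Fin n → Finset p.Tok, m' = (fun v => { m v with T := T v }) ∧
      (∀ v, (m v).T ⊆ T v) ∧ (∀ v, ∀ τ ∈ T v, ∃ w, τ ∈ (m w).T) ∧
      ∀ v, (m v).mode = false → T v = (m v).T := by
  classical
  refine Reach.invariant (I := fun m₁ => ∃ T : Fin n → Finset p.Tok,
    m₁ = (fun v => { m v with T := T v }) ∧
      (∀ v, (m v).T ⊆ T v) ∧ (∀ v, ∀ τ ∈ T v, ∃ w, τ ∈ (m w).T) ∧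
      ∀ v, (m v).mode = false → T v = (m v).T) ?_ h
      ⟨fun v => (m v).T, rfl, fun v => Subset.rfl, fun v τ hτ => ⟨v, hτ⟩, fun v _ => rfl⟩
  rintro k hk G _ x ⟨T, rfl, h1, h2, h3⟩
  rw [List.eq_of_mem_replicate hk]
  have hm₁ : Running (fun v => { m v with T := T v }) := hm
  refine ⟨_, funext fun v => gstep_apply hm₁ _ _ _ _, fun v => ?_, fun v τ hτ => ?_,
    fun v hv => ?_⟩
  · dsimp only
    split_ifs
    · exact (h1 v).trans subset_union_left
    · exact h1 v
  · dsimp only at hτ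
    split_ifs at hτ
    · rcases mem_union.1 hτ with hτ | hτ
      · exact h2 v τ hτ
      · obtain ⟨w, -, hw⟩ := mem_recvTok_inbox.1 hτ
        exact h2 w τ (mem_blk.1 hw).1
    · exact h2 v τ hτ
  · dsimp only
    rw [if_neg (by simp [hv])]
    exact h3 v hv

open Classical in
/-- The nodes that know the undelivered token `τ`. -/
noncomputable def holders (m : Fin n → p.Mem) (τ : p.Tok) : Finset (Fin n) :=
  univ.filter fun v => τ ∈ (m v).T

theorem mem_holders {m : Fin n → p.Mem} {τ : p.Tok} {v : Fin n} :
    v ∈ holders m τ ↔ τ ∈ (m v).T := by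
  simp [holders]

/-- After forwarding, a token is known to many nodes, or some node is heavy. -/
theorem upper_fwd_le [Nonempty (CGraph n)] {m : Fin n → p.Mem} (hm : Running m)
    (hmode : ∀ v, (m v).mode = true) {τ : p.Tok} (hτ : ∃ v, τ ∈ (m v).T) (F h : ℕ) :
    upper gstep (List.replicate F Kind.fwd) (fun m => ind ((∀ v, (m v).T.card ≤ p.g * p.s) ∧
        holders m τ ≠ univ ∧ (holders m τ).card ≤ h)) m ≤ 2 ^ h * (1 - 1 / p.g / 2) ^ F := by
  classical
  let I : (Fin n → p.Mem) → Prop := fun m₁ =>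
    Running m₁ ∧ (∀ v, (m₁ v).mode = true) ∧ ∃ v, τ ∈ (m₁ v).T
  have hstep : ∀ (G : CGraph n) m₁ x, I m₁ → ∀ v, gstep .fwd G.1 m₁ x v =
      { m₁ v with T := (m₁ v).T ∪ p.recvTok (inbox .fwd G.1 m₁ x v) } := by
    intro G m₁ x hI v
    rw [gstep_apply hI.1, upd]
    simp only [hI.2.1 v, if_true]
  have hg : (1 : ℝ) ≤ p.g := by exact_mod_cast p.g_pos
  have hmain := upper_spread_le (step := gstep (p := p)) (k := Kind.fwd) (I := I)
    -- The process stops once a node is heavy: only for a light node do the first g blocks contain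
    -- all its tokens, so that each is sent with probability at least 1/g.
    (quit := fun m => ¬ ∀ v, (m v).T.card ≤ p.g * p.s)
    (A := fun m => holders m τ) (q := 1 / p.g)
    (by rw [div_le_one (by positivity)]; exact hg)
    (fun G m₁ x hI => by
      refine ⟨fun v => ?_, fun v => ?_, ?_⟩
      · rw [hstep G m₁ x hI v]; exact hI.1 v
      · rw [hstep G m₁ x hI v]; exact hI.2.1 v
      · obtain ⟨v, hv⟩ := hI.2.2
        exact ⟨v, by rw [hstep G m₁ x hI v]; exact mem_union_left _ hv⟩)
    (fun G m₁ x hI hst hst' => hst fun v => by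
      have := hst' v
      rw [hstep G m₁ x hI v] at this
      exact (card_le_card subset_union_left).trans this)
    (fun G m₁ x hI v hv => by
      rw [mem_holders] at hv ⊢
      rw [hstep G m₁ x hI v]
      exact mem_union_left _ hv)
    (fun m₁ hI => by
      obtain ⟨v, hv⟩ := hI.2.2
      exact ⟨v, mem_holders.2 hv⟩)
    (fun G m₁ v w hI hst hw hv hvw => by
      push Not at hst
      rw [mem_holders] at hw
      obtain ⟨i, hi⟩ := exists_mem_blk (hst w) hw
      calc (1 : ℝ) / p.g = 𝔼 x : Fin n → p.Coin, ind ((x w).idx = i) := by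
            rw [expect_eval w (fun y : p.Coin => ind (y.idx = i)),
              expect_coin_idx (fun j => ind (j = i)), expect_ind_eq]
            simp
        _ ≤ _ := by
            refine expect_le_expect fun x _ => ?_
            refine ind_mono fun h1 => mem_holders.2 ?_
            rw [hstep G m₁ x hI v]
            exact mem_union_right _ (mem_recvTok_inbox.2 ⟨w, hvw, by rwa [h1]⟩))
    F h (m := m) ⟨hm, hmode, hτ⟩
  simpa only [not_not] using hmain

/-! ### Coding -/

/-- All vectors that some node has. -/
noncomputable def allVec (m : Fin n → p.Mem) : Finset p.Vec :=
  univ.biUnion fun v => (m v).R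

theorem code_reach {H : ℕ} {m m' : Fin n → p.Mem} (hm : Running m)
    (h : Reach gstep (List.replicate H Kind.code) m m') :
    ∃ R : Fin n → Finset p.Vec, m' = (fun v => { m v with R := R v }) ∧
      (∀ v, (m v).R ⊆ R v) ∧ ∀ v, ∀ e ∈ R v, e ∈ p.spanOf (allVec m) := by
  classical
  refine Reach.invariant (I := fun m₁ => ∃ R : Fin n → Finset p.Vec,
    m₁ = (fun v => { m v with R := R v }) ∧
      (∀ v, (m v).R ⊆ R v) ∧ ∀ v, ∀ e ∈ R v, e ∈ p.spanOf (allVec m)) ?_ h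
      ⟨fun v => (m v).R, rfl, fun v => Subset.rfl, fun v e he => Submodule.subset_span
        (mem_coe.2 (mem_biUnion.2 ⟨v, mem_univ _, he⟩))⟩
  rintro k hk G _ x ⟨R, rfl, h1, h2⟩
  rw [List.eq_of_mem_replicate hk]
  have hm₁ : Running (fun v => { m v with R := R v }) := hm
  refine ⟨_, funext fun v => gstep_apply hm₁ _ _ _ _, fun v => ?_, fun v e he => ?_⟩
  · exact (h1 v).trans subset_union_left
  · rcases mem_union.1 he with he | he
    · exact h2 v e he
    · obtain ⟨w, -, rfl⟩ := mem_recvVec_inbox.1 he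
      exact Submodule.sum_mem _ fun e' he' => Submodule.smul_mem _ _ (h2 w e' he')

theorem zmod_two_eq_one {c : ZMod 2} (hc : c ≠ 0) : c = 1 := by
  revert c; decide

/-- A random combination of vectors is not annihilated by a functional with probability `1/2`. -/
theorem expect_functional {R : Finset p.Vec} (μ : p.Vec →ₗ[ZMod 2] ZMod 2) {e : p.Vec}
    (he : e ∈ R) (hμ : μ e ≠ 0) :
    (𝔼 c : p.Vec → ZMod 2, ind (μ (∑ w ∈ R, c w • w) ≠ 0)) = 1 / 2 := by
  classical
  -- Changing the coefficient of e changes the value of μ by 1.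
  refine expect_half_of_flip (Equiv.addRight (Pi.single e 1)) _ fun c => ?_
  have h1 : μ (∑ w ∈ R, (Equiv.addRight (Pi.single e 1) c) w • w) =
      μ (∑ w ∈ R, c w • w) + 1 := by
    have : ∑ w ∈ R, (Equiv.addRight (Pi.single e 1) c) w • w = (∑ w ∈ R, c w • w) + e := by
      simp only [Equiv.coe_addRight, Pi.add_apply, add_smul, sum_add_distrib, Pi.single_apply,
        ite_smul, one_smul, zero_smul, sum_ite_eq', he, if_true]
    rw [this, map_add, zmod_two_eq_one hμ]
  rw [h1]
  generalize μ (∑ w ∈ R, c w • w) = z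
  have h2 : ∀ z : ZMod 2, z = 0 ∨ z = 1 := by decide
  rcases h2 z with rfl | rfl
  · simp [ind]
  · simp [ind, show (1 : ZMod 2) + 1 = 0 by decide]

/-- A neighbour of a node that is not annihilated by μ becomes such a node with probability 1/2, so
`upper_spread_le` applies with q = 1/2; its size bound is taken to be n and is void. -/
theorem upper_functional_le [Nonempty (CGraph n)] {m : Fin n → p.Mem} (hm : Running m)
    (μ : p.Vec →ₗ[ZMod 2] ZMod 2) (hμ : ∃ v, ∃ e ∈ (m v).R, μ e ≠ 0) (H : ℕ) :
    upper gstep (List.replicate H Kind.code) (fun m =>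
      ind (∃ v, ∀ e ∈ (m v).R, μ e = 0)) m ≤ 2 ^ n * (3 / 4) ^ H := by
  classical
  let I : (Fin n → p.Mem) → Prop := fun m₁ => Running m₁ ∧ ∃ v, ∃ e ∈ (m₁ v).R, μ e ≠ 0
  have hstep : ∀ (G : CGraph n) m₁ x, I m₁ → ∀ v, gstep .code G.1 m₁ x v =
      { m₁ v with R := (m₁ v).R ∪ p.recvVec (inbox .code G.1 m₁ x v) } :=
    fun G m₁ x hI v => by rw [gstep_apply hI.1, upd]
  have hmain := upper_spread_le (step := gstep (p := p)) (k := Kind.code) (I := I)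
    (quit := fun _ => False)
    (A := fun m => univ.filter fun v => ∃ e ∈ (m v).R, μ e ≠ 0) (q := 1 / 2) (by norm_num)
    (fun G m₁ x hI => by
      refine ⟨fun v => ?_, ?_⟩
      · rw [hstep G m₁ x hI v]; exact hI.1 v
      · obtain ⟨v, e, he, h⟩ := hI.2
        exact ⟨v, e, by rw [hstep G m₁ x hI v]; exact mem_union_left _ he, h⟩)
    (fun G m₁ x hI h => h)
    (fun G m₁ x hI v hv => by
      rw [mem_filter] at hv ⊢
      obtain ⟨-, e, he, h⟩ := hv
      rw [hstep G m₁ x hI v]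
      exact ⟨mem_univ _, e, mem_union_left _ he, h⟩)
    (fun m₁ hI => by
      obtain ⟨v, hv⟩ := hI.2
      exact ⟨v, by simpa using hv⟩)
    (fun G m₁ v w hI hst hw hv hvw => by
      rw [mem_filter] at hw
      obtain ⟨-, e, he, hμe⟩ := hw
      calc (1 : ℝ) / 2 = 𝔼 x : Fin n → p.Coin,
            ind (μ (∑ w' ∈ (m₁ w).R, (x w).coef w' • w') ≠ 0) := by
            rw [expect_eval w (fun y : p.Coin =>
                ind (μ (∑ w' ∈ (m₁ w).R, y.coef w' • w') ≠ 0)),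
              expect_coin_coef (fun c =>
                ind (μ (∑ w' ∈ (m₁ w).R, c w' • w') ≠ 0)),
              expect_functional μ he hμe]
        _ ≤ _ := by
            refine expect_le_expect fun x _ => ?_
            refine ind_mono fun h1 => mem_filter.2 ⟨mem_univ _, ?_⟩
            rw [hstep G m₁ x hI v]
            exact ⟨_, mem_union_right _ (mem_recvVec_inbox.2 ⟨w, hvw, rfl⟩), h1⟩)
    H n (m := m) ⟨hm, hμ⟩
  refine (upper_mono fun m' _ => ?_).trans (hmain.trans_eq (by norm_num))
  refine ind_mono fun ⟨v, hv⟩ => ⟨not_false, fun hu => ?_, (card_le_univ _).trans (by simp)⟩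
  obtain ⟨-, e, he, h⟩ := mem_filter.1 (eq_univ_iff_forall.1 hu v)
  exact h (hv e he)

/-- Random linear network coding: all nodes are likely to obtain the whole span. -/
theorem upper_code_le [Nonempty (CGraph n)] {m : Fin n → p.Mem} (hm : Running m) {c : ℕ}
    (hc : (allVec m).card ≤ c) (H : ℕ) :
    upper gstep (List.replicate H Kind.code) (fun m' =>
      ind (¬ ∀ v, ∀ e ∈ allVec m, e ∈ p.spanOf (m' v).R)) m ≤
      2 ^ c * (2 ^ n * (3 / 4) ^ H) := by
  classical
  -- Only the values on `allVec m` matter, and they are 0 or 1. One representative for each support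
  -- makes the union bound have 2^c terms, whatever the dimension of the space.
  let pat : (p.Vec →ₗ[ZMod 2] ZMod 2) → Finset p.Vec := fun μ =>
    (allVec m).filter fun e => μ e ≠ 0
  let rep : Finset p.Vec → (p.Vec →ₗ[ZMod 2] ZMod 2) := fun P =>
    if h : ∃ μ, pat μ = P then h.choose else 0
  have hrep : ∀ μ, pat (rep (pat μ)) = pat μ := fun μ => by
    have h : ∃ μ', pat μ' = pat μ := ⟨μ, rfl⟩
    simp only [rep, dif_pos h]
    exact h.choose_spec
  let bad : Finset p.Vec → (Fin n → p.Mem) → ℝ := fun P m' =>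
    ind (pat (rep P) ≠ ∅ ∧ ∃ v, ∀ e ∈ (m' v).R, rep P e = 0)
  have hbad0 : ∀ P m', 0 ≤ bad P m' := fun P m' => ind_nonneg _
  calc _ ≤ upper gstep (List.replicate H Kind.code)
        (fun m' => ∑ P ∈ (allVec m).powerset, bad P m') m := by
        refine upper_mono fun m' hm' => ?_
        by_cases h : ∀ v, ∀ e ∈ allVec m, e ∈ p.spanOf (m' v).R
        · rw [ind_neg (not_not.2 h)]
          exact sum_nonneg fun P _ => hbad0 P m'
        · rw [ind_pos h]
          push Not at h
          obtain ⟨v, e, he, hev⟩ := h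
          obtain ⟨μ, hμe, hμ⟩ := Submodule.exists_le_ker_of_notMem hev
          obtain ⟨R, rfl, -, hR⟩ := code_reach hm hm'
          -- Equal supports over the field with two elements mean equal values, so the
          -- representative agrees with μ on everything that nodes can ever receive.
          have hagree : ∀ e ∈ p.spanOf (allVec m), rep (pat μ) e = μ e := by
            have hle : p.spanOf (allVec m) ≤ LinearMap.ker (rep (pat μ) - μ) := by
              refine Submodule.span_le.2 fun e he => ?_
              have he := mem_coe.1 he
              have h1 : rep (pat μ) e ≠ 0 ↔ μ e ≠ 0 := by
                have := congrArg (e ∈ ·) (hrep μ)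
                simpa [pat, he] using this
              change rep (pat μ) e - μ e = 0
              by_cases h0 : μ e = 0
              · rw [h0, sub_zero]
                by_contra h2
                exact h1.1 h2 h0
              · rw [zmod_two_eq_one h0, zmod_two_eq_one (h1.2 h0), sub_self]
            intro e he
            exact sub_eq_zero.1 (hle he)
          have h1 : bad (pat μ) (fun v => { m v with R := R v }) = 1 := by
            refine ind_pos ⟨?_, v, fun e' he' => ?_⟩
            · rw [hrep]
              exact ne_empty_of_mem (mem_filter.2 ⟨he, hμe⟩)
            · rw [hagree e' (hR v e' he')]
              exact hμ (Submodule.subset_span (mem_coe.2 he'))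
          rw [← h1]
          exact single_le_sum (f := fun P => bad P (fun v => { m v with R := R v }))
            (fun P _ => hbad0 P _) (mem_powerset.2 (filter_subset _ _))
    _ ≤ ∑ P ∈ (allVec m).powerset, upper gstep (List.replicate H Kind.code) (bad P) m :=
        upper_sum_le _ _ _ _
    _ ≤ ∑ P ∈ (allVec m).powerset, (2 ^ n * (3 / 4) ^ H : ℝ) := by
        refine sum_le_sum fun P _ => ?_
        by_cases hP : pat (rep P) = ∅
        · refine upper_le_of_forall fun m' _ => ?_
          simp only [bad]
          rw [ind_neg (fun h => h.1 hP)]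
          positivity
        · obtain ⟨e, he⟩ := nonempty_iff_ne_empty.2 hP
          obtain ⟨he, hμ⟩ := mem_filter.1 he
          obtain ⟨v, -, hv⟩ := mem_biUnion.1 he
          refine le_trans (upper_mono fun m' _ => ?_) (upper_functional_le hm (rep P) ⟨v, e, hv, hμ⟩ H)
          exact ind_mono fun h => h.2
    _ = 2 ^ (allVec m).card * (2 ^ n * (3 / 4) ^ H) := by
        rw [sum_const, card_powerset, nsmul_eq_mul]
        push_cast
        ring
    _ ≤ _ := by
        gcongr
        norm_num

end Par

/-! ### Moments of the number of hits in a product space -/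

section Moments

/-- The density of `A`. -/
noncomputable def dens {Ω : Type} [Fintype Ω] (A : Finset Ω) : ℝ :=
  (A.card : ℝ) / Fintype.card Ω

theorem dens_nonneg {Ω : Type} [Fintype Ω] (A : Finset Ω) : 0 ≤ dens A := by
  unfold dens; positivity

theorem expect_indicator {Ω : Type} [Fintype Ω] (A : Finset Ω) :
    (𝔼 y : Ω, ind (y ∈ A)) = dens A := by
  rw [Fintype.expect_eq_sum_div_card, dens]
  simp only [ind, sum_boole]
  congr 3
  ext
  simp

/-- The indicator of `y a ∈ A`. -/
noncomputable def hit {ι Ω : Type} (A : Finset Ω) (a : ι) (y : ι → Ω) : ℝ := ind (y a ∈ A)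

theorem hit_nonneg {ι Ω : Type} (A : Finset Ω) (a : ι) (y : ι → Ω) : 0 ≤ hit A a y := ind_nonneg _

theorem sum_hit_eq_zero {ι Ω : Type} (A : Finset Ω) {J : Finset ι} {y : ι → Ω} (h : ¬ ∃ a ∈ J, y a ∈ A) :
    ∑ a ∈ J, hit A a y = 0 :=
  sum_eq_zero fun a ha => ind_neg fun hy => h ⟨a, ha, hy⟩

variable {ι Ω : Type} [Fintype ι] [DecidableEq ι] [Fintype Ω] [Nonempty Ω]

theorem expect_eval_mul {a b : ι} (hab : a ≠ b) (f h : Ω → ℝ) :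
    𝔼 x : ι → Ω, f (x a) * h (x b) = (𝔼 y, f y) * 𝔼 y, h y := by
  rw [Fintype.expect_equiv (Equiv.funSplitAt a Ω) (fun x => f (x a) * h (x b))
    (fun y => f y.1 * h (y.2 ⟨b, hab.symm⟩)) (fun x => by simp [Equiv.funSplitAt]),
    ← univ_product_univ, expect_product]
  simp only [← mul_expect]
  rw [← expect_mul]
  congr 1
  exact expect_eval (Ω := Ω) (⟨b, hab.symm⟩ : {j // j ≠ a}) h

variable (A : Finset Ω)

theorem expect_hit (a : ι) : 𝔼 y, hit A a y = dens A := by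
  classical
  simp only [hit]
  rw [expect_eval a (fun y => ind (y ∈ A)), ← expect_indicator]

theorem expect_hit_mul_hit_le (a b : ι) :
    𝔼 y, hit A a y * hit A b y ≤ (if a = b then dens A else 0) + dens A * dens A := by
  classical
  by_cases hab : a = b
  · subst hab
    have : ∀ y : ι → Ω, hit A a y * hit A a y = hit A a y := fun y => by
      by_cases h : y a ∈ A <;> simp [hit, ind, h]
    simp only [this, expect_hit, if_true]
    have := dens_nonneg A
    nlinarith
  · simp only [hit, if_neg hab, zero_add]
    rw [expect_eval_mul hab (fun y => ind (y ∈ A))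
      (fun y => ind (y ∈ A)), ← expect_indicator]

theorem expect_sum_hit (J : Finset ι) : 𝔼 y, ∑ a ∈ J, hit A a y = J.card * dens A := by
  rw [expect_sum_comm]
  simp [expect_hit]

theorem expect_sum_hit_mul_le (J I : Finset ι) :
    𝔼 y, (∑ a ∈ J, hit A a y) * (∑ b ∈ I, hit A b y) ≤
      J.card * dens A * (1 + I.card * dens A) := by
  classical
  have h0 := dens_nonneg A
  simp only [sum_mul_sum]
  rw [expect_sum_comm]
  simp only [expect_sum_comm]
  calc ∑ a ∈ J, ∑ b ∈ I, 𝔼 y, hit A a y * hit A b y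
      ≤ ∑ a ∈ J, ∑ b ∈ I, ((if a = b then dens A else 0) + dens A * dens A) :=
        sum_le_sum fun a _ => sum_le_sum fun b _ => expect_hit_mul_hit_le A a b
    _ ≤ ∑ a ∈ J, (dens A + I.card * (dens A * dens A)) := by
        refine sum_le_sum fun a _ => ?_
        rw [sum_add_distrib, sum_const, nsmul_eq_mul, sum_ite_eq]
        gcongr
        split_ifs
        · exact le_rfl
        · exact h0
    _ = _ := by rw [sum_const, nsmul_eq_mul]; ring

/-- A lower bound for the probability that some `a ∈ J` is hit and at most `c` elements of `I`
are hit. -/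
theorem le_expect_hit (J I : Finset ι) {c : ℝ} (hc : 4 * (1 + I.card * dens A) ≤ c) :
    1 / 2 * (J.card * dens A / (1 + J.card * dens A)) ≤
      𝔼 y : ι → Ω, ind ((∃ a ∈ J, y a ∈ A) ∧ (∑ a ∈ I, hit A a y) ≤ c) := by
  set q := dens A
  have hq : 0 ≤ q := dens_nonneg A
  set M : ℝ := J.card * q with hM
  have hM0 : 0 ≤ M := by positivity
  set t : ℝ := 1 / (1 + M) with ht
  have ht0 : 0 ≤ t := by positivity
  have hI0 : (0 : ℝ) ≤ I.card * q := by positivity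
  have hcpos : 0 < c := by linarith
  -- With h hits in J and N in I: 2th - (th)² ≤ 1 always, and for N > c the last term exceeds 2th.
  -- The expectation is at least 2tM - tM - tM/2 = tM/2, by the choice of t.
  have hpt : ∀ y : ι → Ω, 2 * t * (∑ a ∈ J, hit A a y) -
      t ^ 2 * ((∑ a ∈ J, hit A a y) * (∑ a ∈ J, hit A a y)) -
      2 * t / c * ((∑ a ∈ J, hit A a y) * (∑ b ∈ I, hit A b y)) ≤
      ind ((∃ a ∈ J, y a ∈ A) ∧ (∑ a ∈ I, hit A a y) ≤ c) := by
    intro y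
    have hh : 0 ≤ ∑ a ∈ J, hit A a y := sum_nonneg fun a _ => hit_nonneg A a y
    have hN : 0 ≤ ∑ b ∈ I, hit A b y := sum_nonneg fun a _ => hit_nonneg A a y
    have h0 := sum_hit_eq_zero A (J := J) (y := y)
    set h : ℝ := ∑ a ∈ J, hit A a y
    set N : ℝ := ∑ b ∈ I, hit A b y
    have hterm : 0 ≤ 2 * t / c * (h * N) := by positivity
    by_cases hcond : (∃ a ∈ J, y a ∈ A) ∧ N ≤ c
    · rw [ind_pos hcond]
      nlinarith [sq_nonneg (t * h - 1)]
    · rw [ind_neg hcond]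
      by_cases h1 : ∃ a ∈ J, y a ∈ A
      · have hNc : c < N := by
          by_contra hle
          exact hcond ⟨h1, not_lt.1 hle⟩
        have : 2 * t * h ≤ 2 * t / c * (h * N) := by
          rw [div_mul_eq_mul_div, le_div_iff₀ hcpos]
          have : 2 * t * h * c ≤ 2 * t * h * N := by gcongr
          linarith
        nlinarith [sq_nonneg (t * h)]
      · rw [h0 h1]
        simp
  refine le_trans ?_ (expect_le_expect fun y _ => hpt y)
  rw [expect_sub_distrib, expect_sub_distrib, ← mul_expect, ← mul_expect, ← mul_expect,
    expect_sum_hit]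
  have h1 := expect_sum_hit_mul_le A J J
  have h2 := expect_sum_hit_mul_le A J I
  have h3 : t ^ 2 * (𝔼 y, (∑ a ∈ J, hit A a y) * (∑ a ∈ J, hit A a y)) ≤ t * M := by
    calc _ ≤ t ^ 2 * (M * (1 + M)) := by gcongr
      _ = t * M * (t * (1 + M)) := by ring
      _ = t * M := by rw [ht]; field_simp
  have h4 : 2 * t / c * (𝔼 y, (∑ a ∈ J, hit A a y) * (∑ b ∈ I, hit A b y)) ≤ t * M / 2 := by
    calc _ ≤ 2 * t / c * (M * (1 + I.card * q)) := by gcongr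
      _ = t * M / 2 * (4 * (1 + I.card * q) / c) := by field_simp; ring
      _ ≤ t * M / 2 * 1 := by
          have : 4 * (1 + I.card * q) / c ≤ 1 := (div_le_one hcpos).2 hc
          gcongr
      _ = _ := by ring
  have h5 : M / (1 + M) = t * M := by rw [ht]; ring
  rw [h5]
  linarith

theorem le_expect_exists_hit (J : Finset ι) :
    J.card * dens A / (1 + J.card * dens A) ≤
      𝔼 y : ι → Ω, ind (∃ a ∈ J, y a ∈ A) := by
  set M : ℝ := J.card * dens A with hM
  have hM0 : 0 ≤ M := by have := dens_nonneg A; positivity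
  set t : ℝ := 1 / (1 + M) with ht
  have hpt : ∀ y : ι → Ω, 2 * t * (∑ a ∈ J, hit A a y) -
      t ^ 2 * ((∑ a ∈ J, hit A a y) * (∑ a ∈ J, hit A a y)) ≤
      ind (∃ a ∈ J, y a ∈ A) := by
    intro y
    by_cases hcond : ∃ a ∈ J, y a ∈ A
    · rw [ind_pos hcond]
      nlinarith [sq_nonneg (t * (∑ a ∈ J, hit A a y) - 1)]
    · rw [ind_neg hcond, sum_hit_eq_zero A hcond]
      simp
  refine le_trans ?_ (expect_le_expect fun y _ => hpt y)
  rw [expect_sub_distrib, ← mul_expect, ← mul_expect, expect_sum_hit]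
  have h3 : t ^ 2 * (𝔼 y, (∑ a ∈ J, hit A a y) * (∑ a ∈ J, hit A a y)) ≤ t * M := by
    calc _ ≤ t ^ 2 * (M * (1 + M)) := by gcongr; exact expect_sum_hit_mul_le A J J
      _ = t * M * (t * (1 + M)) := by ring
      _ = t * M := by rw [ht]; field_simp
  have h5 : M / (1 + M) = t * M := by rw [ht]; ring
  rw [h5]
  linarith

theorem expect_exists_hit_le (J : Finset ι) :
    (𝔼 y : ι → Ω, ind (∃ a ∈ J, y a ∈ A)) ≤ J.card * dens A := by
  rw [← expect_sum_hit]
  refine expect_le_expect fun y _ => ?_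
  by_cases h : ∃ a ∈ J, y a ∈ A
  · obtain ⟨a, ha, hy⟩ := h
    rw [ind_pos ⟨a, ha, hy⟩, ← ind_pos hy]
    exact single_le_sum (f := fun a => hit A a y) (fun a _ => hit_nonneg A a y) ha
  · rw [ind_neg h]
    exact sum_nonneg fun a _ => hit_nonneg A a y

end Moments

/-! ### The largest of several keys -/

theorem card_filter_le_add {Q c : ℕ} (hc : c ≤ Q) :
    (univ.filter fun v : Fin Q => Q ≤ v + c).card = c := by
  calc _ = ((univ.filter fun v : Fin Q => Q ≤ v + c).map Fin.valEmbedding).card := (card_map _).symm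
    _ = (Finset.Ico (Q - c) Q).card := by
        congr 1
        ext j
        simp only [mem_map, mem_filter, mem_univ, true_and, Fin.valEmbedding_apply, mem_Ico]
        constructor
        · rintro ⟨v, hv, rfl⟩
          exact ⟨by omega, v.2⟩
        · rintro ⟨h1, h2⟩
          exact ⟨⟨j, h2⟩, by simp only; omega, rfl⟩
    _ = c := by simp; omega

theorem dens_filter_le_add {Q : ℕ} [NeZero Q] {c : ℕ} (hc : c ≤ Q) :
    dens (univ.filter fun v : Fin Q => Q ≤ v + c) = c / Q := by
  rw [dens, card_filter_le_add hc, Fintype.card_fin]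

/-- With probability at least `1/2`, the distance of the largest of `|I|` random keys to `Q` is
`Q / |I|` up to a factor `4`. -/
theorem half_le_expect_key {ι : Type} [Fintype ι] [DecidableEq ι] {Q : ℕ} [NeZero Q] (I : Finset ι)
    (hI : I.Nonempty) (hQ : I.card ≤ Q) :
    1 / 2 ≤ 𝔼 κ : ι → Fin Q, ind ((∀ a ∈ I, Q ≤ 4 * I.card * (Q - κ a)) ∧
      ∃ a ∈ I, I.card * (Q - κ a) ≤ 4 * Q) := by
  set Φ := I.card with hΦ
  have hΦ0 : 0 < Φ := hI.card_pos
  have hQ0 : 0 < Q := Nat.pos_of_ne_zero (NeZero.ne Q)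
  have hQR : (0 : ℝ) < Q := by exact_mod_cast hQ0
  have hΦR : (0 : ℝ) < Φ := by exact_mod_cast hΦ0
  -- The largest width with 4Φ·c₁ < Q. The expected number of keys this close to Q is at most 1/4.
  obtain ⟨c₁, hc₁⟩ : ∃ c, c = (Q - 1) / (4 * Φ) := ⟨_, rfl⟩
  have hc₁Q : c₁ ≤ Q := hc₁ ▸ (Nat.div_le_self _ _).trans (Nat.sub_le _ _)
  have hlow : (𝔼 κ : ι → Fin Q, ind (∃ a ∈ I, κ a ∈ univ.filter (fun v : Fin Q => Q ≤ v + c₁))) ≤ 1 / 4 := by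
    refine (expect_exists_hit_le _ I).trans ?_
    rw [dens_filter_le_add hc₁Q, ← hΦ]
    have h0 : 4 * Φ * c₁ ≤ Q := by
      rw [hc₁]
      exact (Nat.mul_div_le (Q - 1) (4 * Φ)).trans (Nat.sub_le _ _)
    have h1 : (4 : ℝ) * Φ * c₁ ≤ Q := by
      have := (Nat.cast_le (α := ℝ)).2 h0
      simpa only [Nat.cast_mul, Nat.cast_ofNat] using this
    rw [mul_div_assoc', div_le_iff₀ hQR]
    linarith
  have hup : 3 / 4 ≤ 𝔼 κ : ι → Fin Q, ind (∃ a ∈ I, Φ * (Q - κ a) ≤ 4 * Q) := by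
    by_cases h4 : Φ ≤ 4
    · obtain ⟨a, ha⟩ := hI
      have : ∀ κ : ι → Fin Q, ∃ a ∈ I, Φ * (Q - κ a) ≤ 4 * Q := fun κ =>
        ⟨a, ha, Nat.mul_le_mul h4 (Nat.sub_le _ _)⟩
      simp only [fun κ => ind_pos (this κ), Fintype.expect_const]
      norm_num
    -- Rounding costs at most Φ ≤ Q, so at least three keys are expected this close to Q, and the
    -- second moment bound M/(1+M) is at least 3/4.
    · obtain ⟨c₂, hc₂⟩ : ∃ c, c = 4 * Q / Φ := ⟨_, rfl⟩
      have hc₂Q : c₂ ≤ Q := by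
        rw [hc₂]
        refine Nat.div_le_of_le_mul ?_
        push Not at h4
        exact Nat.mul_le_mul_right _ h4.le
      have h1 := le_expect_exists_hit (univ.filter (fun v : Fin Q => Q ≤ v + c₂)) I
      rw [dens_filter_le_add hc₂Q, ← hΦ] at h1
      have h2 : (3 : ℝ) ≤ Φ * (c₂ / Q) := by
        have h5 : 4 * Q < Φ * c₂ + Φ := by
          have := Nat.lt_mul_div_succ (4 * Q) hΦ0
          rw [← hc₂] at this
          linarith
        have h6 : ((4 * Q : ℕ) : ℝ) ≤ ((Φ * c₂ + Φ : ℕ) : ℝ) := by exact_mod_cast h5.le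
        have h7 : (Φ : ℝ) ≤ Q := by exact_mod_cast hQ
        push_cast at h6
        rw [mul_div_assoc', le_div_iff₀ hQR]
        linarith
      have h3 : (3 : ℝ) / 4 ≤ Φ * (c₂ / Q) / (1 + Φ * (c₂ / Q)) := by
        rw [div_le_div_iff₀ (by norm_num) (by linarith)]
        linarith
      refine h3.trans (h1.trans (expect_le_expect fun κ _ => ?_))
      refine ind_mono fun ⟨a, ha, hκ⟩ => ⟨a, ha, ?_⟩
      have hκ := (mem_filter.1 hκ).2
      calc Φ * (Q - κ a) ≤ Φ * c₂ := Nat.mul_le_mul_left _ (by omega)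
        _ ≤ 4 * Q := by rw [hc₂]; exact Nat.mul_div_le _ _
  have hpt : ∀ κ : ι → Fin Q, (ind (∃ a ∈ I, Φ * (Q - κ a) ≤ 4 * Q)) -
      (ind (∃ a ∈ I, κ a ∈ univ.filter (fun v : Fin Q => Q ≤ v + c₁))) ≤
      ind ((∀ a ∈ I, Q ≤ 4 * Φ * (Q - κ a)) ∧ ∃ a ∈ I, Φ * (Q - κ a) ≤ 4 * Q) := by
    intro κ
    by_cases h1 : ∃ a ∈ I, κ a ∈ univ.filter (fun v : Fin Q => Q ≤ v + c₁)
    · rw [ind_pos h1]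
      exact (sub_nonpos.2 (ind_le_one _)).trans (ind_nonneg _)
    · rw [ind_neg h1, sub_zero]
      have h2 : ∀ a ∈ I, Q ≤ 4 * Φ * (Q - κ a) := by
        intro a ha
        by_contra hlt
        push Not at hlt
        refine h1 ⟨a, ha, mem_filter.2 ⟨mem_univ _, ?_⟩⟩
        have : Q - κ a ≤ c₁ := hc₁ ▸ (Nat.le_div_iff_mul_le (by omega)).2 (by
          rw [mul_comm]; omega)
        omega
      exact ind_mono fun h3 => ⟨h2, h3⟩
  refine le_trans ?_ (expect_le_expect fun κ _ => hpt κ)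
  rw [expect_sub_distrib]
  linarith

namespace Par

variable {p : Par} {n : ℕ}

/-! ### The random choices before the sampling -/

/-- Keys, sampling values and seeds become three independent families, so they can be analysed one
after the other: width, selection, hashing. -/
theorem expect_draw (f : (Fin n × Fin p.g → Fin p.Q) → (Fin n × Fin p.g → Fin p.Q) →
    (Fin n → Fin (Fintype.card p.Fd)) → ℝ) :
    𝔼 x : Fin n → p.Coin, f (fun a => (x a.1).key a.2) (fun a => (x a.1).smp a.2)
      (fun v => (x v).seed) = 𝔼 κ, 𝔼 σ, 𝔼 ς, f κ σ ς := by
  let e : (Fin n → p.Coin) ≃ (Fin n → Fin p.g) × (Fin n → p.Vec → ZMod 2) ×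
      (Fin n × Fin p.g → Fin p.Q) × (Fin n × Fin p.g → Fin p.Q) ×
        (Fin n → Fin (Fintype.card p.Fd)) :=
    { toFun := fun x => (fun v => (x v).idx, fun v => (x v).coef, fun a => (x a.1).key a.2,
        fun a => (x a.1).smp a.2, fun v => (x v).seed)
      invFun := fun y v => ⟨y.1 v, fun i => y.2.2.1 (v, i), fun i => y.2.2.2.1 (v, i),
        y.2.2.2.2 v, y.2.1 v⟩ }
  refine (Fintype.expect_equiv e _ (fun y => f y.2.2.1 y.2.2.2.1 y.2.2.2.2) (fun _ => rfl)).trans ?_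
  simp only [← univ_product_univ, expect_product]
  rw [Fintype.expect_const, Fintype.expect_const]

open Classical in
/-- The nonempty blocks of all nodes. -/
noncomputable def slots (m : Fin n → p.Mem) : Finset (Fin n × Fin p.g) :=
  univ.filter fun a => (p.blk (m a.1).T a.2).1.Nonempty

open Classical in
noncomputable def keyMax (m : Fin n → p.Mem) (κ : Fin n × Fin p.g → Fin p.Q) :
    WithBot (Fin p.Q) :=
  univ.sup fun v => (univ.filter fun i : Fin p.g => (p.blk (m v).T i).1.Nonempty).sup fun i =>
    (κ (v, i) : WithBot (Fin p.Q))

/-- The threshold for sampling is `Q - keyWidth`. -/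
noncomputable def keyWidth (m : Fin n → p.Mem) (κ : Fin n × Fin p.g → Fin p.Q) : ℕ :=
  p.g * (p.Q - (WithBot.unbotD 0 (keyMax m κ) : Fin p.Q))

open Classical in
/-- The blocks that are sampled by some node. -/
noncomputable def chosen (m : Fin n → p.Mem) (κ σ : Fin n × Fin p.g → Fin p.Q) :
    Finset p.Block :=
  ((slots m).filter fun a => p.Q ≤ σ a + keyWidth m κ).image fun a => p.blk (m a.1).T a.2

noncomputable def seedMax (ς : Fin n → Fin (Fintype.card p.Fd)) : p.Fd :=
  (Fintype.equivFin p.Fd).symm (WithBot.unbotD ⟨0, Fintype.card_pos⟩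
    (univ.sup fun v => (ς v : WithBot (Fin (Fintype.card p.Fd)))))

theorem mem_slots {m : Fin n → p.Mem} {a : Fin n × Fin p.g} :
    a ∈ slots m ↔ (p.blk (m a.1).T a.2).1.Nonempty := by
  simp [slots]

theorem le_keyMax {m : Fin n → p.Mem} (κ : Fin n × Fin p.g → Fin p.Q) {a : Fin n × Fin p.g}
    (ha : a ∈ slots m) : (κ a : WithBot (Fin p.Q)) ≤ keyMax m κ := by
  classical
  refine le_trans ?_ (le_sup (mem_univ a.1))
  exact le_sup (f := fun i => (κ (a.1, i) : WithBot (Fin p.Q)))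
    (mem_filter.2 ⟨mem_univ a.2, mem_slots.1 ha⟩)

theorem exists_keyMax_eq {m : Fin n → p.Mem} (κ : Fin n × Fin p.g → Fin p.Q)
    (h : (slots m).Nonempty) : ∃ a ∈ slots m, keyMax m κ = κ a := by
  classical
  obtain ⟨a₀, ha₀⟩ := h
  have hne : keyMax m κ ≠ ⊥ := fun h => by
    have := le_keyMax κ ha₀
    rw [h, le_bot_iff] at this
    exact WithBot.coe_ne_bot this
  obtain ⟨v, -, hv⟩ := exists_mem_eq_sup univ ⟨a₀.1, mem_univ _⟩ fun v =>
    (univ.filter fun i : Fin p.g => (p.blk (m v).T i).1.Nonempty).sup fun i =>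
      (κ (v, i) : WithBot (Fin p.Q))
  have hv' : keyMax m κ = (univ.filter fun i : Fin p.g => (p.blk (m v).T i).1.Nonempty).sup
      fun i => (κ (v, i) : WithBot (Fin p.Q)) := hv
  rcases (univ.filter fun i : Fin p.g => (p.blk (m v).T i).1.Nonempty).eq_empty_or_nonempty with
    he | he
  · rw [he, sup_empty] at hv'
    exact absurd hv' hne
  · obtain ⟨i, hi, hi'⟩ := exists_mem_eq_sup _ he fun i => (κ (v, i) : WithBot (Fin p.Q))
    exact ⟨(v, i), mem_slots.2 (mem_filter.1 hi).2, hv'.trans hi'⟩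

theorem exists_seedMax_eq (hn : 0 < n) (ς : Fin n → Fin (Fintype.card p.Fd)) :
    ∃ v, seedMax (p := p) ς = (Fintype.equivFin p.Fd).symm (ς v) := by
  obtain ⟨v, -, hv⟩ := exists_mem_eq_sup univ ⟨⟨0, hn⟩, mem_univ _⟩ fun v : Fin n =>
    (ς v : WithBot (Fin (Fintype.card p.Fd)))
  exact ⟨v, by rw [seedMax, hv]; rfl⟩

/-- The maximum of the seeds is not uniform, so all n seeds are required to be good; this is the
factor n in `hF`. -/
theorem half_le_expect_seed (hn : 0 < n) (hinj : Function.Injective p.toFd) {X : Finset p.Block}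
    (hX : X.card ≤ p.G) (hF : 2 * (n * (2 ^ p.G * (2 * p.G + 1))) ≤ Fintype.card p.Fd) :
    1 / 2 ≤ 𝔼 ς : Fin n → Fin (Fintype.card p.Fd), ind (p.GoodSeed (seedMax ς) X) := by
  classical
  set A : Finset (Fin (Fintype.card p.Fd)) :=
    univ.filter fun i => ¬ p.GoodSeed ((Fintype.equivFin p.Fd).symm i) X with hA
  have hAc : A.card ≤ 2 ^ p.G * (2 * p.G + 1) := by
    refine le_trans ?_ (card_not_goodSeed_le hinj hX)
    rw [← card_image_of_injective A (Fintype.equivFin p.Fd).symm.injective]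
    refine card_le_card fun a ha => ?_
    obtain ⟨i, hi, rfl⟩ := mem_image.1 ha
    exact mem_filter.2 ⟨mem_univ _, (mem_filter.1 hi).2⟩
  have h1 := expect_exists_hit_le A (univ : Finset (Fin n))
  have h2 : ((univ : Finset (Fin n)).card : ℝ) * dens A ≤ 1 / 2 := by
    rw [dens, card_univ, Fintype.card_fin, Fintype.card_fin, mul_div_assoc',
      div_le_iff₀ (by exact_mod_cast Fintype.card_pos)]
    have h3 : 2 * (n * A.card) ≤ Fintype.card p.Fd :=
      (Nat.mul_le_mul_left _ (Nat.mul_le_mul_left _ hAc)).trans hF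
    have h4 : (2 : ℝ) * (n * A.card) ≤ Fintype.card p.Fd := by exact_mod_cast h3
    linarith
  have hpt : ∀ ς : Fin n → Fin (Fintype.card p.Fd),
      1 - ind (∃ v ∈ univ, ς v ∈ A) ≤ ind (p.GoodSeed (seedMax ς) X) := fun ς => by
    by_cases h : ∃ v ∈ univ, ς v ∈ A
    · rw [ind_pos h, sub_self]; exact ind_nonneg _
    · rw [ind_pos (P := p.GoodSeed _ _)]
      · linarith [ind_nonneg (∃ v ∈ univ, ς v ∈ A)]
      · obtain ⟨v, hv⟩ := exists_seedMax_eq (p := p) hn ς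
        rw [hv]
        by_contra hb
        exact h ⟨v, mem_univ _, mem_filter.2 ⟨mem_univ _, hb⟩⟩
  refine le_trans ?_ (expect_le_expect fun ς _ => hpt ς)
  rw [expect_sub_distrib, Fintype.expect_const]
  linarith

theorem div_one_add_mono {a b : ℝ} (ha : 0 ≤ a) (hab : a ≤ b) : a / (1 + a) ≤ b / (1 + b) := by
  rw [div_le_div_iff₀ (by linarith) (by linarith)]
  nlinarith

theorem card_holders_le {m : Fin n → p.Mem} (hlight : ∀ v, (m v).T.card ≤ p.g * p.s)
    (τ : p.Tok) [DecidablePred fun a : Fin n × Fin p.g => τ ∈ (p.blk (m a.1).T a.2).1] :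
    (holders m τ).card ≤
      (univ.filter fun a : Fin n × Fin p.g => τ ∈ (p.blk (m a.1).T a.2).1).card := by
  classical
  calc _ ≤ ((univ.filter fun a : Fin n × Fin p.g => τ ∈ (p.blk (m a.1).T a.2).1).image
          Prod.fst).card := by
        refine card_le_card fun v hv => ?_
        obtain ⟨i, hi⟩ := exists_mem_blk (hlight v) (mem_holders.1 hv)
        exact mem_image.2 ⟨(v, i), mem_filter.2 ⟨mem_univ _, hi⟩, rfl⟩
    _ ≤ _ := card_image_le

/-- The probability that a token is in a sampled block, that not too many blocks are sampled, and
that the seed is good for them. -/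
theorem le_expect_chosen {m : Fin n → p.Mem} (hlight : ∀ v, (m v).T.card ≤ p.g * p.s)
    (hinj : Function.Injective p.toFd)
    (hF : 2 * (n * (2 ^ p.G * (2 * p.G + 1))) ≤ Fintype.card p.Fd)
    (hG : 4 * (1 + 4 * p.g) ≤ p.G) (hQ : (slots m).card ≤ p.Q) {τ : p.Tok}
    (hτ : (holders m τ).Nonempty) {q : ℝ} (hq0 : 0 ≤ q) (hq1 : q ≤ 1)
    (hq : 4 * (slots m).card * q ≤ p.g) :
    1 / 8 * ((holders m τ).card * q / (1 + (holders m τ).card * q)) ≤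
      𝔼 κ : Fin n × Fin p.g → Fin p.Q, 𝔼 σ : Fin n × Fin p.g → Fin p.Q,
      𝔼 ς : Fin n → Fin (Fintype.card p.Fd), ind ((∃ B ∈ chosen m κ σ, τ ∈ B.1) ∧ (chosen m κ σ).card ≤ p.G ∧
        p.GoodSeed (seedMax ς) (chosen m κ σ)) := by
  classical
  obtain ⟨v₀, hv₀⟩ := hτ
  have hn : 0 < n := v₀.pos
  have hQR : (0 : ℝ) < p.Q := by exact_mod_cast p.Q_pos
  set J : Finset (Fin n × Fin p.g) := univ.filter fun a => τ ∈ (p.blk (m a.1).T a.2).1 with hJ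
  have hJh : ((holders m τ).card : ℝ) ≤ J.card := by
    exact_mod_cast card_holders_le hlight τ
  have hI : (slots m).Nonempty := by
    obtain ⟨i, hi⟩ := exists_mem_blk (hlight v₀) (mem_holders.1 hv₀)
    exact ⟨(v₀, i), mem_slots.2 ⟨τ, hi⟩⟩
  set Φ := (slots m).card with hΦ
  have hΦR : (0 : ℝ) < Φ := by exact_mod_cast hI.card_pos
  set y : ℝ := (holders m τ).card * q / (1 + (holders m τ).card * q) with hy
  have hy0 : 0 ≤ y := by positivity
  have hkey := half_le_expect_key (slots m) hI hQ
  have hmain : ∀ κ : Fin n × Fin p.g → Fin p.Q,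
      ind ((∀ a ∈ slots m, p.Q ≤ 4 * Φ * (p.Q - κ a)) ∧
        ∃ a ∈ slots m, Φ * (p.Q - κ a) ≤ 4 * p.Q) * (1 / 4 * y) ≤
      𝔼 σ : Fin n × Fin p.g → Fin p.Q, 𝔼 ς : Fin n → Fin (Fintype.card p.Fd), ind ((∃ B ∈ chosen m κ σ, τ ∈ B.1) ∧ (chosen m κ σ).card ≤ p.G ∧
        p.GoodSeed (seedMax ς) (chosen m κ σ)) := by
    intro κ
    by_cases hκ : (∀ a ∈ slots m, p.Q ≤ 4 * Φ * (p.Q - κ a)) ∧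
        ∃ a ∈ slots m, Φ * (p.Q - κ a) ≤ 4 * p.Q
    swap
    · rw [ind_neg hκ, zero_mul]
      exact expect_nonneg fun σ _ => expect_nonneg fun ς _ => ind_nonneg _
    rw [ind_pos hκ, one_mul]
    obtain ⟨hκ1, a₁, ha₁, hκ2⟩ := hκ
    obtain ⟨a₀, ha₀, hK⟩ := exists_keyMax_eq κ hI
    set w := p.Q - (κ a₀ : ℕ) with hw
    have hwid : keyWidth m κ = p.g * w := by
      rw [keyWidth, hK]; rfl
    have hw1 : p.Q ≤ 4 * Φ * w := hκ1 a₀ ha₀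
    have hw2 : Φ * w ≤ 4 * p.Q := by
      refine (Nat.mul_le_mul_left _ ?_).trans hκ2
      have : κ a₁ ≤ κ a₀ := by
        have := le_keyMax κ ha₁
        rw [hK] at this
        exact WithBot.coe_le_coe.1 this
      have : (κ a₁ : ℕ) ≤ κ a₀ := this
      omega
    -- The width g·w may exceed Q when there are few slots; then every block is selected, and q ≤ 1
    -- suffices for the bound.
    set c := min (p.g * w) p.Q with hc
    set A : Finset (Fin p.Q) := univ.filter fun v : Fin p.Q => p.Q ≤ v + c with hA
    have hdens : dens A = c / p.Q := dens_filter_le_add (min_le_right _ _)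
    have hmemA : ∀ v : Fin p.Q, v ∈ A ↔ p.Q ≤ v + keyWidth m κ := fun v => by
      rw [hA, mem_filter, hwid, hc]
      simp only [mem_univ, true_and]
      omega
    have hd1 : q ≤ dens A := by
      rw [hdens, le_div_iff₀ hQR, hc]
      push_cast
      refine le_min ?_ ?_
      · have h1 : (p.Q : ℝ) ≤ 4 * Φ * w := by exact_mod_cast hw1
        calc q * p.Q ≤ q * (4 * Φ * w) := by gcongr
          _ = 4 * Φ * q * w := by ring
          _ ≤ p.g * w := by gcongr
      · nlinarith
    have hd2 : (Φ : ℝ) * dens A ≤ 4 * p.g := by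
      rw [hdens, mul_div_assoc', div_le_iff₀ hQR]
      have h1 : (Φ : ℝ) * w ≤ 4 * p.Q := by exact_mod_cast hw2
      have h2 : (c : ℝ) ≤ p.g * w := by exact_mod_cast min_le_left _ _
      calc (Φ : ℝ) * c ≤ Φ * (p.g * w) := by gcongr
        _ = p.g * (Φ * w) := by ring
        _ ≤ p.g * (4 * p.Q) := by gcongr
        _ = _ := by ring
    have hGR : (4 : ℝ) * (1 + 4 * p.g) ≤ p.G := by exact_mod_cast hG
    -- At most 4g selections are expected, so 4(1 + 4g) ≤ G leaves room for this bound. The factor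
    -- 1/8 collects 1/2 each for the keys, the selection and the seed.
    have hhit := le_expect_hit A J (slots m) (c := p.G) (by linarith)
    have hyJ : y ≤ J.card * dens A / (1 + J.card * dens A) := by
      refine div_one_add_mono (by positivity) ?_
      gcongr
    calc 1 / 4 * y ≤ (𝔼 σ : Fin n × Fin p.g → Fin p.Q,
          ind ((∃ a ∈ J, σ a ∈ A) ∧ ∑ a ∈ slots m, hit A a σ ≤ p.G)) * (1 / 2) := by linarith
      _ = 𝔼 σ : Fin n × Fin p.g → Fin p.Q,
          ind ((∃ a ∈ J, σ a ∈ A) ∧ ∑ a ∈ slots m, hit A a σ ≤ p.G) * (1 / 2) := expect_mul _ _ _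
      _ ≤ _ := by
        refine expect_le_expect fun σ _ => ?_
        by_cases hσ : (∃ a ∈ J, σ a ∈ A) ∧ ∑ a ∈ slots m, hit A a σ ≤ p.G
        swap
        · rw [ind_neg hσ, zero_mul]
          exact expect_nonneg fun ς _ => ind_nonneg _
        rw [ind_pos hσ, one_mul]
        obtain ⟨⟨a, haJ, haA⟩, hsum⟩ := hσ
        have h1 : ∃ B ∈ chosen m κ σ, τ ∈ B.1 := by
          have hτa := (mem_filter.1 haJ).2
          exact ⟨_, mem_image.2 ⟨a, mem_filter.2 ⟨mem_slots.2 ⟨τ, hτa⟩, (hmemA _).1 haA⟩, rfl⟩,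
            hτa⟩
        have h2 : (chosen m κ σ).card ≤ p.G := by
          have h3 : (((slots m).filter fun a => p.Q ≤ σ a + keyWidth m κ).card : ℝ) ≤ p.G := by
            refine le_trans (le_of_eq ?_) hsum
            rw [card_filter, Nat.cast_sum]
            refine sum_congr rfl fun a _ => ?_
            by_cases h : σ a ∈ A
            · rw [hit, ind_pos h, if_pos ((hmemA _).1 h), Nat.cast_one]
            · rw [hit, ind_neg h, if_neg (fun h' => h ((hmemA _).2 h')), Nat.cast_zero]
          exact card_image_le.trans (by exact_mod_cast h3)
        refine (half_le_expect_seed hn hinj h2 hF).trans ?_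
        exact expect_le_expect fun ς _ => ind_mono fun h => ⟨h1, h2, h⟩
  calc 1 / 8 * y ≤ (𝔼 κ : Fin n × Fin p.g → Fin p.Q,
        ind ((∀ a ∈ slots m, p.Q ≤ 4 * Φ * (p.Q - κ a)) ∧
          ∃ a ∈ slots m, Φ * (p.Q - κ a) ≤ 4 * p.Q)) * (1 / 4 * y) := by
        have : (0 : ℝ) ≤ 1 / 4 * y := by positivity
        nlinarith
    _ = 𝔼 κ : Fin n × Fin p.g → Fin p.Q,
        ind ((∀ a ∈ slots m, p.Q ≤ 4 * Φ * (p.Q - κ a)) ∧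
          ∃ a ∈ slots m, Φ * (p.Q - κ a) ≤ 4 * p.Q) * (1 / 4 * y) := expect_mul _ _ _
    _ ≤ _ := expect_le_expect fun κ _ => hmain κ


variable {p : Par} {n : ℕ}

/-! ### A phase -/

open Classical in
/-- The tokens that are not yet delivered. -/
noncomputable def und (m : Fin n → p.Mem) : Finset p.Tok := univ.biUnion fun v => (m v).T

theorem mem_und {m : Fin n → p.Mem} {τ : p.Tok} : τ ∈ und m ↔ ∃ v, τ ∈ (m v).T := by
  simp [und]

theorem subset_und (m : Fin n → p.Mem) (v : Fin n) : (m v).T ⊆ und m :=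
  fun _ h => mem_und.2 ⟨v, h⟩

/-- The result of the first flooding of a phase. -/
noncomputable def ledOf (m : Fin n → p.Mem) (x : Fin n → p.Coin) : p.Fl :=
  univ.sup fun w => (m w).drawn (x w)

section Coordinates

variable (m : Fin n → p.Mem) (x : Fin n → p.Coin)

theorem sup_fst {α β ι : Type} [SemilatticeSup α] [OrderBot α] [SemilatticeSup β] [OrderBot β]
    (s : Finset ι) (f : ι → α × β) : (s.sup f).1 = s.sup fun i => (f i).1 :=
  apply_sup_eq_sup_comp Prod.fst (fun _ _ => rfl) rfl

theorem sup_snd {α β ι : Type} [SemilatticeSup α] [OrderBot α] [SemilatticeSup β] [OrderBot β]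
    (s : Finset ι) (f : ι → α × β) : (s.sup f).2 = s.sup fun i => (f i).2 :=
  apply_sup_eq_sup_comp Prod.snd (fun _ _ => rfl) rfl

theorem exists_eq_of_sup_ne_bot {α ι : Type} [LinearOrder α] [OrderBot α] {s : Finset ι}
    {f : ι → α} (h : s.sup f ≠ ⊥) : ∃ i ∈ s, s.sup f = f i := by
  rcases s.eq_empty_or_nonempty with rfl | hs
  · exact absurd sup_empty h
  · exact exists_mem_eq_sup s hs f

theorem ledOf_heavy_eq_bot : (ledOf m x).1 = ⊥ ↔ ∀ v, (m v).T.card ≤ p.g * p.s := by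
  rw [ledOf, sup_fst, Finset.sup_eq_bot_iff]
  simp only [mem_univ, true_imp_iff, Mem.drawn]
  refine forall_congr' fun v => ?_
  split_ifs with h
  · simp [h]
  · simp [not_lt.1 h]

theorem exists_heavy_of_ledOf (h : (ledOf m x).1 ≠ ⊥) :
    ∃ v, p.g * p.s < (m v).T.card ∧ (ledOf m x).1 = (m v).uid := by
  have h1 : (ledOf m x).1 = univ.sup fun w => ((m w).drawn (x w)).1 := sup_fst _ _
  rw [h1] at h ⊢
  obtain ⟨v, -, hv⟩ := exists_eq_of_sup_ne_bot h
  rw [hv] at h ⊢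
  refine ⟨v, ?_⟩
  simp only [Mem.drawn] at h ⊢
  split_ifs at h ⊢ with hc
  · exact ⟨hc, rfl⟩
  · exact absurd rfl h

theorem ledOf_active : (ledOf m x).2.1 =
    univ.sup fun w => if (m w).T.Nonempty then ((m w).uid : WithBot (Fin p.U)) else ⊥ := by
  rw [ledOf, sup_snd, sup_fst]
  exact sup_congr rfl fun w _ => by simp [Mem.drawn]

theorem ledOf_active_eq_bot : (ledOf m x).2.1 = ⊥ ↔ und m = ∅ := by
  rw [ledOf_active, Finset.sup_eq_bot_iff, eq_empty_iff_forall_notMem]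
  simp only [mem_univ, true_imp_iff, mem_und, not_exists]
  rw [forall_comm]
  simp only [← eq_empty_iff_forall_notMem]
  refine forall_congr' fun v => ?_
  split_ifs with h
  · simp [h.ne_empty]
  · simp [not_nonempty_iff_eq_empty.1 h]

theorem exists_active_of_ledOf (h : (ledOf m x).2.1 ≠ ⊥) : ∃ v, (ledOf m x).2.1 = (m v).uid := by
  rw [ledOf_active] at h ⊢
  obtain ⟨v, -, hv⟩ := exists_eq_of_sup_ne_bot h
  rw [hv] at h ⊢
  refine ⟨v, ?_⟩
  split_ifs at h ⊢ with hc
  · rfl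
  · exact absurd rfl h

theorem exists_tokSet_ledOf (h : und m ≠ ∅) : ∃ τ ∈ und m, p.tokSet (ledOf m x).2.2.1 = {τ} := by
  have h1 : (ledOf m x).2.2.1 = univ.sup fun w => (m w).T.sup fun τ =>
      (p.tokCode τ : WithBot (Fin (Fintype.card p.Tok))) := by
    rw [ledOf, sup_snd, sup_snd, sup_fst]; rfl
  have hb : (ledOf m x).2.2.1 ≠ ⊥ := by
    obtain ⟨τ, hτ⟩ := nonempty_iff_ne_empty.2 h
    obtain ⟨v, hv⟩ := mem_und.1 hτ
    intro hb
    rw [h1, Finset.sup_eq_bot_iff] at hb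
    have := hb v (mem_univ _)
    rw [Finset.sup_eq_bot_iff] at this
    exact WithBot.coe_ne_bot (this τ hv)
  rw [h1] at hb ⊢
  obtain ⟨v, -, hv⟩ := exists_eq_of_sup_ne_bot hb
  rw [hv] at hb ⊢
  obtain ⟨τ, hτ, hτ'⟩ := exists_eq_of_sup_ne_bot hb
  refine ⟨τ, mem_und.2 ⟨v, hτ⟩, ?_⟩
  rw [hτ']
  ext τ'
  simp only [tokSet, mem_filter, mem_univ, true_and, WithBot.coe_inj, mem_singleton,
    EmbeddingLike.apply_eq_iff_eq]

theorem width_ledOf : p.width (ledOf m x) = keyWidth m fun a => (x a.1).key a.2 := by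
  have h1 : (ledOf m x).2.2.2.1 = keyMax m fun a => (x a.1).key a.2 := by
    rw [ledOf, sup_snd, sup_snd, sup_snd, sup_fst]; rfl
  rw [width, h1, keyWidth]

theorem seedOf_ledOf : p.seedOf (ledOf m x) = seedMax fun v => (x v).seed := by
  have h1 : (ledOf m x).2.2.2.2.1 =
      univ.sup fun v => ((x v).seed : WithBot (Fin (Fintype.card p.Fd))) := by
    rw [ledOf, sup_snd, sup_snd, sup_snd, sup_snd, sup_fst]; rfl
  rw [seedOf, h1, seedMax]

end Coordinates

/-- The state after drawing, flooding and sampling. -/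
noncomputable def sampleState (m : Fin n → p.Mem) (x : Fin n → p.Coin) : Fin n → p.Mem := fun v =>
  ({ m v with acc := ledOf m x, smp := (x v).smp } : p.Mem).doSample

variable (p) in
def drawStage : List Kind := [.draw] ++ (List.replicate p.L .flood ++ [.sample])

theorem gstep_eq {m : Fin n → p.Mem} (hm : Running m) (k : Kind) (G : SimpleGraph (Fin n))
    (x : Fin n → p.Coin) : gstep k G m x = fun v => upd k (m v) (x v) (inbox k G m x v) :=
  funext fun v => gstep_apply hm k G x v

/-- Selection and seed are fixed by the coins of the draw round, whose graph is chosen before them.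
Later graphs in this stage are irrelevant. -/
theorem drawStage_reach (hL : n ≤ p.L) {m m' : Fin n → p.Mem} (hm : Running m) (G : CGraph n)
    (x : Fin n → p.Coin)
    (h : Reach gstep (List.replicate p.L Kind.flood ++ [.sample]) (gstep .draw G.1 m x) m') :
    m' = sampleState m x := by
  rw [gstep_eq hm, Reach.append] at h
  obtain ⟨m₃, h3, G', x', h4⟩ := h
  have hr₂ : Running fun v => upd .draw (m v) (x v) (inbox .draw G.1 m x v) := fun v => hm v
  have h3' := flood_reach hL hr₂ h3
  have hr : Running m₃ := by rw [h3']; exact fun v => hm v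
  rw [show m' = _ from h4, gstep_eq hr, h3']
  rfl

theorem upper_drawStage_le [Nonempty (CGraph n)] (hL : n ≤ p.L) {m : Fin n → p.Mem}
    (hm : Running m) (f : (Fin n → p.Mem) → ℝ) :
    upper gstep p.drawStage f m ≤ 𝔼 x, f (sampleState m x) :=
  upper_cons_le fun G => expect_le_expect fun x _ => upper_le_of_forall fun m' h => by
    rw [drawStage_reach hL hm G x h]

/-- What holds after the sampling if the flooded value is `a`. -/
structure Ready (m : Fin n → p.Mem) (a : p.Fl) : Prop where
  running : Running m
  uid_inj : Function.Injective fun v => (m v).uid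
  led_eq : ∀ v, (m v).led = a
  R_eq : ∀ v, ∀ e, e ∈ (m v).R ↔ ∃ B ∈ (m v).X, p.hashVec (p.seedOf a) B = e
  X_sub : ∀ v, ∀ B ∈ (m v).X, B.1.Nonempty ∧ B.1 ⊆ (m v).T
  X_empty : a.1 ≠ ⊥ → ∀ v, (m v).X = ∅
  active : a.2.1 ≠ ⊥ → ∃ v, a.2.1 = (m v).uid
  heavy : a.1 ≠ ⊥ → ∃ v, p.g * p.s < (m v).T.card ∧ a.1 = (m v).uid
  tok : a.2.1 ≠ ⊥ → ∃ τ ∈ und m, p.tokSet a.2.2.1 = {τ}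

theorem und_sampleState (m : Fin n → p.Mem) (x : Fin n → p.Coin) :
    und (sampleState m x) = und m := rfl

theorem sampleState_ready {m : Fin n → p.Mem} (hm : Running m)
    (hu : Function.Injective fun v => (m v).uid) (x : Fin n → p.Coin) :
    Ready (sampleState m x) (ledOf m x) := by
  classical
  refine ⟨fun v => hm v, hu, fun v => rfl, fun v e => ?_, fun v B hB => ?_, fun h v => ?_,
    fun h => exists_active_of_ledOf m x h, fun h => exists_heavy_of_ledOf m x h, fun h => ?_⟩
  · simp [sampleState, Mem.doSample]
  · simp only [sampleState, Mem.doSample, Mem.sampled] at hB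
    split_ifs at hB with hc
    · obtain ⟨i, hi, rfl⟩ := mem_image.1 hB
      exact ⟨(mem_filter.1 hi).2.1, fun τ hτ => (mem_blk.1 hτ).1⟩
    · simp at hB
  · simp only [sampleState, Mem.doSample, Mem.sampled]
    rw [if_neg h]
  · rw [Ne, ledOf_active_eq_bot] at h
    exact exists_tokSet_ledOf m x h

theorem mode_sampleState (m : Fin n → p.Mem) (x : Fin n → p.Coin) (v : Fin n) :
    (sampleState m x v).mode = true ↔ (m v).mode = true ∧ ∃ w, p.g * p.s < (m w).T.card := by
  simp only [sampleState, Mem.doSample, Bool.and_eq_true, decide_eq_true_eq]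
  rw [Ne, ledOf_heavy_eq_bot]
  simp

/-- All sampled blocks. -/
def Sampled (m : Fin n → p.Mem) (B : p.Block) : Prop := ∃ v, B ∈ (m v).X

theorem sampled_sampleState {m : Fin n → p.Mem} (hlight : ∀ v, (m v).T.card ≤ p.g * p.s)
    (x : Fin n → p.Coin) (B : p.Block) : Sampled (sampleState m x) B ↔
      B ∈ chosen m (fun a => (x a.1).key a.2) (fun a => (x a.1).smp a.2) := by
  classical
  have h := (ledOf_heavy_eq_bot m x).2 hlight
  simp only [Sampled, sampleState, Mem.doSample, Mem.sampled, if_pos h, chosen, mem_image,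
    mem_filter, mem_univ, true_and, mem_slots, Prod.exists, width_ledOf]


variable {p : Par} {n : ℕ}

/-! ### The coding stages of a phase -/

variable (p) in
def endStage : List Kind := [.decode] ++ (List.replicate p.L .flood ++ [.finish])

variable (p) in
def leadStage : List Kind := [.lead] ++ (List.replicate p.H .code ++ p.endStage)

variable (p) in
def codeStage : List Kind := List.replicate p.H .code ++ p.leadStage

theorem phase_eq : p.phase = List.replicate p.F .fwd ++ (p.drawStage ++ p.codeStage) := by
  simp [phase, drawStage, codeStage, leadStage, endStage]

/-- The state after decoding, flooding of the failure flag, and finishing. -/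
noncomputable def endState (m : Fin n → p.Mem) : Fin n → p.Mem := fun v =>
  ({ (m v).doDecode with acc := univ.sup fun w => (m w).doDecode.acc } : p.Mem).doFinish

theorem endStage_reach (hL : n ≤ p.L) {m m' : Fin n → p.Mem} (hm : Running m)
    (h : Reach gstep p.endStage m m') : m' = endState m := by
  obtain ⟨G, x, h⟩ := h
  change Reach gstep (List.replicate p.L Kind.flood ++ [.finish]) _ m' at h
  rw [gstep_eq hm, Reach.append] at h
  obtain ⟨m₃, h3, G', x', h4⟩ := h
  have hr₂ : Running fun v => upd .decode (m v) (x v) (inbox .decode G.1 m x v) := fun v => hm v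
  have h3' := flood_reach hL hr₂ h3
  have hr : Running m₃ := by rw [h3']; exact fun v => hm v
  rw [show m' = _ from h4, gstep_eq hr, h3']
  rfl

theorem failed_iff (m : Fin n → p.Mem) :
    (univ.sup fun w => (m w).doDecode.acc).2.2.2.2.2 = true ↔ ∃ w, ¬ (m w).DecodeOk := by
  rw [sup_snd, sup_snd, sup_snd, sup_snd, sup_snd]
  constructor
  · intro h
    obtain ⟨w, -, hw⟩ := exists_eq_of_sup_ne_bot (s := univ)
      (f := fun w => (m w).doDecode.acc.2.2.2.2.2) (by rw [h]; decide)
    rw [h] at hw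
    simp only [Mem.doDecode, flag] at hw
    exact ⟨w, by simpa using hw.symm⟩
  · rintro ⟨w, hw⟩
    have := le_sup (f := fun w => (m w).doDecode.acc.2.2.2.2.2) (mem_univ w)
    have h1 : (m w).doDecode.acc.2.2.2.2.2 = true := by
      simp only [Mem.doDecode, flag]
      simpa using hw
    rw [h1] at this
    exact top_le_iff.1 this

/-! ### Soundness and success of the coding stages -/

section

variable {m : Fin n → p.Mem} {a : p.Fl}

open Classical in
/-- The identifier of the leader. -/
noncomputable def leaderId (a : p.Fl) : WithBot (Fin p.U) := if a.1 = ⊥ then a.2.1 else a.1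

theorem Ready.exists_leader (h : Ready m a) (ha : a.2.1 ≠ ⊥) :
    ∃ v, leaderId a = (m v).uid ∧ (a.1 ≠ ⊥ → p.g * p.s < (m v).T.card) := by
  by_cases hh : a.1 = ⊥
  · obtain ⟨v, hv⟩ := h.active ha
    exact ⟨v, by rw [leaderId, if_pos hh, hv], fun h' => absurd hh h'⟩
  · obtain ⟨v, hc, hv⟩ := h.heavy hh
    exact ⟨v, by rw [leaderId, if_neg hh, hv], fun _ => hc⟩

/-- The state with other sets of vectors. -/
def withR (m : Fin n → p.Mem) (R : Fin n → Finset p.Vec) : Fin n → p.Mem := fun v =>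
  { m v with R := R v }

open Classical in
theorem leadStep (h : Ready m a) {v₀ : Fin n} (hv₀ : leaderId a = (m v₀).uid)
    (R : Fin n → Finset p.Vec) (G : CGraph n) (x : Fin n → p.Coin) :
    gstep .lead G.1 (withR m R) x = withR m fun v =>
      if v = v₀ then univ.image fun j => p.idxVec j ((withR m R v₀).bcast j) else ∅ := by
  have hr : Running (withR m R) := fun v => h.running v
  rw [gstep_eq hr]
  funext v
  simp only [upd, Mem.doLead, withR]
  congr 1
  have h1 : (withR m R v).leader = leaderId a := by
    simp only [Mem.leader, withR, h.led_eq v, leaderId]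
  have h2 : (withR m R v).leader = ((withR m R v).uid : WithBot (Fin p.U)) ↔ v = v₀ := by
    rw [h1, hv₀, WithBot.coe_inj]
    exact ⟨fun h' => (h.uid_inj h').symm, fun h' => h' ▸ rfl⟩
  by_cases hv : v = v₀
  · subst hv
    rw [if_pos rfl]
    exact if_pos (h2.2 rfl)
  · rw [if_neg hv]
    exact if_neg fun h' => hv (h2.1 h')

open Classical in
theorem allVec_lead (D : Fin p.G → p.Block) (v₀ : Fin n) :
    allVec (withR m fun v => if v = v₀ then univ.image fun j => p.idxVec j (D j) else ∅) =
      univ.image fun j => p.idxVec j (D j) := by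
  ext e
  simp only [allVec, withR, mem_biUnion, mem_univ, true_and]
  constructor
  · rintro ⟨v, hv⟩
    split_ifs at hv
    · exact hv
    · simp at hv
  · exact fun he => ⟨v₀, by simpa using he⟩

open Classical in
/-- The tokens that are removed if the leader broadcasts `D`. -/
noncomputable def remSet (D : Fin p.G → p.Block) (a : p.Fl) (ok : Prop) : Finset p.Tok :=
  (if ok then univ.biUnion fun j => (D j).1 else ∅) ∪ p.tokSet a.2.2.1

theorem decoded_eq {μ : p.Mem} (hinj : Function.Injective p.toFd) {D : Fin p.G → p.Block}
    (hR : ∀ e ∈ μ.R, e ∈ p.spanOf (univ.image fun j => p.idxVec j (D j)))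
    {j : Fin p.G} (h : ∃ B, p.idxVec j B ∈ p.spanOf μ.R) : μ.decoded j = D j := by
  rw [Mem.decoded, dif_pos h]
  exact eq_of_idxVec_mem_span hinj hR h.choose_spec

/-- All vectors come from one leader, so any node that can decode obtains D itself. With the flooded
failure flag, all nodes remove the same set of tokens. -/
theorem endState_apply (h : Ready m a) (ha : a.2.1 ≠ ⊥) (hinj : Function.Injective p.toFd)
    {D : Fin p.G → p.Block} {R : Fin n → Finset p.Vec}
    (hR : ∀ v, ∀ e ∈ R v, e ∈ p.spanOf (univ.image fun j => p.idxVec j (D j))) (v : Fin n) :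
    (endState (withR m R) v).uid = (m v).uid ∧
    (endState (withR m R) v).T = (m v).T \ remSet D a (∀ w, (withR m R w).DecodeOk) ∧
    (endState (withR m R) v).Del = (m v).Del ∪ remSet D a (∀ w, (withR m R w).DecodeOk) ∧
    (endState (withR m R) v).mode = (m v).mode ∧ (endState (withR m R) v).out = none := by
  classical
  set acc := univ.sup fun w => (withR m R w).doDecode.acc with hacc
  have hrem : ({ (withR m R v).doDecode with acc := acc } : p.Mem).removed =
      remSet D a (∀ w, (withR m R w).DecodeOk) := by
    have hf := failed_iff (withR m R)
    rw [← hacc] at hf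
    simp only [Mem.removed, remSet]
    have hled : (withR m R v).doDecode.led = a := h.led_eq v
    rw [hled]
    congr 1
    by_cases hok : ∀ w, (withR m R w).DecodeOk
    · have : acc.2.2.2.2.2 = false := by
        rw [← Bool.not_eq_true, hf]; push Not; exact hok
      rw [this, if_pos hok]
      simp only [Bool.false_eq_true, if_false]
      refine congrArg _ (funext fun j => ?_)
      exact congrArg Subtype.val (decoded_eq hinj (hR v) ((hok v).1 j))
    · have : acc.2.2.2.2.2 = true := by
        rw [hf]; push Not at hok; exact hok
      rw [this, if_neg hok, if_pos rfl]
  have hfin : endState (withR m R) v = { ({ (withR m R v).doDecode with acc := acc } : p.Mem) with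
      T := (m v).T \ remSet D a (∀ w, (withR m R w).DecodeOk)
      Del := (m v).Del ∪ remSet D a (∀ w, (withR m R w).DecodeOk) } := by
    rw [← hrem]
    have hled : (withR m R v).doDecode.led = a := h.led_eq v
    simp only [endState, Mem.doFinish]
    rw [if_neg (by rw [hled]; exact ha)]
    rfl
  rw [hfin]
  exact ⟨rfl, rfl, rfl, rfl, h.running v⟩

/-- The blocks that the leader broadcasts hold undelivered tokens, if all nodes could decode. -/
theorem remSet_subset (h : Ready m a) (hinj : Function.Injective p.toFd) (ha : a.2.1 ≠ ⊥)
    {R R' : Fin n → Finset p.Vec} (hR : ∀ v, ∀ e ∈ R v, e ∈ p.spanOf (allVec m)) {v₀ : Fin n}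
    (hR' : ∀ v, ∀ e ∈ R' v, e ∈ p.spanOf (univ.image fun j =>
      p.idxVec j ((withR m R v₀).bcast j))) :
    remSet (withR m R v₀).bcast a (∀ w, (withR m R' w).DecodeOk) ⊆ und m := by
  classical
  refine union_subset ?_ ?_
  swap
  · obtain ⟨τ, hτ, hτ'⟩ := h.tok ha
    rw [hτ']
    exact singleton_subset_iff.2 hτ
  split_ifs with hok
  swap
  · exact empty_subset _
  refine biUnion_subset.2 fun j _ τ hτ => ?_
  have hled : (withR m R v₀).led = a := h.led_eq v₀
  have hD : ∀ w, ∀ B ∈ (m w).X, ∃ j, (withR m R v₀).bcast j = B := fun w B hB => by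
    obtain ⟨j, hj⟩ := (hok w).2 B hB
    exact ⟨j, by rw [← hj]; exact (decoded_eq hinj (hR' w) ((hok w).1 j)).symm⟩
  revert hD hτ
  simp only [Mem.bcast]
  rw [hled]
  set Y := p.decSet (p.seedOf a) (withR m R v₀).R with hY
  intro hτ hD
  by_cases hh : a.1 = ⊥
  swap
  · rw [if_neg hh] at hτ
    split_ifs at hτ
    · exact mem_und.2 ⟨v₀, (mem_blk.1 hτ).1⟩
    · simp [emptyBlock] at hτ
  simp only [if_pos hh] at hτ hD
  by_cases hg : p.GoodSeed (p.seedOf a) Y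
  swap
  · rw [if_neg hg] at hτ
    simp [emptyBlock] at hτ
  simp only [if_pos hg] at hτ hD
  set X : Finset p.Block := univ.biUnion fun v => (m v).X with hX
  -- The nodes' own checks: each selected block was broadcast, and it is not one of the empty
  -- fillers.
  have hXY : X ⊆ Y := fun B hB => by
    obtain ⟨w, -, hw⟩ := mem_biUnion.1 hB
    obtain ⟨j, hj⟩ := hD w B hw
    rcases p.enum_mem Y j with h1 | h1
    · rwa [hj] at h1
    · have := (h.X_sub w B hw).1
      rw [← hj, h1] at this
      simp [emptyBlock] at this
  have hvec : allVec m = X.image (p.hashVec (p.seedOf a)) := by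
    ext e
    simp only [allVec, mem_biUnion, mem_univ, true_and, h.R_eq, hX, mem_image]
    constructor
    · rintro ⟨v, B, hB, rfl⟩
      exact ⟨B, ⟨v, hB⟩, rfl⟩
    · rintro ⟨B, ⟨v, hB⟩, rfl⟩
      exact ⟨v, B, hB, rfl⟩
  -- The leader's vectors lie in the span of those of X ⊆ Y, and the seed is good for Y, so no block
  -- outside X can appear. Hence Y = X without any probabilistic assumption.
  have hYX : Y ⊆ X := fun B hB => by
    refine hg.mem_of_mem_span hinj hXY ?_
    rw [← hvec]
    have h1 : p.hashVec (p.seedOf a) B ∈ p.spanOf (R v₀) := (mem_filter.1 hB).2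
    exact Submodule.span_le.2 (fun e he => hR v₀ e he) h1
  rcases p.enum_mem Y j with h1 | h1
  · obtain ⟨w, -, hw⟩ := mem_biUnion.1 (hYX h1)
    exact mem_und.2 ⟨w, (h.X_sub w _ hw).2 hτ⟩
  · rw [h1] at hτ
    simp [emptyBlock] at hτ

theorem card_remSet_le (h : Ready m a) (ha : a.2.1 ≠ ⊥) (D : Fin p.G → p.Block) (ok : Prop) :
    (remSet D a ok).card ≤ p.G * p.s + 1 := by
  classical
  refine (card_union_le _ _).trans (add_le_add ?_ ?_)
  · split_ifs
    · refine card_biUnion_le.trans ((sum_le_sum fun j _ => (D j).2).trans ?_)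
      simp
    · simp
  · obtain ⟨τ, -, hτ⟩ := h.tok ha
    rw [hτ, card_singleton]

/-- What a phase does after the sampling, if there are undelivered tokens. -/
theorem codeStage_reach (h : Ready m a) (ha : a.2.1 ≠ ⊥) (hinj : Function.Injective p.toFd)
    (hL : n ≤ p.L) {m' : Fin n → p.Mem} (hr : Reach gstep p.codeStage m m') :
    ∃ S ⊆ und m, S.Nonempty ∧ S.card ≤ p.G * p.s + 1 ∧ ∀ v, (m' v).uid = (m v).uid ∧
      (m' v).T = (m v).T \ S ∧ (m' v).Del = (m v).Del ∪ S ∧ (m' v).mode = (m v).mode ∧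
        (m' v).out = none := by
  classical
  obtain ⟨v₀, hv₀, -⟩ := h.exists_leader ha
  rw [codeStage, Reach.append] at hr
  obtain ⟨m₅, h5, hr⟩ := hr
  obtain ⟨R, rfl, -, hR⟩ := code_reach h.running h5
  obtain ⟨G, x, hr⟩ := hr
  change Reach gstep (List.replicate p.H .code ++ p.endStage) (gstep .lead G.1 (withR m R) x) m'
    at hr
  rw [leadStep h hv₀, Reach.append] at hr
  obtain ⟨m₇, h7, hr⟩ := hr
  obtain ⟨R', rfl, -, hR'⟩ := code_reach (by exact fun v => h.running v) h7
  rw [allVec_lead] at hR'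
  have hm' : m' = endState (withR m R') := endStage_reach hL (by exact fun v => h.running v) hr
  refine ⟨_, remSet_subset h hinj ha hR hR', ?_, card_remSet_le h ha _ _, fun v => ?_⟩
  · obtain ⟨τ, hτ, hτ'⟩ := h.tok ha
    exact ⟨τ, mem_union_right _ (by rw [hτ']; exact mem_singleton_self τ)⟩
  · rw [hm']
    exact endState_apply h ha hinj hR' v

theorem codeStage_reach_of_bot (h : Ready m a) (ha : a.2.1 = ⊥)
    (hL : n ≤ p.L) {m' : Fin n → p.Mem} (hr : Reach gstep p.codeStage m m') :
    ∀ v, (m' v).out = some (m v).Del := by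
  classical
  rw [codeStage, Reach.append] at hr
  obtain ⟨m₅, h5, hr⟩ := hr
  obtain ⟨R, rfl, -, hR⟩ := code_reach h.running h5
  obtain ⟨G, x, hr⟩ := hr
  change Reach gstep (List.replicate p.H .code ++ p.endStage) (gstep .lead G.1 (withR m R) x) m'
    at hr
  have hrun : Running (withR m R) := fun v => h.running v
  rw [gstep_eq hrun, Reach.append] at hr
  obtain ⟨m₇, h7, hr⟩ := hr
  have hrun' : Running fun v => upd .lead (withR m R v) (x v)
    (inbox .lead G.1 (withR m R) x v) := fun v => h.running v
  obtain ⟨R', rfl, -, hR'⟩ := code_reach hrun' h7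
  have hm' := endStage_reach hL (by exact fun v => h.running v) hr
  intro v
  rw [hm']
  simp only [endState, Mem.doFinish]
  rw [if_pos]
  · rfl
  · exact (congrArg (fun a : p.Fl => a.2.1) (h.led_eq v)).trans ha

/-- The tokens that a phase tries to deliver. -/
def Payload (m : Fin n → p.Mem) (a : p.Fl) (τ : p.Tok) : Prop :=
  if a.1 = ⊥ then ∃ B, Sampled m B ∧ τ ∈ B.1
  else ∃ v, leaderId a = (m v).uid ∧ ∃ i : Fin p.g, τ ∈ (p.blk (m v).T i).1

/-- The payload is delivered with probability at least `1/2`. -/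
theorem upper_codeStage_le [Nonempty (CGraph n)] (h : Ready m a) (ha : a.2.1 ≠ ⊥)
    (hinj : Function.Injective p.toFd) (hL : n ≤ p.L) (hgG : p.g ≤ p.G)
    (hH : (2 : ℝ) ^ p.G * (2 ^ n * (3 / 4) ^ p.H) ≤ 1 / 4) {X : Finset p.Block}
    (hX : ∀ B, B ∈ X ↔ Sampled m B) (hXG : X.card ≤ p.G)
    (hgood : a.1 = ⊥ → p.GoodSeed (p.seedOf a) X) :
    upper gstep p.codeStage (fun m' => ind (∃ τ, Payload m a τ ∧ τ ∈ und m')) m ≤ 1 / 2 := by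
  classical
  obtain ⟨v₀, hv₀, -⟩ := h.exists_leader ha
  have hvec : allVec m = X.image (p.hashVec (p.seedOf a)) := by
    ext e
    simp only [allVec, mem_biUnion, mem_univ, true_and, h.R_eq, hX, mem_image, Sampled]
    constructor
    · rintro ⟨v, B, hB, rfl⟩
      exact ⟨B, ⟨v, hB⟩, rfl⟩
    · rintro ⟨B, ⟨v, hB⟩, rfl⟩
      exact ⟨v, B, hB, rfl⟩
  have hc : (allVec m).card ≤ p.G := by rw [hvec]; exact card_image_le.trans hXG
  rw [codeStage, upper_append]
  -- Two coding stages, each failing with probability at most 1/4.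
  calc _ ≤ upper gstep (List.replicate p.H Kind.code) (fun m₅ =>
        ind (¬ ∀ v, ∀ e ∈ allVec m, e ∈ p.spanOf (m₅ v).R) + 1 / 4) m := ?_
    _ ≤ 1 / 4 + 1 / 4 := (upper_add_le _ _ _ _).trans (add_le_add
        ((upper_code_le h.running hc _).trans hH) (upper_le_of_forall fun _ _ => le_rfl))
    _ = 1 / 2 := by norm_num
  refine upper_mono fun m₅ h5 => ?_
  by_cases hb : ∀ v, ∀ e ∈ allVec m, e ∈ p.spanOf (m₅ v).R
  swap
  · rw [ind_pos hb]
    exact (upper_le_of_forall fun _ _ => ind_le_one _).trans (by norm_num)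
  rw [ind_neg (not_not.2 hb), zero_add]
  obtain ⟨R, rfl, -, hR⟩ := code_reach h.running h5
  refine upper_cons_le fun G => expect_le univ_nonempty fun x _ => ?_
  change upper gstep (List.replicate p.H .code ++ p.endStage) _
    (gstep .lead G.1 (withR m R) x) ≤ _
  rw [leadStep h hv₀, upper_append]
  set D := (withR m R v₀).bcast with hD
  have hr6 : Running (withR m fun v =>
      if v = v₀ then univ.image fun j => p.idxVec j (D j) else ∅) := fun v => h.running v
  have hlem := upper_code_le hr6 (c := p.G) (by
    rw [allVec_lead]
    exact card_image_le.trans (by simp)) p.H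
  refine le_trans (upper_mono fun m₇ h7 => ?_) (hlem.trans hH)
  obtain ⟨R', rfl, -, hR'⟩ := code_reach hr6 h7
  rw [allVec_lead] at hR' ⊢
  refine upper_le_of_forall fun m' hm' => ?_
  rw [endStage_reach hL (by exact fun v => h.running v) hm']
  refine ind_mono ?_
  rintro ⟨τ, hτ, hτ'⟩ hdec
  have hled : (withR m R v₀).led = a := h.led_eq v₀
  have hex : ∀ v j, p.idxVec j (D j) ∈ p.spanOf (R' v) := fun v j =>
    hdec v _ (mem_image.2 ⟨j, mem_univ _, rfl⟩)
  -- Once the leader has the whole span and the seed is good, its candidates are exactly the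
  -- selected blocks.
  have hXD : a.1 = ⊥ → ∀ B ∈ X, ∃ j, D j = B := fun hh => by
    have hY : p.decSet (p.seedOf a) (R v₀) = X := by
      ext B
      simp only [decSet, mem_filter, mem_univ, true_and]
      constructor
      · intro hB
        refine (hgood hh).mem_of_mem_span hinj Subset.rfl ?_
        rw [← hvec]
        exact Submodule.span_le.2 (fun e he => hR v₀ e he) hB
      · intro hB
        refine hb v₀ _ ?_
        rw [hvec]
        exact mem_image_of_mem _ hB
    have hDe : D = p.enum X := by
      rw [hD, Mem.bcast, hled, if_pos hh]
      change (if p.GoodSeed (p.seedOf a) (p.decSet (p.seedOf a) (R v₀)) then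
        p.enum (p.decSet (p.seedOf a) (R v₀)) else _) = _
      rw [hY, if_pos (hgood hh)]
    rw [hDe]
    exact (enum_spec hXG).1
  have hok : ∀ w, (withR m R' w).DecodeOk := fun w => by
    refine ⟨fun j => ⟨D j, hex w j⟩, fun B hB => ?_⟩
    have hB' : B ∈ X := (hX B).2 ⟨w, hB⟩
    have hh : a.1 = ⊥ := by
      by_contra hh
      have hB2 : B ∈ (m w).X := hB
      rw [h.X_empty hh w] at hB2
      simp at hB2
    obtain ⟨j, hj⟩ := hXD hh B hB'
    exact ⟨j, by rw [← hj]; exact decoded_eq hinj (hR' w) ⟨D j, hex w j⟩⟩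
  have hτD : ∃ j, τ ∈ (D j).1 := by
    unfold Payload at hτ
    split_ifs at hτ with hh
    · obtain ⟨B, hB, hτB⟩ := hτ
      obtain ⟨j, hj⟩ := hXD hh B ((hX B).2 hB)
      exact ⟨j, by rwa [hj]⟩
    · obtain ⟨v, hv, i, hi⟩ := hτ
      have hvv : v = v₀ := h.uid_inj (WithBot.coe_inj.1 (hv.symm.trans hv₀))
      subst hvv
      refine ⟨⟨i, i.2.trans_le hgG⟩, ?_⟩
      rw [hD, Mem.bcast, hled, if_neg hh, if_pos i.2]
      exact hi
  obtain ⟨j, hj⟩ := hτD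
  obtain ⟨v, hv⟩ := mem_und.1 hτ'
  change τ ∈ (endState (withR m R') v).T at hv
  rw [(endState_apply h ha hinj hR' v).2.1, remSet, if_pos hok] at hv
  exact (mem_sdiff.1 hv).2 (mem_union_left _ (mem_biUnion.2 ⟨j, mem_univ _, hj⟩))

end


variable {p : Par} {n : ℕ}

/-! ### Progress in a phase -/

variable (p) in
/-- The rounds of a phase after the forwarding. -/
def mainStage : List Kind := p.drawStage ++ p.codeStage

theorem mainStage_reach {m m' : Fin n → p.Mem} (hm : Running m)
    (hu : Function.Injective fun v => (m v).uid) (hund : und m ≠ ∅)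
    (hinj : Function.Injective p.toFd) (hL : n ≤ p.L) (hr : Reach gstep p.mainStage m m') :
    ∃ S ⊆ und m, S.Nonempty ∧ S.card ≤ p.G * p.s + 1 ∧ ∀ v, (m' v).uid = (m v).uid ∧
      (m' v).T = (m v).T \ S ∧ (m' v).Del = (m v).Del ∪ S ∧
      ((m' v).mode = true ↔ (m v).mode = true ∧ ∃ w, p.g * p.s < (m w).T.card) ∧
        (m' v).out = none := by
  rw [mainStage, Reach.append] at hr
  obtain ⟨m₄, ⟨G, x, h⟩, hr⟩ := hr
  rw [drawStage_reach hL hm G x h] at hr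
  have ha : (ledOf m x).2.1 ≠ ⊥ := by rwa [Ne, ledOf_active_eq_bot]
  obtain ⟨S, hS, h1, h2, h3⟩ := codeStage_reach (sampleState_ready hm hu x) ha hinj hL hr
  refine ⟨S, hS, h1, h2, fun v => ?_⟩
  obtain ⟨h4, h5, h6, h7, h8⟩ := h3 v
  exact ⟨h4, h5, h6, by rw [h7, mode_sampleState], h8⟩

theorem mainStage_reach_of_empty {m m' : Fin n → p.Mem} (hm : Running m)
    (hu : Function.Injective fun v => (m v).uid) (hund : und m = ∅)
    (hL : n ≤ p.L) (hr : Reach gstep p.mainStage m m') (v : Fin n) :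
    (m' v).out = some (m v).Del := by
  rw [mainStage, Reach.append] at hr
  obtain ⟨m₄, ⟨G, x, h⟩, hr⟩ := hr
  rw [drawStage_reach hL hm G x h] at hr
  exact codeStage_reach_of_bot (sampleState_ready hm hu x) ((ledOf_active_eq_bot m x).2 hund) hL hr v

theorem und_sdiff {m m' : Fin n → p.Mem} {S : Finset p.Tok} (h : ∀ v, (m' v).T = (m v).T \ S) :
    und m' = und m \ S := by
  ext τ
  simp only [mem_und, mem_sdiff, h, exists_and_right]

/-- The invariant at the beginning of a phase; `A` is the set of all tokens. -/
structure Inv (A : Finset p.Tok) (m : Fin n → p.Mem) : Prop where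
  running : Running m
  uid_inj : Function.Injective fun v => (m v).uid
  total : ∀ v, und m ∪ (m v).Del = A
  mode_eq : ∀ v w, (m v).mode = (m w).mode

theorem Inv.fwd {A : Finset p.Tok} {m m' : Fin n → p.Mem} (h : Inv A m) {F : ℕ}
    (hr : Reach gstep (List.replicate F Kind.fwd) m m') :
    Inv A m' ∧ und m' = und m ∧ (∀ v, (m' v).mode = (m v).mode) ∧ (∀ v, (m' v).Del = (m v).Del) ∧
      ∀ v, (m v).mode = false → m' = m := by
  obtain ⟨T, rfl, h1, h2, h3⟩ := fwd_reach h.running hr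
  have hund : und (fun v => ({ m v with T := T v } : p.Mem)) = und m := by
    ext τ
    simp only [mem_und]
    constructor
    · rintro ⟨v, hv⟩
      exact h2 v τ hv
    · rintro ⟨v, hv⟩
      exact ⟨v, h1 v hv⟩
  refine ⟨⟨fun v => h.running v, h.uid_inj, fun v => ?_, fun v w => h.mode_eq v w⟩, hund,
    fun v => rfl, fun v => rfl, fun v hv => ?_⟩
  · rw [hund]; exact h.total v
  · funext w
    rw [h3 w (by rw [h.mode_eq w v]; exact hv)]

theorem Inv.main {A : Finset p.Tok} {m m' : Fin n → p.Mem} (h : Inv A m) (hund : und m ≠ ∅)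
    (hinj : Function.Injective p.toFd) (hL : n ≤ p.L) (hr : Reach gstep p.mainStage m m') :
    Inv A m' ∧ (und m').card < (und m).card := by
  obtain ⟨S, hS, hne, -, h3⟩ := mainStage_reach h.running h.uid_inj hund hinj hL hr
  have hu := und_sdiff fun v => (h3 v).2.1
  refine ⟨⟨fun v => (h3 v).2.2.2.2, ?_, fun v => ?_, fun v w => ?_⟩, ?_⟩
  · have : (fun v => (m' v).uid) = fun v => (m v).uid := funext fun v => (h3 v).1
    rw [this]
    exact h.uid_inj
  · rw [hu, (h3 v).2.2.1, ← h.total v]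
    ext τ
    simp only [mem_union, mem_sdiff]
    have := @hS τ
    tauto
  · rw [Bool.eq_iff_iff, (h3 v).2.2.2.1, (h3 w).2.2.2.1, h.mode_eq v w]
  · rw [hu]
    refine card_lt_card (sdiff_ssubset hS hne)

theorem Inv.phase {A : Finset p.Tok} {m m' : Fin n → p.Mem} (h : Inv A m)
    (hinj : Function.Injective p.toFd) (hL : n ≤ p.L) (hr : Reach gstep p.phase m m') :
    (und m = ∅ ∧ ∀ v, (m' v).out = some A) ∨ (Inv A m' ∧ (und m').card < (und m).card) := by
  rw [phase_eq, Reach.append] at hr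
  obtain ⟨m₁, h1, hr⟩ := hr
  obtain ⟨hI, hu, -, hD, -⟩ := h.fwd h1
  by_cases he : und m = ∅
  · refine Or.inl ⟨he, fun v => ?_⟩
    rw [mainStage_reach_of_empty hI.running hI.uid_inj (by rw [hu, he]) hL hr v, hD, ← h.total v, he,
      empty_union]
  · right
    rw [← hu] at he ⊢
    exact hI.main he hinj hL hr

/-! ### Probability of progress -/

/-- The relations between the parameters that the analysis uses. -/
structure Fits (p : Par) (n : ℕ) : Prop where
  inj : Function.Injective p.toFd
  flood : n ≤ p.L
  field : 2 * (n * (2 ^ p.G * (2 * p.G + 1))) ≤ Fintype.card p.Fd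
  keys : n * p.g ≤ p.Q
  sample : p.G = 20 * p.g
  code : (2 : ℝ) ^ p.G * (2 ^ n * (3 / 4) ^ p.H) ≤ 1 / 4

theorem card_slots_le_mul (m : Fin n → p.Mem) : (slots m).card ≤ n * p.g := by
  refine (card_le_univ _).trans ?_
  simp

/-- The probability 1/8 · (…) that a block with τ is selected under good conditions, times 1/2 for
successful coding. -/
theorem upper_mainStage_light_le [Nonempty (CGraph n)] (hp : Fits p n) {m : Fin n → p.Mem}
    (hm : Running m) (hu : Function.Injective fun v => (m v).uid)
    (hlight : ∀ v, (m v).T.card ≤ p.g * p.s) {τ : p.Tok} (hτ : τ ∈ und m) {q : ℝ} (hq0 : 0 ≤ q)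
    (hq1 : q ≤ 1) (hq : 4 * (slots m).card * q ≤ p.g) :
    upper gstep p.mainStage (fun m' => ind (τ ∈ und m')) m ≤
      1 - 1 / 16 * ((holders m τ).card * q / (1 + (holders m τ).card * q)) := by
  classical
  have hund : und m ≠ ∅ := ne_empty_of_mem hτ
  have hne : (holders m τ).Nonempty := by
    obtain ⟨v, hv⟩ := mem_und.1 hτ
    exact ⟨v, mem_holders.2 hv⟩
  have hg := p.g_pos
  have hmain := le_expect_chosen hlight hp.inj hp.field (by rw [hp.sample]; omega)
    ((card_slots_le_mul m).trans hp.keys) hne hq0 hq1 hq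
  rw [← expect_draw fun κ σ ς => ind ((∃ B ∈ chosen m κ σ, τ ∈ B.1) ∧ (chosen m κ σ).card ≤ p.G ∧
        p.GoodSeed (seedMax ς) (chosen m κ σ))] at hmain
  set ev : (Fin n → p.Coin) → Prop := fun x =>
    (∃ B ∈ chosen m (fun a => (x a.1).key a.2) (fun a => (x a.1).smp a.2), τ ∈ B.1) ∧
      (chosen m (fun a => (x a.1).key a.2) (fun a => (x a.1).smp a.2)).card ≤ p.G ∧
        p.GoodSeed (seedMax fun v => (x v).seed)
          (chosen m (fun a => (x a.1).key a.2) (fun a => (x a.1).smp a.2)) with hev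
  rw [mainStage, upper_append]
  refine (upper_drawStage_le hp.flood hm _).trans ?_
  calc _ ≤ 𝔼 x : Fin n → p.Coin, (1 - 1 / 2 * ind (ev x)) := expect_le_expect fun x _ => ?_
    _ = 1 - 1 / 2 * 𝔼 x : Fin n → p.Coin, ind (ev x) := by
        rw [expect_sub_distrib, Fintype.expect_const, mul_expect]
    _ ≤ _ := by linarith
  by_cases hx : ev x
  swap
  · rw [ind_neg hx]
    exact (upper_le_of_forall fun _ _ => ind_le_one _).trans (by norm_num)
  rw [ind_pos hx]
  obtain ⟨⟨B, hB, hτB⟩, hc, hgood⟩ := hx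
  have ha : (ledOf m x).2.1 ≠ ⊥ := by rwa [Ne, ledOf_active_eq_bot]
  have hb := (ledOf_heavy_eq_bot m x).2 hlight
  refine (le_trans (upper_mono fun m' _ => ?_) (upper_codeStage_le (sampleState_ready hm hu x) ha
    hp.inj hp.flood (by rw [hp.sample]; omega) hp.code
    (fun B => (sampled_sampleState hlight x B).symm) hc
    (fun _ => by rw [seedOf_ledOf]; exact hgood))).trans (by norm_num)
  refine ind_mono fun h => ⟨τ, ?_, h⟩
  rw [Payload, if_pos hb]
  exact ⟨B, (sampled_sampleState hlight x B).2 hB, hτB⟩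

/-- A heavy leader fills its first g blocks completely, so successful coding delivers at least g·s
tokens. -/
theorem upper_mainStage_heavy_le [Nonempty (CGraph n)] (hp : Fits p n) {m : Fin n → p.Mem}
    (hm : Running m) (hu : Function.Injective fun v => (m v).uid)
    (hheavy : ∃ v, p.g * p.s < (m v).T.card) :
    upper gstep p.mainStage (fun m' => ind (¬ (und m').card + p.g * p.s ≤ (und m).card)) m ≤
      1 / 2 := by
  classical
  have hund : und m ≠ ∅ := by
    obtain ⟨v, hv⟩ := hheavy
    obtain ⟨τ, hτ⟩ := card_pos.1 ((Nat.zero_le _).trans_lt hv)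
    exact ne_empty_of_mem (mem_und.2 ⟨v, hτ⟩)
  rw [mainStage, upper_append]
  refine (upper_drawStage_le hp.flood hm _).trans ?_
  refine expect_le univ_nonempty fun x _ => ?_
  have ha : (ledOf m x).2.1 ≠ ⊥ := by rwa [Ne, ledOf_active_eq_bot]
  have hb : (ledOf m x).1 ≠ ⊥ := by
    rw [Ne, ledOf_heavy_eq_bot]; push Not; exact hheavy
  have hready := sampleState_ready hm hu x
  refine le_trans (upper_mono fun m' hm' => ?_) (upper_codeStage_le hready ha
    hp.inj hp.flood (by rw [hp.sample]; omega) hp.code (X := ∅) (fun B => ?_) (by simp)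
    (fun h => absurd h hb))
  · refine ind_mono fun h => ?_
    by_contra hno
    push Not at hno
    obtain ⟨v₀, hv₀, hv₁⟩ := hready.exists_leader ha
    have hcard := le_card_biUnion_blk (hv₁ hb).le
    set P := univ.biUnion fun i : Fin p.g => (p.blk (sampleState m x v₀).T i).1 with hP
    obtain ⟨S, hS, -, -, h3⟩ := codeStage_reach hready ha hp.inj hp.flood hm'
    have hu' := und_sdiff fun v => (h3 v).2.1
    have hPu : P ⊆ und m := fun τ hτ => by
      obtain ⟨i, -, hi⟩ := mem_biUnion.1 hτ
      exact mem_und.2 ⟨v₀, (mem_blk.1 hi).1⟩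
    have hdis : Disjoint (und m') P := by
      rw [disjoint_right]
      intro τ hτ
      refine hno τ ?_
      obtain ⟨i, -, hi⟩ := mem_biUnion.1 hτ
      rw [Payload, if_neg hb]
      exact ⟨v₀, hv₀, i, hi⟩
    refine h ?_
    calc (und m').card + p.g * p.s ≤ (und m').card + P.card := by gcongr
      _ = (und m' ∪ P).card := (card_union_of_disjoint hdis).symm
      _ ≤ (und m).card := by
        refine card_le_card (union_subset ?_ hPu)
        rw [hu', und_sampleState]
        exact sdiff_subset
  · simp only [notMem_empty, false_iff]
    rintro ⟨v, hv⟩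
    rw [hready.X_empty hb v] at hv
    simp at hv


variable {p : Par} {n : ℕ}

/-! ### The potential -/

/-- The number of pairs of a node and an undelivered token that it knows. -/
def mass (m : Fin n → p.Mem) : ℕ := ∑ v, (m v).T.card

theorem mass_eq (m : Fin n → p.Mem) : mass m = ∑ τ ∈ und m, (holders m τ).card := by
  classical
  have h : ∀ v, (m v).T.card = ∑ τ ∈ und m, if τ ∈ (m v).T then 1 else 0 := fun v => by
    rw [← card_filter, filter_mem_eq_inter, inter_eq_right.2 (subset_und m v)]
  simp only [mass, h, holders, card_filter]
  exact sum_comm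

/-- Only the last nonempty block of a node can be incomplete; this accounts for the n. -/
theorem card_slots_le (m : Fin n → p.Mem) : ((slots m).card : ℝ) ≤ mass m / p.s + n := by
  classical
  have h1 : (slots m).card ≤ ∑ v, ((m v).T.card / p.s + 1) := by
    have h2 : slots m = univ.biUnion fun v : Fin n =>
        (univ.filter fun i : Fin p.g => (p.blk (m v).T i).1.Nonempty).image fun i => (v, i) := by
      ext ⟨v, i⟩
      simp [mem_slots]
    rw [h2]
    refine card_biUnion_le.trans (sum_le_sum fun v _ => card_image_le.trans ?_)
    exact card_nonempty_blk_le _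
  calc ((slots m).card : ℝ) ≤ ((∑ v, ((m v).T.card / p.s + 1) : ℕ) : ℝ) := by exact_mod_cast h1
    _ = ∑ v : Fin n, ((((m v).T.card / p.s : ℕ) : ℝ) + 1) := by push_cast; rfl
    _ ≤ ∑ v : Fin n, (((m v).T.card : ℝ) / p.s + 1) := by gcongr; exact Nat.cast_div_le
    _ = _ := by rw [sum_add_distrib, ← sum_div, mass]; simp

variable (p) in
/-- The rate of the exponential part of the potential. -/
noncomputable def rate : ℝ := 1 / (21 * (p.g * p.s))

theorem rate_pos : 0 < p.rate := by
  have h1 : (0 : ℝ) < p.g := by exact_mod_cast p.g_pos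
  have h2 : (0 : ℝ) < p.s := by exact_mod_cast p.s_pos
  rw [rate]; positivity

/-- Valid up to y = 1, which explains `rate`: a phase removes at most G·s + 1 ≤ 21·g·s tokens. -/
theorem exp_neg_le {y : ℝ} (h0 : 0 ≤ y) (h1 : y ≤ 1) : Real.exp (-y) ≤ 1 - y / 2 := by
  have h2 : 0 < 1 + y := by linarith
  rw [Real.exp_neg]
  calc (Real.exp y)⁻¹ ≤ (1 + y)⁻¹ := by
        gcongr
        linarith [Real.add_one_le_exp y]
    _ ≤ 1 - y / 2 := by
        rw [inv_le_iff_one_le_mul₀ h2]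
        nlinarith

/-- h + w is the loss of potential credited to a token with h holders, and h·q/(1 + h·q) the order
of its chance to be delivered. The hypothesis says that h·q is bounded below or w compensates for a
small q. -/
theorem gain_le {h q w : ℝ} (hh : 0 ≤ h) (hq0 : 0 ≤ q) (hw : 1 / 168 ≤ h * q / 2 + w * q) :
    1 / 168 * h ≤ (h + w) * (h * q / (1 + h * q)) := by
  have h1 : 0 ≤ h * q := by positivity
  rw [mul_div_assoc', le_div_iff₀ (by positivity)]
  nlinarith

/-- Since Φ ≤ M/s + n, one of the two summands dominates Φ: n is paid for by the holders (h ≥ n/g),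
M/s by the exponential. The constant is 1/168 = 1/(21·2·4). -/
theorem le_gain {h g Φ M s n : ℝ} (hg : 0 < g) (hs : 0 < s) (hΦ : 0 < Φ) (hM : 0 ≤ M)
    (hn : 0 ≤ n) (h1 : 1 ≤ h) (hh : n ≤ g * h) (hΦM : Φ ≤ M / s + n) :
    1 / 168 ≤ h * min 1 (g / (4 * Φ)) / 2 + M * (1 / (21 * (g * s))) / 2 * min 1 (g / (4 * Φ)) := by
  rcases min_choice 1 (g / (4 * Φ)) with h2 | h2 <;> rw [h2]
  · have : 0 ≤ M * (1 / (21 * (g * s))) / 2 * 1 := by positivity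
    linarith
  · have h3 : n / (8 * Φ) ≤ h * (g / (4 * Φ)) / 2 := by
      rw [div_le_iff₀ (by positivity)]
      calc n ≤ g * h := hh
        _ = _ := by field_simp; ring
    have h4 : M * (1 / (21 * (g * s))) / 2 * (g / (4 * Φ)) = 1 / 168 * ((M / s) / Φ) := by
      field_simp; ring
    have h5 : 1 / 168 * (n / Φ) ≤ n / (8 * Φ) := by
      have : n / (8 * Φ) = 1 / 8 * (n / Φ) := by field_simp
      rw [this]
      have : 0 ≤ n / Φ := by positivity
      linarith
    have h6 : 1 ≤ (M / s) / Φ + n / Φ := by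
      rw [← add_div, le_div_iff₀ hΦ]; linarith
    rw [h4]
    linarith

theorem upper_mass_le [Nonempty (CGraph n)] (hp : Fits p n) {m : Fin n → p.Mem}
    (hm : Running m) (hu : Function.Injective fun v => (m v).uid)
    (hlight : ∀ v, (m v).T.card ≤ p.g * p.s) (hund : und m ≠ ∅)
    (hh : ∀ τ ∈ und m, n ≤ p.g * (holders m τ).card) :
    upper gstep p.mainStage (fun m' => mass m' * Real.exp (p.rate * (und m').card)) m ≤
      (1 - 1 / 5376) * (mass m * Real.exp (p.rate * (und m).card)) := by
  classical
  have hg : (0 : ℝ) < p.g := by exact_mod_cast p.g_pos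
  have hs : (0 : ℝ) < p.s := by exact_mod_cast p.s_pos
  have hr := p.rate_pos
  set E := Real.exp (p.rate * (und m).card) with hE
  have hE0 : 0 < E := Real.exp_pos _
  set M : ℝ := ((mass m : ℕ) : ℝ) with hM
  have hM0 : 0 ≤ M := Nat.cast_nonneg _
  -- Linearised loss from delivering τ: its holders leave the mass, and the exponential drops by the
  -- relative amount rate/2.
  set c : p.Tok → ℝ := fun τ => (holders m τ).card + M * p.rate / 2 with hc
  have hc0 : ∀ τ, 0 ≤ c τ := fun τ => by positivity
  have hMsum : M = ∑ τ ∈ und m, ((holders m τ).card : ℝ) := by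
    rw [hM, mass_eq]; push_cast; rfl
  set Φ : ℝ := ((slots m).card : ℝ) with hΦ
  obtain ⟨τ₀, hτ₀⟩ := nonempty_iff_ne_empty.2 hund
  have hΦ0 : 0 < Φ := by
    obtain ⟨v, hv⟩ := mem_und.1 hτ₀
    obtain ⟨i, hi⟩ := exists_mem_blk (hlight v) hv
    have : (v, i) ∈ slots m := mem_slots.2 ⟨τ₀, hi⟩
    exact Nat.cast_pos.2 (card_pos.2 ⟨_, this⟩)
  -- The largest selection probability with 4Φq ≤ g and q ≤ 1.
  set q : ℝ := min 1 (p.g / (4 * Φ)) with hq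
  have hq0 : 0 ≤ q := by positivity
  have hq1 : q ≤ 1 := min_le_left _ _
  have hqΦ : 4 * ((slots m).card : ℝ) * q ≤ p.g := by
    calc 4 * Φ * q ≤ 4 * Φ * (p.g / (4 * Φ)) := by gcongr; exact min_le_right _ _
      _ = p.g := by field_simp
  set y : p.Tok → ℝ := fun τ => (holders m τ).card * q / (1 + (holders m τ).card * q) with hy
  have hgain : ∀ τ ∈ und m, 1 / 168 * ((holders m τ).card : ℝ) ≤ c τ * y τ := fun τ hτ => by
    refine gain_le (Nat.cast_nonneg _) hq0 ?_
    refine le_gain hg hs hΦ0 hM0 (Nat.cast_nonneg n) ?_ ?_ (card_slots_le m)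
    · obtain ⟨v, hv⟩ := mem_und.1 hτ
      exact_mod_cast card_pos.2 ⟨v, mem_holders.2 hv⟩
    · exact_mod_cast hh τ hτ
  have hpt : ∀ m', Reach gstep p.mainStage m m' →
      mass m' * Real.exp (p.rate * (und m').card) ≤
        E * (M - 1 / 2 * ∑ τ ∈ und m, c τ) + ∑ τ ∈ und m, E * c τ / 2 * ind (τ ∈ und m') := by
    intro m' hm'
    obtain ⟨S, hS, -, hScard, h3⟩ := mainStage_reach hm hu hund hp.inj hp.flood hm'
    have hu' : und m' = und m \ S := und_sdiff fun v => (h3 v).2.1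
    set a : ℝ := ∑ τ ∈ S, ((holders m τ).card : ℝ) with ha
    set z : ℝ := p.rate * S.card with hz
    have hsplit : ∀ f : p.Tok → ℝ, ∑ τ ∈ und m, f τ * ind (τ ∈ und m') =
        ∑ τ ∈ und m, f τ - ∑ τ ∈ S, f τ := fun f => by
      rw [← sum_sdiff hS (f := f), add_sub_cancel_right, ← sum_sdiff hS]
      have h5 : ∑ τ ∈ S, f τ * ind (τ ∈ und m') = 0 := sum_eq_zero fun τ hτ => by
        rw [ind_neg, mul_zero]
        rw [hu', mem_sdiff]; tauto
      rw [h5, add_zero]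
      refine sum_congr rfl fun τ hτ => ?_
      rw [ind_pos (by rwa [hu']), mul_one]
    have hmass : (mass m' : ℝ) = M - a := by
      have : (mass m' : ℝ) = ∑ τ ∈ und m \ S, ((holders m τ).card : ℝ) := by
        rw [mass_eq, hu']
        push_cast
        refine sum_congr rfl fun τ hτ => ?_
        congr 2
        ext v
        have := (mem_sdiff.1 hτ).2
        simp [mem_holders, (h3 v).2.1, this]
      rw [this, hMsum, ha, ← sum_sdiff hS]
      ring
    have hcard : ((und m').card : ℝ) = (und m).card - S.card := by
      rw [hu', card_sdiff_of_subset hS, Nat.cast_sub (card_le_card hS)]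
    have hz0 : 0 ≤ z := by positivity
    have hz1 : z ≤ 1 := by
      have h6 : S.card ≤ 21 * (p.g * p.s) := by
        refine hScard.trans ?_
        rw [hp.sample]
        have := Nat.mul_pos p.g_pos p.s_pos
        nlinarith
      have h7 : (S.card : ℝ) ≤ 21 * (p.g * p.s) := by exact_mod_cast h6
      calc z ≤ p.rate * (21 * (p.g * p.s)) := by rw [hz]; gcongr
        _ = 1 := by rw [rate]; field_simp
    have hexp : Real.exp (p.rate * (und m').card) ≤ E * (1 - z / 2) := by
      have : p.rate * (und m').card = p.rate * (und m).card + -z := by rw [hcard, hz]; ring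
      rw [this, Real.exp_add]
      exact mul_le_mul_of_nonneg_left (exp_neg_le hz0 hz1) hE0.le
    have ha0 : 0 ≤ a := sum_nonneg fun τ _ => Nat.cast_nonneg _
    have hMa : 0 ≤ M - a := by rw [← hmass]; exact Nat.cast_nonneg _
    have hcS : ∑ τ ∈ S, c τ = a + M * z / 2 := by
      rw [hc, sum_add_distrib, sum_const, nsmul_eq_mul, ha, hz]; ring
    have h8 : ∑ τ ∈ und m, E * c τ / 2 * ind (τ ∈ und m') =
        E / 2 * (∑ τ ∈ und m, c τ - ∑ τ ∈ S, c τ) := by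
      rw [hsplit, mul_sub, mul_sum, mul_sum]
      congr 1 <;> exact sum_congr rfl fun τ _ => by ring
    rw [h8, hcS, hmass]
    calc (M - a) * Real.exp (p.rate * (und m').card) ≤ (M - a) * (E * (1 - z / 2)) := by gcongr
      _ = E * ((M - a) * (1 - z / 2)) := by ring
      -- Both losses cannot be added in full because of the cross term a·z/2; as z ≤ 1, half of
      -- their sum is always lost.
      _ ≤ E * (M - 1 / 2 * (a + M * z / 2)) := by
        refine mul_le_mul_of_nonneg_left ?_ hE0.le
        nlinarith [mul_nonneg hMa hz0, mul_nonneg ha0 hz0]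
      _ = _ := by ring
  refine (upper_mono hpt).trans ((upper_affine_le _ _ _ _ (fun τ _ => by
    have := hc0 τ; positivity) _ _).trans ?_)
  calc _ ≤ E * (M - 1 / 2 * ∑ τ ∈ und m, c τ) +
        ∑ τ ∈ und m, E * c τ / 2 * (1 - 1 / 16 * y τ) := by
        refine add_le_add_right (sum_le_sum fun τ hτ => mul_le_mul_of_nonneg_left
          (upper_mainStage_light_le hp hm hu hlight hτ hq0 hq1 hqΦ) ?_) _
        have := hc0 τ
        positivity
    _ = E * (M - 1 / 32 * ∑ τ ∈ und m, c τ * y τ) := by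
        have : ∑ τ ∈ und m, E * c τ / 2 * (1 - 1 / 16 * y τ) =
            E / 2 * (∑ τ ∈ und m, c τ) - E / 32 * ∑ τ ∈ und m, c τ * y τ := by
          rw [mul_sum, mul_sum, ← sum_sub_distrib]
          exact sum_congr rfl fun τ _ => by ring
        rw [this]; ring
    _ ≤ E * (M - 1 / 32 * ∑ τ ∈ und m, 1 / 168 * ((holders m τ).card : ℝ)) := by
        have := sum_le_sum hgain
        gcongr
    -- The factor of decrease: 32 · 168 = 5376.
    _ = _ := by
        rw [← mul_sum, ← hMsum]; ring

/-- Delivering g·s tokens, which has probability at least 1/2, multiplies the exponential by at most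
41/42. This is better than needed; the constant is that of the light case. -/
theorem upper_exp_le [Nonempty (CGraph n)] (hp : Fits p n) {m : Fin n → p.Mem}
    (hm : Running m) (hu : Function.Injective fun v => (m v).uid)
    (hheavy : ∃ v, p.g * p.s < (m v).T.card) :
    upper gstep p.mainStage (fun m' => Real.exp (p.rate * (und m').card)) m ≤
      (1 - 1 / 5376) * Real.exp (p.rate * (und m).card) := by
  have hg : (0 : ℝ) < p.g := by exact_mod_cast p.g_pos
  have hs : (0 : ℝ) < p.s := by exact_mod_cast p.s_pos
  have hr := p.rate_pos
  set E := Real.exp (p.rate * (und m).card) with hE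
  have hE0 : 0 < E := Real.exp_pos _
  have hund : und m ≠ ∅ := by
    obtain ⟨v, hv⟩ := hheavy
    obtain ⟨τ, hτ⟩ := card_pos.1 ((Nat.zero_le _).trans_lt hv)
    exact ne_empty_of_mem (mem_und.2 ⟨v, hτ⟩)
  have hpt : ∀ m', Reach gstep p.mainStage m m' → Real.exp (p.rate * (und m').card) ≤
      E * (41 / 42) + E * (1 / 42) * ind (¬ (und m').card + p.g * p.s ≤ (und m).card) := by
    intro m' hm'
    obtain ⟨S, hS, -, -, h3⟩ := mainStage_reach hm hu hund hp.inj hp.flood hm'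
    have hu' : und m' = und m \ S := und_sdiff fun v => (h3 v).2.1
    by_cases h : (und m').card + p.g * p.s ≤ (und m).card
    · rw [ind_neg (not_not.2 h), mul_zero, add_zero]
      have h1 : ((und m').card : ℝ) + p.g * p.s ≤ (und m).card := by exact_mod_cast h
      have h2 : p.rate * (und m').card ≤ p.rate * (und m).card + -(1 / 21) := by
        have h4 : p.rate * (p.g * p.s) = 1 / 21 := by rw [rate]; field_simp
        nlinarith
      calc _ ≤ Real.exp (p.rate * (und m).card + -(1 / 21)) := Real.exp_le_exp.2 h2
        _ = E * Real.exp (-(1 / 21)) := Real.exp_add _ _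
        _ ≤ E * (1 - 1 / 21 / 2) := by
          gcongr
          exact exp_neg_le (by norm_num) (by norm_num)
        _ = _ := by ring
    · rw [ind_pos h]
      have h1 : ((und m').card : ℝ) ≤ (und m).card := by
        rw [hu']; exact_mod_cast card_le_card sdiff_subset
      calc _ ≤ E := Real.exp_le_exp.2 (by gcongr)
        _ = _ := by ring
  refine (upper_mono hpt).trans ((upper_add_le _ _ _ _).trans ?_)
  calc _ ≤ E * (41 / 42) + E * (1 / 42) * (1 / 2) := by
        refine add_le_add (upper_le_of_forall fun _ _ => le_rfl) ?_
        refine (upper_mul_le _ (by positivity) _ _).trans ?_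
        gcongr
        exact upper_mainStage_heavy_le hp hm hu hheavy
    _ ≤ _ := by nlinarith


variable {p : Par} {n : ℕ}

/-! ### Many phases -/

variable (p) in
/-- The rounds of `j` phases. -/
def phases : ℕ → List Kind
  | 0 => []
  | j + 1 => p.phase ++ phases j

theorem phases_succ' (j : ℕ) : p.phases (j + 1) = p.phases j ++ p.phase := by
  induction j with
  | zero => simp [phases]
  | succ j ih =>
    rw [phases]
    nth_rw 1 [ih]
    rw [← List.append_assoc]
    rfl

theorem und_gstep {m : Fin n → p.Mem} (h : und m = ∅) (k : Kind) (G : SimpleGraph (Fin n))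
    (x : Fin n → p.Coin) : und (gstep k G m x) = ∅ := by
  classical
  have hT : ∀ v, (m v).T = ∅ := fun v => subset_empty.1 (h ▸ subset_und m v)
  rw [eq_empty_iff_forall_notMem]
  intro τ hτ
  obtain ⟨v, hv⟩ := mem_und.1 hτ
  rw [gstep] at hv
  split_ifs at hv with ho
  · simp [hT] at hv
  cases k with
  | fwd =>
    simp only [upd, hT] at hv
    split_ifs at hv
    · rw [empty_union, recvTok] at hv
      obtain ⟨μ, hμ, hτμ⟩ := mem_biUnion.1 hv
      obtain ⟨w, -, rfl⟩ := Multiset.mem_map.1 (Multiset.mem_toFinset.1 hμ)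
      simp only [msg] at hτμ
      have := (mem_blk.1 hτμ).1
      simp [hT] at this
    · simp at hv
  | finish =>
    simp only [upd, Mem.doFinish] at hv
    split_ifs at hv <;> simp [hT] at hv
  | draw => simp [upd, hT] at hv
  | flood => simp [upd, hT] at hv
  | sample => simp [upd, Mem.doSample, hT] at hv
  | code => simp [upd, hT] at hv
  | lead => simp [upd, Mem.doLead, hT] at hv
  | decode => simp [upd, Mem.doDecode, hT] at hv

theorem gstep_of_isSome {m : Fin n → p.Mem} {v : Fin n} (h : (m v).out.isSome = true) (k : Kind)
    (G : SimpleGraph (Fin n)) (x : Fin n → p.Coin) : gstep k G m x v = m v :=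
  if_pos h

/-- All nodes have terminated with output `A`. -/
def Done (A : Finset p.Tok) (m : Fin n → p.Mem) : Prop := ∀ v, (m v).out = some A

theorem Done.reach {A : Finset p.Tok} {m m' : Fin n → p.Mem} (h : Done A m) {l : List Kind}
    (hr : Reach gstep l m m') : Done A m' :=
  Reach.invariant (I := Done A) (fun k _ G m x hm v => by
    rw [gstep_of_isSome (by rw [hm v]; rfl)]
    exact hm v) hr h

theorem Inv.phases {A : Finset p.Tok} {m m' : Fin n → p.Mem} (h : Inv A m)
    (hinj : Function.Injective p.toFd) (hL : n ≤ p.L) {j : ℕ}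
    (hr : Reach gstep (p.phases j) m m') :
    Done A m' ∨ Inv A m' ∧ (und m').card + j ≤ (und m).card := by
  induction j generalizing m with
  | zero =>
    rw [show m' = m from hr]
    exact Or.inr ⟨h, le_rfl⟩
  | succ j ih =>
    rw [Par.phases, Reach.append] at hr
    obtain ⟨m₁, h1, hr⟩ := hr
    rcases h.phase hinj hL h1 with ⟨-, hd⟩ | ⟨hI, hlt⟩
    · exact Or.inl (Done.reach hd hr)
    · rcases ih hI hr with hd | ⟨hI', hle⟩
      · exact Or.inl hd
      · exact Or.inr ⟨hI', by omega⟩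

/-- The tokens are still being forwarded, or no node is heavy and all tokens are well spread. -/
def Good (m : Fin n → p.Mem) : Prop :=
  (∀ v, (m v).mode = true) ∨ ((∀ v, (m v).mode = false) ∧
    (∀ v, (m v).T.card ≤ p.g * p.s) ∧ ∀ τ ∈ und m, n ≤ p.g * (holders m τ).card)

-- While forwarding is on, holders may still increase, so the mass is replaced by its upper bound
-- n². Switching it off can then only lower the potential.
open Classical in
noncomputable def pot (m : Fin n → p.Mem) : ℝ :=
  (if ∀ v, (m v).mode = true then (n : ℝ) ^ 2 else mass m) * Real.exp (p.rate * (und m).card)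

theorem pot_nonneg (m : Fin n → p.Mem) : 0 ≤ pot m := by
  unfold pot
  split_ifs <;> positivity

theorem mass_le {A : Finset p.Tok} {m : Fin n → p.Mem} (h : Inv A m) (hA : A.card ≤ n) :
    (mass m : ℝ) ≤ (n : ℝ) ^ 2 := by
  have h1 : ∀ v, (m v).T.card ≤ n := fun v =>
    (card_le_card ((subset_und m v).trans (subset_union_left.trans (h.total v).subset))).trans hA
  have h2 : mass m ≤ n ^ 2 := (sum_le_sum fun v _ => h1 v).trans (by simp [sq])
  exact_mod_cast h2

theorem card_und_le {A : Finset p.Tok} {m : Fin n → p.Mem} (h : Inv A m) (v : Fin n) :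
    und m ⊆ A :=
  subset_union_left.trans (h.total v).subset

/-- One phase. -/
theorem upper_phase_le [Nonempty (CGraph n)] (hp : Fits p n) (hn : 0 < n) {A : Finset p.Tok}
    (hA : A.card ≤ n) {ε : ℝ} (hε : (n : ℝ) * (2 ^ (n / p.g) * (1 - 1 / p.g / 2) ^ p.F) ≤ ε)
    {m : Fin n → p.Mem} (h : Inv A m) (hG : Good m) (hund : und m ≠ ∅)
    {f : (Fin n → p.Mem) → ℝ} (hf1 : ∀ m', f m' ≤ 1) {a c : ℝ} (ha : 0 ≤ a) (hc : 0 ≤ c)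
    (hf : ∀ m', Inv A m' → Good m' → f m' ≤ a * pot m' + c) :
    upper gstep p.phase f m ≤ (1 - 1 / 5376) * a * pot m + c + ε := by
  classical
  set v₀ : Fin n := ⟨0, hn⟩ with hv₀
  have hpot := pot_nonneg m
  set K : ℝ := (1 - 1 / 5376) * a * pot m + c with hK
  have hK0 : 0 ≤ K := by
    have : (0 : ℝ) ≤ 1 - 1 / 5376 := by norm_num
    positivity
  let few : p.Tok → (Fin n → p.Mem) → Prop := fun τ m₁ =>
    (∀ v, (m₁ v).T.card ≤ p.g * p.s) ∧ holders m₁ τ ≠ univ ∧ (holders m₁ τ).card ≤ n / p.g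
  have hg1 : (0 : ℝ) ≤ 1 - 1 / p.g / 2 := by
    have : (1 : ℝ) ≤ p.g := by exact_mod_cast p.g_pos
    have h2 : (1 : ℝ) / p.g ≤ 1 := (div_le_one (by linarith)).2 this
    linarith
  -- One fixed outcome of the forwarding. The last hypothesis excludes the badly spread outcomes,
  -- which are charged to ε by a union bound over the tokens.
  have hbase : ∀ m₁, Reach gstep (List.replicate p.F Kind.fwd) m m₁ →
      ((∀ v, (m v).mode = true) → ∀ τ ∈ und m, ¬ few τ m₁) →
      upper gstep p.mainStage f m₁ ≤ K := by
    intro m₁ h1 hnb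
    obtain ⟨hI, hu, hmode, -, hsame⟩ := h.fwd h1
    have hund₁ : und m₁ ≠ ∅ := by rwa [hu]
    by_cases hheavy : ∃ v, p.g * p.s < (m₁ v).T.card
    -- Without forwarding the token sets do not grow, so a node cannot become heavy again.
    · have hmt : ∀ v, (m v).mode = true := by
        rcases hG with hG | ⟨hmf, hl, -⟩
        · exact hG
        · obtain ⟨v, hv⟩ := hheavy
          rw [hsame v₀ (hmf v₀)] at hv
          exact absurd (hl v) (not_le.2 hv)
      have hpt : ∀ m', Reach gstep p.mainStage m₁ m' →
          f m' ≤ a * (n : ℝ) ^ 2 * Real.exp (p.rate * (und m').card) + c := by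
        intro m' hm'
        obtain ⟨S, -, -, -, h3⟩ := mainStage_reach hI.running hI.uid_inj hund₁ hp.inj hp.flood hm'
        have hm't : ∀ v, (m' v).mode = true := fun v => by
          rw [(h3 v).2.2.2.1, hmode]
          exact ⟨hmt v, hheavy⟩
        refine (hf m' (hI.main hund₁ hp.inj hp.flood hm').1 (Or.inl hm't)).trans (le_of_eq ?_)
        rw [pot, if_pos hm't, mul_assoc]
      refine (upper_mono hpt).trans ((upper_add_le _ _ _ _).trans ?_)
      refine add_le_add ?_ (upper_le_of_forall fun _ _ => le_rfl)
      refine (upper_mul_le _ (by positivity) _ _).trans ?_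
      calc _ ≤ a * (n : ℝ) ^ 2 * ((1 - 1 / 5376) * Real.exp (p.rate * (und m₁).card)) := by
            gcongr
            exact upper_exp_le hp hI.running hI.uid_inj hheavy
        _ = _ := by rw [pot, if_pos hmt, hu]; ring
    · have hlight : ∀ v, (m₁ v).T.card ≤ p.g * p.s := by
        push Not at hheavy; exact hheavy
      have hh : ∀ τ ∈ und m₁, n ≤ p.g * (holders m₁ τ).card := by
        rcases hG with hmt | ⟨hmf, -, hh⟩
        · intro τ hτ
          by_contra hlt
          rw [not_le] at hlt
          refine hnb hmt τ (by rwa [← hu]) ⟨hlight, fun hun => ?_, ?_⟩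
          · rw [hun, card_univ, Fintype.card_fin] at hlt
            exact absurd (Nat.le_mul_of_pos_left n p.g_pos) (not_le.2 hlt)
          · rw [Nat.le_div_iff_mul_le p.g_pos, mul_comm]
            exact hlt.le
        · rw [hsame v₀ (hmf v₀)]
          exact hh
      have hpt : ∀ m', Reach gstep p.mainStage m₁ m' →
          f m' ≤ a * (mass m' * Real.exp (p.rate * (und m').card)) + c := by
        intro m' hm'
        obtain ⟨S, -, -, -, h3⟩ := mainStage_reach hI.running hI.uid_inj hund₁ hp.inj hp.flood hm'
        have hu' : und m' = und m₁ \ S := und_sdiff fun v => (h3 v).2.1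
        have hm'f : ∀ v, (m' v).mode = false := fun v => by
          rw [← Bool.not_eq_true, (h3 v).2.2.2.1]
          exact fun h => hheavy h.2
        refine (hf m' (hI.main hund₁ hp.inj hp.flood hm').1 (Or.inr ⟨hm'f, fun v => ?_,
          fun τ hτ => ?_⟩)).trans (le_of_eq ?_)
        · rw [(h3 v).2.1]
          exact (card_le_card sdiff_subset).trans (hlight v)
        · rw [hu', mem_sdiff] at hτ
          have : holders m' τ = holders m₁ τ := by
            ext v
            simp [mem_holders, (h3 v).2.1, hτ.2]
          rw [this]
          exact hh τ hτ.1
        · rw [pot, if_neg]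
          exact fun h => by simpa [hm'f v₀] using h v₀
      refine (upper_mono hpt).trans ((upper_add_le _ _ _ _).trans ?_)
      refine add_le_add ?_ (upper_le_of_forall fun _ _ => le_rfl)
      refine (upper_mul_le _ ha _ _).trans ?_
      have hE : 0 < Real.exp (p.rate * (und m).card) := Real.exp_pos _
      have hmp : mass m₁ * Real.exp (p.rate * (und m₁).card) ≤ pot m := by
        rw [hu, pot]
        gcongr
        split_ifs with hmt
        · exact mass_le hI hA
        · rw [hsame v₀]
          rw [← Bool.not_eq_true]
          exact fun h0 => hmt fun v => (h.mode_eq v v₀).trans h0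
      calc _ ≤ a * ((1 - 1 / 5376) * (mass m₁ * Real.exp (p.rate * (und m₁).card))) := by
            gcongr
            exact upper_mass_le hp hI.running hI.uid_inj hlight hund₁ hh
        _ ≤ a * ((1 - 1 / 5376) * pot m) := by
            gcongr
        _ = _ := by ring
  rw [phase_eq, ← mainStage, upper_append]
  by_cases hmt : ∀ v, (m v).mode = true
  · calc _ ≤ upper gstep (List.replicate p.F Kind.fwd)
          (fun m₁ => K + ∑ τ ∈ und m, 1 * ind (few τ m₁)) m := upper_mono fun m₁ h1 => ?_
      _ ≤ K + ∑ τ ∈ und m, 1 * upper gstep (List.replicate p.F Kind.fwd)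
          (fun m₁ => ind (few τ m₁)) m :=
            upper_affine_le _ _ _ _ (fun _ _ => zero_le_one) _ _
      _ ≤ K + ∑ _τ ∈ und m, (2 : ℝ) ^ (n / p.g) * (1 - 1 / (p.g : ℝ) / 2) ^ p.F := by
            refine add_le_add_right (sum_le_sum fun τ hτ => ?_) _
            rw [one_mul]
            exact upper_fwd_le h.running hmt (mem_und.1 hτ) p.F (n / p.g)
      _ ≤ K + ε := by
            gcongr
            rw [sum_const, nsmul_eq_mul]
            refine le_trans ?_ hε
            gcongr
            exact (card_le_card (card_und_le h v₀)).trans hA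
    by_cases hb : ∃ τ ∈ und m, few τ m₁
    · obtain ⟨τ, hτ, hfew⟩ := hb
      have h2 : 1 ≤ ∑ τ ∈ und m, 1 * ind (few τ m₁) := by
        refine le_trans ?_ (single_le_sum (fun τ _ => by rw [one_mul]; exact ind_nonneg _) hτ)
        rw [ind_pos hfew, one_mul]
      exact (upper_le_of_forall fun m' _ => hf1 m').trans (by linarith)
    · push Not at hb
      have h2 : 0 ≤ ∑ τ ∈ und m, 1 * ind (few τ m₁) :=
        sum_nonneg fun τ _ => by rw [one_mul]; exact ind_nonneg _
      linarith [hbase m₁ h1 fun _ => hb]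
  · have hε0 : 0 ≤ ε := le_trans (by positivity) hε
    refine (upper_le_of_forall fun m₁ h1 => hbase m₁ h1 fun h' => absurd h' hmt).trans ?_
    linarith

theorem one_le_pot {m : Fin n → p.Mem} (hn : 0 < n) (hund : und m ≠ ∅) :
    1 ≤ pot m := by
  have hE : 1 ≤ Real.exp (p.rate * (und m).card) :=
    Real.one_le_exp (mul_nonneg p.rate_pos.le (Nat.cast_nonneg _))
  unfold pot
  refine one_le_mul_of_one_le_of_one_le ?_ hE
  split_ifs
  · exact one_le_pow₀ (by exact_mod_cast hn)
  · obtain ⟨τ, hτ⟩ := nonempty_iff_ne_empty.2 hund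
    obtain ⟨v, hv⟩ := mem_und.1 hτ
    have : 0 < mass m := (card_pos.2 ⟨τ, hv⟩).trans_le
      (single_le_sum (f := fun v => (m v).T.card) (fun _ _ => Nat.zero_le _) (mem_univ v))
    exact_mod_cast this

/-- The potential is at least 1 while tokens are undelivered (`one_le_pot`), so its geometric decay
bounds the probability of this event; each phase adds at most ε for failed forwarding. -/
theorem upper_phases_le [Nonempty (CGraph n)] (hp : Fits p n) (hn : 0 < n) {A : Finset p.Tok}
    (hA : A.card ≤ n) {ε : ℝ} (hε : (n : ℝ) * (2 ^ (n / p.g) * (1 - 1 / p.g / 2) ^ p.F) ≤ ε)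
    (hε0 : 0 ≤ ε) (j : ℕ) {m : Fin n → p.Mem} (h : Inv A m) (hG : Good m) :
    upper gstep (p.phases j) (fun m' => ind (und m' ≠ ∅)) m ≤
      (1 - 1 / 5376) ^ j * pot m + j * ε := by
  induction j generalizing m with
  | zero =>
    simp only [phases, upper, pow_zero, one_mul, Nat.cast_zero, zero_mul, add_zero]
    by_cases hund : und m = ∅
    · rw [ind_neg (not_not.2 hund)]; exact pot_nonneg m
    · exact (ind_le_one _).trans (one_le_pot hn hund)
  | succ j ih =>
    have hρ : (0 : ℝ) ≤ 1 - 1 / 5376 := by norm_num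
    by_cases hund : und m = ∅
    · have hpot := pot_nonneg m
      refine le_trans (upper_le_of_forall (c := 0) fun m' hr => ?_) (by positivity)
      have : und m' = ∅ := Reach.invariant (I := fun m => und m = ∅)
        (fun k _ G m x hm => und_gstep hm k G.1 x) hr hund
      rw [ind_neg (not_not.2 this)]
    · rw [phases, upper_append]
      refine (upper_phase_le hp hn hA hε h hG hund
        (fun m' => upper_le_of_forall fun _ _ => ind_le_one _) (pow_nonneg hρ j)
        (mul_nonneg (Nat.cast_nonneg j) hε0) fun m' => ih).trans (le_of_eq ?_)
      push_cast
      ring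

/-- After one more phase, all nodes have terminated. -/
theorem upper_not_halted_le [Nonempty (CGraph n)] (hp : Fits p n) (hn : 0 < n) {A : Finset p.Tok}
    (hA : A.card ≤ n) {ε : ℝ} (hε : (n : ℝ) * (2 ^ (n / p.g) * (1 - 1 / p.g / 2) ^ p.F) ≤ ε)
    (hε0 : 0 ≤ ε) (j : ℕ) {m : Fin n → p.Mem} (h : Inv A m) (hG : Good m) :
    upper gstep (p.phases (j + 1)) (fun m' => ind (¬ ∀ v, (m' v).out.isSome = true)) m ≤
      (1 - 1 / 5376) ^ j * pot m + j * ε := by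
  refine le_trans ?_ (upper_phases_le hp hn hA hε hε0 j h hG)
  rw [phases_succ', upper_append]
  refine upper_mono fun m' hr => ?_
  by_cases hund : und m' = ∅
  · rw [ind_neg (not_not.2 hund)]
    refine upper_le_of_forall fun m'' hr' => ?_
    have hd : Done A m'' := by
      rcases h.phases hp.inj hp.flood hr with hd | ⟨hI, -⟩
      · exact hd.reach hr'
      · rcases hI.phase hp.inj hp.flood hr' with ⟨-, hd⟩ | ⟨-, hlt⟩
        · exact hd
        · rw [hund] at hlt; simp at hlt
    rw [ind_neg (not_not.2 fun v => by rw [hd v]; rfl)]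
  · rw [ind_pos hund]
    exact upper_le_of_forall fun _ _ => ind_le_one _


variable {p : Par} {n : ℕ}

/-! ### The whole execution -/

theorem pre_add (t : ℕ) {i : ℕ} (hi : i ≤ p.phase.length) :
    p.pre (t * p.phase.length + i) = p.pre (t * p.phase.length) ++ p.phase.take i := by
  induction i with
  | zero => simp
  | succ i ih =>
    rw [← Nat.add_assoc, pre, ih (by omega), List.append_assoc]
    congr 1
    rw [List.take_add_one, List.getElem?_eq_getElem (by omega)]
    congr 1
    simp only [sched, Option.toList_some]
    congr 1
    have : (t * p.phase.length + i) % p.phase.length = i := by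
      rw [Nat.add_comm, Nat.add_mul_mod_self_right, Nat.mod_eq_of_lt (by omega)]
    simp only [this]

theorem pre_mul_length (j : ℕ) : p.pre (j * p.phase.length) = p.phases j := by
  induction j with
  | zero => simp [pre, phases]
  | succ j ih =>
    rw [Nat.succ_mul, pre_add j le_rfl, ih, List.take_length, phases_succ']

theorem exists_pre_eq_append {t t' : ℕ} (h : t ≤ t') : ∃ l, p.pre t' = p.pre t ++ l := by
  induction t', h using Nat.le_induction with
  | base => exact ⟨[], by simp⟩
  | succ t' _ ih =>
    obtain ⟨l, hl⟩ := ih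
    exact ⟨l ++ [p.sched t'], by rw [pre, hl, List.append_assoc]⟩

theorem upper_pre_antitone [Nonempty (CGraph n)] {t t' : ℕ} (h : t ≤ t') (m : Fin n → p.Mem) :
    upper gstep (p.pre t') (fun m' => ind (¬ ∀ v, (m' v).out.isSome = true)) m ≤
      upper gstep (p.pre t) (fun m' => ind (¬ ∀ v, (m' v).out.isSome = true)) m := by
  obtain ⟨l, hl⟩ := exists_pre_eq_append (p := p) h
  rw [hl, upper_append]
  refine upper_mono fun m₁ _ => upper_le_of_forall fun m₂ hr => ind_mono fun h2 h1 => h2 ?_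
  exact Reach.invariant (I := fun m : Fin n → p.Mem => ∀ v, (m v).out.isSome = true)
    (fun k _ G m x hm v => by rw [gstep_of_isSome (hm v)]; exact hm v) hr h1

/-! ### Correctness and success probability of the machine -/

section

variable {b : ℕ} {uid : Fin n → ℕ} {tok : Fin n → Finset (Token p.d)}

theorem inv_init (huid : Function.Injective uid) (hU : ∀ v, uid v < p.U) :
    Inv (univ.biUnion tok) fun v => p.initMem (uid v) (tok v) := by
  refine ⟨fun v => rfl, fun v w h => huid ?_, fun v => ?_, fun v w => rfl⟩
  · have h' : (Fin.ofNat p.U (uid v) : Fin p.U) = Fin.ofNat p.U (uid w) := h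
    have := congrArg Fin.val h'
    simpa [Nat.mod_eq_of_lt (hU v), Nat.mod_eq_of_lt (hU w)] using this
  · ext τ
    simp [mem_und, initMem]

/-- Correctness is known at the ends of phases; prolonging an execution by arbitrary coins reduces
every other time to this case. -/
theorem exists_extension (adv : Adversary n p.Coin) (henc : Function.Injective (p.enc b)) (t : ℕ)
    (x : Fin t → Fin n → p.Coin) (v : Fin n) (h : (mems uid tok adv b t x v).out.isSome = true)
    (s : ℕ) : ∃ y : Fin (t + s) → Fin n → p.Coin,
      mems uid tok adv b (t + s) y v = mems uid tok adv b t x v := by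
  induction s with
  | zero => exact ⟨x, rfl⟩
  | succ s ih =>
    obtain ⟨y, hy⟩ := ih
    refine ⟨Fin.snoc (α := fun _ => Fin n → p.Coin) y (Classical.arbitrary _), ?_⟩
    change mems uid tok adv b (t + s + 1) _ v = _
    rw [mems_succ uid tok adv henc, Fin.init_snoc, gstep_of_isSome (by rw [hy]; exact h), hy]

/-- Each phase removes a token, and one more phase detects that none is left, whatever the coins
are. -/
theorem done_mems (hp : Fits p n) (huid : Function.Injective uid) (hU : ∀ v, uid v < p.U)
    (adv : Adversary n p.Coin) (henc : Function.Injective (p.enc b)) {j : ℕ}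
    (hj : (univ.biUnion tok).card < j) (x : Fin (j * p.phase.length) → Fin n → p.Coin) :
    Done (univ.biUnion tok) (mems uid tok adv b (j * p.phase.length) x) := by
  have hI := inv_init (tok := tok) huid hU
  have hr := mems_reach uid tok adv henc (j * p.phase.length) x
  rw [pre_mul_length] at hr
  rcases hI.phases hp.inj hp.flood hr with h | ⟨-, h⟩
  · exact h
  · exfalso
    have : und (fun v => p.initMem (uid v) (tok v)) = univ.biUnion tok := by
      ext τ
      simp [mem_und, initMem]
    rw [this] at h
    omega

theorem machine_disseminates (hp : Fits p n) (huid : Function.Injective uid)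
    (hU : ∀ v, uid v < p.U) (adv : Adversary n p.Coin) (henc : Function.Injective (p.enc b)) :
    (p.machine b).Disseminates uid tok adv := by
  have hP : 0 < p.phase.length := List.length_pos_of_ne_nil p.phase_ne_nil
  constructor
  · intro t x v S hS
    have hS' : (mems uid tok adv b t x v).out = some S := hS
    set j := t + (univ.biUnion tok).card + 1 with hj
    have hle : t ≤ j * p.phase.length := by nlinarith
    obtain ⟨s, hs⟩ := Nat.exists_eq_add_of_le hle
    obtain ⟨y, hy⟩ := exists_extension adv henc t x v (by rw [hS']; rfl) s
    have hd := done_mems (tok := tok) (b := b) hp huid hU adv henc (j := j) (by omega)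
    rw [hs] at hd
    have := hd y v
    rw [hy, hS'] at this
    exact Option.some.inj this
  · intro x
    refine ⟨((univ.biUnion tok).card + 1) * p.phase.length, fun v => ?_⟩
    have := done_mems (tok := tok) (b := b) hp huid hU adv henc (Nat.lt_succ_self _)
      (fun i => x i) v
    change (mems uid tok adv b _ _ v).out.isSome = true
    rw [this]
    rfl

theorem le_haltProb (hp : Fits p n) (hn : 0 < n) (huid : Function.Injective uid)
    (hU : ∀ v, uid v < p.U) (adv : Adversary n p.Coin) (henc : Function.Injective (p.enc b))
    {k : ℕ} (htok : (univ.biUnion tok).card = k) (hk : k ≤ n) {ε : ℝ}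
    (hε : (n : ℝ) * (2 ^ (n / p.g) * (1 - 1 / p.g / 2) ^ p.F) ≤ ε) (hε0 : 0 ≤ ε) (j : ℕ) {t : ℕ}
    (ht : (j + 1) * p.phase.length ≤ t) :
    1 - ((1 - 1 / 5376) ^ j * ((n : ℝ) ^ 2 * Real.exp (p.rate * k)) + j * ε)
      ≤ (p.machine b).haltProb uid tok adv t := by
  subst htok
  have := nonempty_cgraph hn
  refine le_trans ?_ (one_sub_upper_le_haltProb uid tok adv henc t)
  have h1 := upper_pre_antitone (p := p) ht fun v => p.initMem (uid v) (tok v)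
  rw [pre_mul_length] at h1
  have h2 := upper_not_halted_le hp hn hk hε hε0 j (inv_init (tok := tok) huid hU)
    (Or.inl fun v => rfl)
  have h3 : pot (fun v => p.initMem (uid v) (tok v)) =
      (n : ℝ) ^ 2 * Real.exp (p.rate * (univ.biUnion tok).card) := by
    have : und (fun v => p.initMem (uid v) (tok v)) = univ.biUnion tok := by
      ext τ
      simp [mem_und, initMem]
    rw [pot, if_pos (show ∀ v, (p.initMem (uid v) (tok v)).mode = true from fun v => rfl), this]
  rw [h3] at h2
  linarith

end


variable {p : Par}

/-! ### Sizes -/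

theorem card_tok : Fintype.card p.Tok = 2 ^ p.d := by simp

theorem card_fd : Fintype.card p.Fd = 2 ^ p.r := by
  rw [← Nat.card_eq_fintype_card, GaloisField.card 2 p.r p.r_ne]

/-- A block is determined by an enumeration of it, filled up with `none` to length s. -/
theorem card_block_le : Fintype.card p.Block ≤ (2 ^ p.d + 1) ^ p.s := by
  classical
  let f : p.Block → Fin p.s → Option p.Tok := fun B i =>
    if h : (i : ℕ) < B.1.card then some (B.1.equivFin.symm ⟨i, h⟩ : B.1) else none
  have hf : ∀ (B : p.Block) τ, τ ∈ B.1 ↔ ∃ i, f B i = some τ := fun B τ => by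
    constructor
    · intro hτ
      refine ⟨⟨B.1.equivFin ⟨τ, hτ⟩, (Fin.is_lt _).trans_le B.2⟩, ?_⟩
      simp [f]
    · rintro ⟨i, hi⟩
      simp only [f] at hi
      split_ifs at hi with h
      rw [← Option.some.inj hi]
      exact (B.1.equivFin.symm ⟨i, h⟩).2
  have hinj : Function.Injective f := fun B B' h => Subtype.ext (by
    ext τ
    rw [hf, hf, h])
  refine (Fintype.card_le_of_injective f hinj).trans (le_of_eq ?_)
  simp

theorem card_fl : Fintype.card p.Fl =
    (p.U + 1) * ((p.U + 1) * ((2 ^ p.d + 1) * ((p.Q + 1) * ((2 ^ p.r + 1) * 2)))) := by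
  have h : ∀ k, Fintype.card (WithBot (Fin k)) = k + 1 := fun k =>
    (Fintype.card_option (α := Fin k)).trans (by simp)
  simp only [Fintype.card_prod, h, card_tok, card_fd, Fintype.card_bool]

theorem card_vec : Fintype.card p.Vec = 2 ^ p.G * (2 ^ p.r * 2 ^ p.r) := by
  simp only [Fintype.card_prod, card_fd, Fintype.card_fun, ZMod.card, Fintype.card_fin]

theorem enc_injective {b : ℕ}
    (h : Fintype.card p.Block + (Fintype.card p.Fl + Fintype.card p.Vec) ≤ 2 ^ b) :
    Function.Injective (p.enc b) :=
  someInj_injective (by simpa [Fintype.card_sum] using h)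

theorem toFd_injective (h : (2 ^ p.d + 1) ^ p.s ≤ 2 ^ p.r) : Function.Injective p.toFd :=
  someInj_injective (by rw [card_fd]; exact card_block_le.trans h)

theorem length_phase : p.phase.length = p.F + 2 * p.L + 2 * p.H + 5 := by
  simp [phase]; ring

end Par

/-! ### The choice of the parameters -/

/-- The number of bits of `N`. -/
def bits (N : ℕ) : ℕ := Nat.log 2 N + 1

/-- A factor in the length of the forwarding stage. -/
def fwdFactor (c : ℕ) : ℕ := 4 * (1 + 2 * (c + 3 + (5376 * (13 + 4 * c) + 1)))

/-- The parameters for the exponent `c` of the error probability, identifiers below `n ^ u`,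
the estimate `N` of `n`, messages of `O(b)` bits, and tokens of `d` bits. -/
def par (c u N b d : ℕ) : Par where
  d := d
  s := max 1 (b / max d 1)
  -- g ≤ b lets the G index bits fit into a message; g of order N / log N at most lets forwarding
  -- succeed with high probability within O(N) rounds.
  g := max 1 (min b (N / bits N + 1))
  G := 20 * max 1 (min b (N / bits N + 1))
  Q := 2 * N * max 1 (min b (N / bits N + 1)) + 1
  r := 29 * b + 1
  U := (2 * N) ^ u + 1
  L := 2 * N
  F := fwdFactor c * N
  H := 132 * N
  s_pos := by positivity
  g_pos := by positivity
  Q_pos := by positivity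
  U_pos := by positivity
  r_ne := by positivity

section Choice

variable {c u N b d n : ℕ}

theorem bits_le (hN : 0 < N) : bits N ≤ N := by
  have h1 := Nat.pow_log_le_self 2 hN.ne'
  have h2 := Nat.lt_two_pow_self (n := Nat.log 2 N)
  rw [bits]; omega

theorem lt_two_pow_bits : N < 2 ^ bits N := Nat.lt_pow_succ_log_self (by norm_num) N

theorem par_g (hb : 0 < b) : (par c u N b d).g = min b (N / bits N + 1) := by
  change max 1 (min b (N / bits N + 1)) = _
  exact max_eq_right (le_min hb (Nat.succ_le_succ (Nat.zero_le _)))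

theorem par_s (hb : 0 < b) (hd : d ≤ b) : (par c u N b d).s = b / max d 1 := by
  change max 1 (b / max d 1) = _
  refine max_eq_right ?_
  rw [Nat.le_div_iff_mul_le (by positivity), one_mul]
  exact max_le hd hb

theorem par_G : (par c u N b d).G = 20 * (par c u N b d).g := rfl

theorem block_bound (hb : 0 < b) (hd : d ≤ b) :
    (2 ^ (par c u N b d).d + 1) ^ (par c u N b d).s ≤ 2 ^ (2 * b) := by
  rw [par_s hb hd]
  change (2 ^ d + 1) ^ (b / max d 1) ≤ _
  have h1 : 2 ^ d + 1 ≤ 2 ^ (d + 1) := by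
    rw [pow_succ]; have := Nat.one_le_two_pow (n := d); omega
  calc (2 ^ d + 1) ^ (b / max d 1) ≤ (2 ^ (d + 1)) ^ (b / max d 1) := Nat.pow_le_pow_left h1 _
    _ = 2 ^ ((d + 1) * (b / max d 1)) := (pow_mul _ _ _).symm
    _ ≤ 2 ^ (2 * b) := by
      refine Nat.pow_le_pow_right (by norm_num) ?_
      calc (d + 1) * (b / max d 1) ≤ (2 * max d 1) * (b / max d 1) :=
            Nat.mul_le_mul_right _ (by omega)
        _ = 2 * (max d 1 * (b / max d 1)) := by ring
        _ ≤ 2 * b := Nat.mul_le_mul_left _ (Nat.mul_div_le _ _)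

theorem two_mul_le_two_pow (hN : N ≤ 2 * n) (hb : 0 < b) (hn : n ≤ 2 ^ b) :
    2 * N ≤ 2 ^ (3 * b) := by
  calc 2 * N ≤ 4 * 2 ^ b := by omega
    _ = 2 ^ (b + 2) := by ring
    _ ≤ 2 ^ (3 * b) := Nat.pow_le_pow_right (by norm_num) (by omega)

theorem add_two_le_two_pow {x k : ℕ} (hb : 0 < b) (h : x ≤ 2 ^ (k * b)) :
    x + 2 ≤ 2 ^ ((k + 2) * b) := by
  have h1 : 1 ≤ 2 ^ (k * b) := Nat.one_le_two_pow
  calc x + 2 ≤ 2 ^ (k * b) * 4 := by omega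
    _ = 2 ^ (k * b + 2) := by ring
    _ ≤ _ := Nat.pow_le_pow_right (by norm_num) (by nlinarith)

theorem par_enc_injective (hN : N ≤ 2 * n) (hb : 0 < b) (hn : n ≤ 2 ^ b) (hd : d ≤ b) :
    Function.Injective ((par c u N b d).enc ((6 * u + 126) * b)) := by
  apply Par.enc_injective
  have h2 : (2 : ℕ) ≤ 2 ^ (1 * b) := by
    simpa using Nat.pow_le_pow_right (n := 2) (by norm_num) hb
  have hNb := two_mul_le_two_pow hN hb hn
  have hU : (2 * N) ^ u + 2 ≤ 2 ^ ((3 * u + 2) * b) := by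
    refine add_two_le_two_pow hb ?_
    calc (2 * N) ^ u ≤ (2 ^ (3 * b)) ^ u := Nat.pow_le_pow_left hNb u
      _ = 2 ^ (3 * u * b) := by rw [← pow_mul]; ring_nf
  have hgb : (par c u N b d).g ≤ b := by rw [par_g hb]; exact min_le_left _ _
  have hQ : 2 * N * (par c u N b d).g + 2 ≤ 2 ^ (6 * b) := by
    refine add_two_le_two_pow (k := 4) hb ?_
    calc 2 * N * (par c u N b d).g ≤ 2 ^ (3 * b) * 2 ^ b :=
          Nat.mul_le_mul hNb (hgb.trans Nat.lt_two_pow_self.le)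
      _ = 2 ^ (4 * b) := by ring
  have hdd : 2 ^ d + 1 ≤ 2 ^ (3 * b) := by
    have := add_two_le_two_pow (x := 2 ^ d) (k := 1) hb
      (Nat.pow_le_pow_right (by norm_num) (by omega))
    exact (Nat.le_succ _).trans this
  have hr : 2 ^ (29 * b + 1) + 1 ≤ 2 ^ (32 * b) := by
    have := add_two_le_two_pow (x := 2 ^ (29 * b + 1)) (k := 30) hb
      (Nat.pow_le_pow_right (by norm_num) (by omega))
    exact (Nat.le_succ _).trans this
  have hfl : Fintype.card (par c u N b d).Fl ≤ 2 ^ ((6 * u + 46) * b) := by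
    rw [Par.card_fl]
    change ((2 * N) ^ u + 2) * (((2 * N) ^ u + 2) * ((2 ^ d + 1) *
      ((2 * N * (par c u N b d).g + 2) * ((2 ^ (29 * b + 1) + 1) * 2)))) ≤ _
    calc _ ≤ 2 ^ ((3 * u + 2) * b) * (2 ^ ((3 * u + 2) * b) * (2 ^ (3 * b) *
          (2 ^ (6 * b) * (2 ^ (32 * b) * 2 ^ (1 * b))))) := by gcongr
      _ = 2 ^ ((6 * u + 46) * b) := by simp only [← pow_add]; ring_nf
  have hvec : Fintype.card (par c u N b d).Vec ≤ 2 ^ (80 * b) := by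
    rw [Par.card_vec, par_G]
    change 2 ^ (20 * (par c u N b d).g) * (2 ^ (29 * b + 1) * 2 ^ (29 * b + 1)) ≤ _
    simp only [← pow_add]
    exact Nat.pow_le_pow_right (by norm_num) (by omega)
  have hblk : Fintype.card (par c u N b d).Block ≤ 2 ^ (2 * b) :=
    Par.card_block_le.trans (block_bound hb hd)
  have hmono : ∀ k, k ≤ 6 * u + 124 → (2 : ℕ) ^ (k * b) ≤ 2 ^ ((6 * u + 124) * b) := fun k hk =>
    Nat.pow_le_pow_right (by norm_num) (Nat.mul_le_mul_right b hk)
  have h3 := hmono 2 (by omega)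
  have h4 := hmono (6 * u + 46) (by omega)
  have h5 := hmono 80 (by omega)
  have h6 : 4 * 2 ^ ((6 * u + 124) * b) ≤ 2 ^ ((6 * u + 126) * b) := by
    calc 4 * 2 ^ ((6 * u + 124) * b) = 2 ^ ((6 * u + 124) * b + 2) := by ring
      _ ≤ _ := Nat.pow_le_pow_right (by norm_num) (by nlinarith)
  omega

theorem par_fits (h2 : 2 ≤ n) (hnN : n ≤ 2 * N) (hb : 0 < b) (hn : n ≤ 2 ^ b)
    (hd : d ≤ b) : (par c u N b d).Fits n := by
  have hgb : (par c u N b d).g ≤ b := by rw [par_g hb]; exact min_le_left _ _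
  have hgN : (par c u N b d).g ≤ N + 1 := by
    rw [par_g hb]
    exact (min_le_right _ _).trans (Nat.succ_le_succ (Nat.div_le_self _ _))
  refine ⟨Par.toFd_injective ((block_bound hb hd).trans ?_), hnN, ?_, ?_, par_G, ?_⟩
  · exact Nat.pow_le_pow_right (by norm_num) (by change 2 * b ≤ 29 * b + 1; omega)
  · rw [Par.card_fd, par_G]
    change _ ≤ 2 ^ (29 * b + 1)
    have hbb : b < 2 ^ b := Nat.lt_two_pow_self
    calc 2 * (n * (2 ^ (20 * (par c u N b d).g) * (2 * (20 * (par c u N b d).g) + 1)))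
        ≤ 2 * (2 ^ b * (2 ^ (20 * b) * (64 * 2 ^ b))) := by
          gcongr
          -- Bad seeds of n nodes: 22b + 7 bits, which is at most the r = 29b + 1 bits of the field.
          · norm_num
          · omega
      _ = 2 ^ (22 * b + 7) := by ring
      _ ≤ _ := Nat.pow_le_pow_right (by norm_num) (by omega)
  · change n * (par c u N b d).g ≤ 2 * N * (par c u N b d).g + 1
    have := Nat.mul_le_mul_right (par c u N b d).g hnN
    omega
  · rw [par_G]
    change (2 : ℝ) ^ (20 * (par c u N b d).g) * (2 ^ n * (3 / 4) ^ (132 * N)) ≤ 1 / 4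
    have h1 : (2 : ℝ) ^ (20 * (par c u N b d).g) ≤ 2 ^ (40 * N) :=
      pow_le_pow_right₀ (by norm_num) (by omega)
    have h3 : (2 : ℝ) ^ n ≤ 2 ^ (2 * N) := pow_le_pow_right₀ (by norm_num) hnN
    -- (3/4)³ ≤ 1/2 turns 132N rounds into a factor 2^(-44N), of which 40N and 2N pay for the union
    -- bound and the spreading; 2^(-2N) ≤ 1/4 remains.
    have h4 : ((3 : ℝ) / 4) ^ (132 * N) ≤ (1 / 2) ^ (44 * N) := by
      rw [show 132 * N = 3 * (44 * N) by ring, pow_mul]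
      exact pow_le_pow_left₀ (by norm_num) (by norm_num) _
    have h5 : ((1 : ℝ) / 2) ^ (2 * N) ≤ (1 / 2) ^ 2 :=
      pow_le_pow_of_le_one (by norm_num) (by norm_num) (by omega)
    calc _ ≤ (2 : ℝ) ^ (40 * N) * (2 ^ (2 * N) * (1 / 2) ^ (44 * N)) := by gcongr
      _ = (2 * (1 / 2) : ℝ) ^ (42 * N) * (1 / 2) ^ (2 * N) := by
        rw [mul_pow]; ring
      _ ≤ _ := by norm_num at h5 ⊢; exact h5

end Choice

/-! ### Failure probability and number of rounds -/

section Bounds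

variable {c u N b d n k : ℕ}

theorem bits_mul_par_g_le (hN : 0 < N) (hb : 0 < b) : bits N * (par c u N b d).g ≤ 2 * N := by
  rw [par_g hb]
  calc bits N * min b (N / bits N + 1) ≤ bits N * (N / bits N + 1) :=
        Nat.mul_le_mul_left _ (min_le_right _ _)
    _ = bits N * (N / bits N) + bits N := by ring
    _ ≤ N + N := add_le_add (Nat.mul_div_le _ _) (bits_le hN)
    _ = 2 * N := by ring

theorem le_exp_bits (hnN : n ≤ 2 * N) : (n : ℝ) ≤ Real.exp (2 * bits N) := by
  have h1 : n ≤ 2 ^ (2 * bits N) := by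
    calc n ≤ 2 * N := hnN
      _ ≤ 2 ^ bits N * 2 ^ bits N := by
        refine Nat.mul_le_mul ?_ lt_two_pow_bits.le
        exact Nat.le_self_pow (by simp [bits]) 2
      _ = _ := by ring
  have h2 : (2 : ℝ) ≤ Real.exp 1 := by linarith [Real.add_one_le_exp (1 : ℝ)]
  calc (n : ℝ) ≤ (2 : ℝ) ^ (2 * bits N) := by exact_mod_cast h1
    _ ≤ Real.exp 1 ^ (2 * bits N) := by gcongr
    _ = Real.exp (2 * bits N) := by
      rw [← Real.exp_nat_mul]; push_cast; ring_nf

theorem exp_neg_bits_le (h2 : 2 ≤ n) (hnN : n ≤ 2 * N) (j : ℕ) :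
    Real.exp (-(2 * bits N * j)) ≤ 1 / (n : ℝ) ^ j := by
  have hn : (0 : ℝ) < n := by exact_mod_cast (by omega : 0 < n)
  have h1 : (n : ℝ) ^ j ≤ Real.exp (2 * bits N * j) := by
    calc (n : ℝ) ^ j ≤ Real.exp (2 * bits N) ^ j := by gcongr; exact le_exp_bits hnN
      _ = _ := by rw [← Real.exp_nat_mul]; ring_nf
  rw [Real.exp_neg, one_div]
  gcongr

/-- The number of holder sets costs exp(O(N/g)) and the union bound costs a power of n; both are
absorbed because N/g is at least bits N / 2. -/
theorem forward_failure_le (h2 : 2 ≤ n) (hnN : n ≤ 2 * N) (hb : 0 < b) :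
    (n : ℝ) * (2 ^ (n / (par c u N b d).g) * (1 - 1 / (par c u N b d).g / 2) ^ (par c u N b d).F) ≤
      Real.exp (-(2 * bits N * (c + 2 + (5376 * (13 + 4 * c) + 1)))) := by
  set g := (par c u N b d).g with hg
  have hg1 : (1 : ℝ) ≤ g := by exact_mod_cast (par c u N b d).g_pos
  have hg0 : (0 : ℝ) < g := by linarith
  have hN : 0 < N := by omega
  have hNR : (0 : ℝ) < N := by exact_mod_cast hN
  have hx : (bits N : ℝ) / 2 ≤ N / g := by
    rw [div_le_div_iff₀ (by norm_num) hg0]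
    have : bits N * g ≤ N * 2 := by rw [mul_comm N 2]; exact bits_mul_par_g_le hN hb
    exact_mod_cast this
  have h3 : (2 : ℝ) ^ (n / g) ≤ Real.exp (2 * (N / g)) := by
    have h4 : (2 : ℝ) ≤ Real.exp 1 := by linarith [Real.add_one_le_exp (1 : ℝ)]
    calc (2 : ℝ) ^ (n / g) ≤ Real.exp 1 ^ (n / g) := by gcongr
      _ = Real.exp ((n / g : ℕ) : ℝ) := by rw [← Real.exp_nat_mul, mul_one]
      _ ≤ Real.exp (2 * (N / g)) := by
        rw [Real.exp_le_exp]
        calc ((n / g : ℕ) : ℝ) ≤ (n : ℝ) / g := Nat.cast_div_le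
          _ ≤ (2 * N : ℝ) / g := by gcongr; exact_mod_cast hnN
          _ = _ := by ring
  have h6 : 0 ≤ 1 - 1 / (g : ℝ) / 2 := by
    have : 1 / (g : ℝ) ≤ 1 := (div_le_one hg0).2 hg1
    linarith
  have h5 : (1 - 1 / (g : ℝ) / 2) ^ (par c u N b d).F ≤
      Real.exp (-((fwdFactor c : ℝ) / 2 * (N / g))) := by
    calc (1 - 1 / (g : ℝ) / 2) ^ (par c u N b d).F
        ≤ Real.exp (-(1 / (g : ℝ) / 2)) ^ (par c u N b d).F := by
          gcongr
          exact Real.one_sub_le_exp_neg _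
      _ = _ := by
          rw [← Real.exp_nat_mul]
          change Real.exp (((fwdFactor c * N : ℕ) : ℝ) * _) = _
          push_cast
          congr 1
          field_simp
  calc _ ≤ Real.exp (2 * bits N) * (Real.exp (2 * (N / g)) *
        Real.exp (-((fwdFactor c : ℝ) / 2 * (N / g)))) := by
        gcongr
        exact le_exp_bits hnN
    -- Half of `fwdFactor` is 2 + 4·(…): the 2 cancels the factor 2^(n/g), the rest yields the
    -- exponent of the error.
    _ = Real.exp (2 * bits N - 4 * (c + 3 + (5376 * (13 + 4 * c) + 1)) * (N / g)) := by
        rw [← Real.exp_add, ← Real.exp_add, fwdFactor]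
        push_cast
        congr 1
        ring
    _ ≤ _ := by
        rw [Real.exp_le_exp]
        have h7 : (0 : ℝ) ≤ 4 * (c + 3 + (5376 * (13 + 4 * c) + 1)) := by positivity
        nlinarith [mul_le_mul_of_nonneg_left hx h7]

/-- The number of phases. -/
noncomputable def phaseCount (p : Par) (c N k : ℕ) : ℕ :=
  ⌈5376 * ((k : ℝ) / (p.g * p.s) + (3 + c) * (2 * bits N))⌉₊

theorem phaseCount_le (p : Par) : (phaseCount p c N k : ℝ) ≤
    5376 * ((k : ℝ) / (p.g * p.s) + (3 + c) * (2 * bits N)) + 1 :=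
  (Nat.ceil_lt_add_one (by positivity)).le

/-- Half of the error is for the potential: the number of phases covers its initial logarithm, at
most k/(g·s) plus that of n², and c + 1 further powers of n. The other half is for forwarding, where
the number of phases is at most A·n and A ≤ n^A. -/
theorem failure_le (h2 : 2 ≤ n) (hnN : n ≤ 2 * N) (hNn : N ≤ 2 * n) (hk : k ≤ n) (p : Par) :
    (1 - 1 / 5376) ^ phaseCount p c N k * ((n : ℝ) ^ 2 * Real.exp (p.rate * k)) +
      phaseCount p c N k * Real.exp (-(2 * bits N * (c + 2 + (5376 * (13 + 4 * c) + 1)))) ≤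
        1 / (n : ℝ) ^ c := by
  have hN : 0 < N := by omega
  have hn : (0 : ℝ) < n := by exact_mod_cast (by omega : 0 < n)
  have hn2 : (2 : ℝ) ≤ n := by exact_mod_cast h2
  have hg : (1 : ℝ) ≤ p.g := by exact_mod_cast p.g_pos
  have hs : (1 : ℝ) ≤ p.s := by exact_mod_cast p.s_pos
  have hgs : (1 : ℝ) ≤ p.g * p.s := one_le_mul_of_one_le_of_one_le hg hs
  set j := phaseCount p c N k with hj
  set A : ℕ := 5376 * (13 + 4 * c) + 1 with hA
  have hx : (k : ℝ) / (p.g * p.s) + (3 + c) * (2 * bits N) ≤ j / 5376 := by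
    rw [le_div_iff₀ (by norm_num), mul_comm]
    exact Nat.le_ceil _
  have hrate : p.rate * k ≤ (k : ℝ) / (p.g * p.s) := by
    rw [Par.rate, one_div_mul_eq_div]
    refine div_le_div_of_nonneg_left (Nat.cast_nonneg k) (by linarith) ?_
    linarith
  have h1 : (1 - 1 / 5376 : ℝ) ^ j ≤ Real.exp (-(j / 5376)) := by
    calc (1 - 1 / 5376 : ℝ) ^ j ≤ Real.exp (-(1 / 5376)) ^ j := by
          exact pow_le_pow_left₀ (by norm_num) (Real.one_sub_le_exp_neg _) j
      _ = _ := by rw [← Real.exp_nat_mul]; ring_nf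
  have hfirst : (1 - 1 / 5376) ^ j * ((n : ℝ) ^ 2 * Real.exp (p.rate * k)) ≤
      1 / (n : ℝ) ^ c / 2 := by
    calc (1 - 1 / 5376) ^ j * ((n : ℝ) ^ 2 * Real.exp (p.rate * k))
        ≤ Real.exp (-(j / 5376)) * ((n : ℝ) ^ 2 * Real.exp (p.rate * k)) := by gcongr
      _ = (n : ℝ) ^ 2 * Real.exp (p.rate * k - j / 5376) := by
          rw [sub_eq_add_neg, Real.exp_add]; ring
      _ ≤ (n : ℝ) ^ 2 * Real.exp (-(2 * bits N * (c + 3 : ℕ))) := by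
          gcongr
          push_cast
          linarith
      _ ≤ (n : ℝ) ^ 2 * (1 / (n : ℝ) ^ (c + 3)) := by
          gcongr
          exact exp_neg_bits_le h2 hnN (c + 3)
      _ = 1 / (n : ℝ) ^ c / n := by field_simp; ring
      _ ≤ _ := by gcongr
  have hjA : (j : ℝ) ≤ A * n := by
    have h3 : (k : ℝ) / (p.g * p.s) ≤ n := by
      refine (div_le_self (Nat.cast_nonneg k) hgs).trans ?_
      exact_mod_cast hk
    have h4 : (bits N : ℝ) ≤ 2 * n := by exact_mod_cast (bits_le hN).trans hNn
    calc (j : ℝ) ≤ 5376 * ((k : ℝ) / (p.g * p.s) + (3 + c) * (2 * bits N)) + 1 := phaseCount_le p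
      _ ≤ 5376 * (n + (3 + c) * (2 * (2 * n))) + n := by gcongr; linarith
      _ = A * n := by rw [hA]; push_cast; ring
  have hsecond : (j : ℝ) * Real.exp (-(2 * bits N * (c + 2 + (5376 * (13 + 4 * c) + 1)))) ≤
      1 / (n : ℝ) ^ c / 2 := by
    have h5 : Real.exp (-(2 * bits N * (c + 2 + (5376 * (13 + 4 * c) + 1)))) ≤
        1 / (n : ℝ) ^ (c + 2 + A) := by
      have := exp_neg_bits_le h2 hnN (c + 2 + A)
      rw [hA] at this ⊢
      push_cast at this
      exact this
    have h6 : (A : ℝ) ≤ n ^ A := by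
      calc (A : ℝ) ≤ (2 : ℝ) ^ A := by exact_mod_cast Nat.lt_two_pow_self.le
        _ ≤ n ^ A := by gcongr
    calc _ ≤ (A * n : ℝ) * (1 / (n : ℝ) ^ (c + 2 + A)) := by gcongr
      _ = A / n ^ A * (1 / (n : ℝ) ^ c / n) := by rw [pow_add, pow_add]; field_simp
      _ ≤ 1 * (1 / (n : ℝ) ^ c / 2) := by
          gcongr
          rw [div_le_one (by positivity)]
          exact h6
      _ = _ := one_mul _
  linarith

theorem le_roundBound (h2 : 2 ≤ n) (hb : 0 < b) (hlog : Real.logb 2 n ≤ b) :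
    (n : ℝ) * ((k : ℝ) * d / b ^ 2 + Real.logb 2 n) ≤ roundBound n k d b := by
  have hn2 : (2 : ℝ) ≤ n := by exact_mod_cast h2
  have hbR : (0 : ℝ) < b := by exact_mod_cast hb
  have hl : 1 ≤ Real.logb 2 n := by
    rw [Real.le_logb_iff_rpow_le (by norm_num) (by linarith), Real.rpow_one]
    exact hn2
  have h0 : (0 : ℝ) ≤ (n : ℝ) * ((k : ℝ) * d / b ^ 2) := by positivity
  rw [roundBound]
  refine le_min ?_ ?_
  · calc _ = (n : ℝ) * ((k : ℝ) * d / b ^ 2) + n * Real.logb 2 n := by ring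
      _ ≤ (n : ℝ) * ((k : ℝ) * d / b ^ 2) + n * b := by gcongr
      _ = _ := by field_simp
  · calc _ = 1 * ((n : ℝ) * ((k : ℝ) * d / b ^ 2)) + n * Real.logb 2 n := by ring
      _ ≤ Real.logb 2 n * ((n : ℝ) * ((k : ℝ) * d / b ^ 2)) + n * Real.logb 2 n := by gcongr
      _ = _ := by field_simp

theorem bits_le_logb (h2 : 2 ≤ n) (hN : 0 < N) (hNn : N ≤ 2 * n) :
    (bits N : ℝ) ≤ 3 * Real.logb 2 n := by
  have hn2 : (2 : ℝ) ≤ n := by exact_mod_cast h2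
  have hl : 1 ≤ Real.logb 2 n := by
    rw [Real.le_logb_iff_rpow_le (by norm_num) (by linarith), Real.rpow_one]
    exact hn2
  have h1 : (Nat.log 2 N : ℝ) ≤ 1 + Real.logb 2 n := by
    have h3 : (2 : ℝ) ^ Nat.log 2 N ≤ 2 * n := by
      exact_mod_cast (Nat.pow_log_le_self 2 hN.ne').trans hNn
    have h4 : 1 + Real.logb 2 n = Real.logb 2 (2 * n) := by
      rw [Real.logb_mul (by norm_num) (by linarith), Real.logb_self_eq_one (by norm_num)]
    rw [h4, Real.le_logb_iff_rpow_le (by norm_num) (by linarith), Real.rpow_natCast]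
    exact h3
  rw [bits]
  push_cast
  linarith

/-- 1/g ≤ 1/b + bits N / N and 1/s ≤ 2d/b. The first summand gives the main term; the second
contributes only O(log n), because k ≤ 2N and d ≤ b. -/
theorem div_gs_le (hnN : n ≤ 2 * N) (hN : 0 < N) (hb : 0 < b) (hd : d ≤ b) (hk : k ≤ n)
    (hkd : d = 0 → k ≤ 1) :
    (k : ℝ) / ((par c u N b d).g * (par c u N b d).s) ≤ 2 * ((k : ℝ) * d / b ^ 2) + 4 * bits N := by
  set g := (par c u N b d).g with hg
  set s := (par c u N b d).s with hs
  have hg1 : (1 : ℝ) ≤ g := by exact_mod_cast (par c u N b d).g_pos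
  have hs1 : (1 : ℝ) ≤ s := by exact_mod_cast (par c u N b d).s_pos
  have hbR : (0 : ℝ) < b := by exact_mod_cast hb
  have hNR : (0 : ℝ) < N := by exact_mod_cast hN
  have hl : (1 : ℝ) ≤ bits N := by exact_mod_cast Nat.succ_le_succ (Nat.zero_le _)
  rcases Nat.eq_zero_or_pos d with rfl | hd0
  · have h1 : (k : ℝ) ≤ 1 := by exact_mod_cast hkd rfl
    calc (k : ℝ) / (g * s) ≤ k :=
          div_le_self (Nat.cast_nonneg k) (one_le_mul_of_one_le_of_one_le hg1 hs1)
      _ ≤ _ := by simp; linarith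
  have hdR : (0 : ℝ) < d := by exact_mod_cast hd0
  have hsinv : 1 / (s : ℝ) ≤ 2 * d / b := by
    rw [div_le_div_iff₀ (by linarith) hbR]
    have h1 : s = b / d := by
      rw [hs, par_s hb hd, max_eq_left hd0]
    have h3 : b ≤ 2 * d * s := by
      have h4 := Nat.div_add_mod b d
      have h5 := Nat.mod_lt b hd0
      have h6 : 1 ≤ s := (par c u N b d).s_pos
      rw [← h1] at h4
      nlinarith
    rw [one_mul]
    exact_mod_cast h3
  have hginv : 1 / (g : ℝ) ≤ 1 / b + bits N / N := by
    have h1 : g = min b (N / bits N + 1) := par_g hb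
    rcases min_choice b (N / bits N + 1) with h3 | h3 <;> rw [h3] at h1
    · rw [h1]
      have : (0 : ℝ) ≤ bits N / N := by positivity
      linarith
    · have h4 : (N : ℝ) ≤ bits N * g := by
        have h5 := Nat.lt_mul_div_succ N (b := bits N) (Nat.succ_pos _)
        rw [← h1] at h5
        exact_mod_cast h5.le
      have h6 : 1 / (g : ℝ) ≤ bits N / N := by
        rw [div_le_div_iff₀ (by linarith) hNR]; linarith
      have : (0 : ℝ) ≤ 1 / b := by positivity
      linarith
  have hkN : (k : ℝ) ≤ 2 * N := by exact_mod_cast hk.trans hnN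
  have hdb : (d : ℝ) ≤ b := by exact_mod_cast hd
  calc (k : ℝ) / (g * s) = k * ((1 / g) * (1 / s)) := by field_simp
    _ ≤ k * ((1 / b + bits N / N) * (2 * d / b)) := by gcongr
    _ = 2 * ((k : ℝ) * d / b ^ 2) + 2 * (k / N) * (d / b) * bits N := by field_simp
    _ ≤ 2 * ((k : ℝ) * d / b ^ 2) + 2 * 2 * 1 * bits N := by
      gcongr
      · rw [div_le_iff₀ hNR]; exact hkN
      · exact (div_le_one hbR).2 hdb
    _ = _ := by ring

/-- The constant in the round bound. -/
noncomputable def roundConst (c : ℕ) : ℝ :=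
  (5376 * (30 + 6 * c) + 2) * (2 * (fwdFactor c + 273))

theorem rounds_le (h2 : 2 ≤ n) (hnN : n ≤ 2 * N) (hNn : N ≤ 2 * n) (hb : 0 < b)
    (hlog : Real.logb 2 n ≤ b) (hd : d ≤ b) (hk : k ≤ n) (hkd : d = 0 → k ≤ 1) :
    (phaseCount (par c u N b d) c N k + 1) * (par c u N b d).phase.length ≤
      ⌊roundConst c * roundBound n k d b⌋₊ := by
  have hN : 0 < N := by omega
  have hn2 : (2 : ℝ) ≤ n := by exact_mod_cast h2
  have hl : 1 ≤ Real.logb 2 n := by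
    rw [Real.le_logb_iff_rpow_le (by norm_num) (by linarith), Real.rpow_one]
    exact hn2
  refine Nat.le_floor ?_
  set X : ℝ := (k : ℝ) * d / b ^ 2 with hX
  have hX0 : 0 ≤ X := by positivity
  have hlen : ((par c u N b d).phase.length : ℝ) ≤ 2 * (fwdFactor c + 273) * n := by
    have h1 : (par c u N b d).phase.length ≤ (fwdFactor c + 273) * N := by
      rw [Par.length_phase]
      change fwdFactor c * N + 2 * (2 * N) + 2 * (132 * N) + 5 ≤ _
      nlinarith
    have h3 : (par c u N b d).phase.length ≤ (fwdFactor c + 273) * (2 * n) :=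
      h1.trans (Nat.mul_le_mul_left _ hNn)
    calc ((par c u N b d).phase.length : ℝ) ≤ (((fwdFactor c + 273) * (2 * n) : ℕ) : ℝ) := by
          exact_mod_cast h3
      _ = _ := by push_cast; ring
  have hj : (phaseCount (par c u N b d) c N k : ℝ) + 1 ≤
      (5376 * (30 + 6 * c) + 2) * (X + Real.logb 2 n) := by
    have h1 := phaseCount_le (c := c) (N := N) (k := k) (par c u N b d)
    have h3 := div_gs_le (c := c) (u := u) hnN hN hb hd hk hkd
    have h4 := bits_le_logb h2 hN hNn
    have hc : (0 : ℝ) ≤ c := Nat.cast_nonneg c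
    calc (phaseCount (par c u N b d) c N k : ℝ) + 1
        ≤ 5376 * (2 * X + 4 * bits N + (3 + c) * (2 * bits N)) + 2 := by linarith
      _ = 5376 * (2 * X + (10 + 2 * c) * bits N) + 2 := by ring
      _ ≤ 5376 * (2 * X + (10 + 2 * c) * (3 * Real.logb 2 n)) + 2 := by gcongr
      _ ≤ _ := by nlinarith [mul_nonneg hc hX0]
  have hrb := le_roundBound (k := k) (d := d) h2 hb hlog
  rw [← hX] at hrb
  push_cast
  calc ((phaseCount (par c u N b d) c N k : ℝ) + 1) * (par c u N b d).phase.length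
      ≤ ((5376 * (30 + 6 * c) + 2) * (X + Real.logb 2 n)) * (2 * (fwdFactor c + 273) * n) := by
        gcongr
    _ = roundConst c * (n * (X + Real.logb 2 n)) := by rw [roundConst]; ring
    _ ≤ _ := by
        gcongr
        rw [roundConst]; positivity

end Bounds

end NetCoding

theorem theorem3 (c u : ℕ) :
    ∃ (K : ℕ) (C : ℝ) (alg : (N b d : ℕ) → Algorithm (K * b) d),
      ∀ n N b d k : ℕ, 2 ≤ n → n ≤ 2 * N → N ≤ 2 * n →
        Real.logb 2 (n : ℝ) ≤ (b : ℝ) → d ≤ b → k ≤ n →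
        ∀ uid : Fin n → ℕ, Function.Injective uid → (∀ v, uid v < n ^ u) →
        ∀ tok : Fin n → Finset (Token d), (Finset.univ.biUnion tok).card = k →
        ∀ adv : Adversary n (alg N b d).Coin,
          (alg N b d).Disseminates uid tok adv ∧
          1 - 1 / (n : ℝ) ^ c ≤
            (alg N b d).haltProb uid tok adv ⌊C * roundBound n k d b⌋₊ := by
  refine ⟨6 * u + 126, NetCoding.roundConst c, fun N b d =>
    (NetCoding.par c u N b d).machine ((6 * u + 126) * b), ?_⟩
  intro n N b d k h2 hnN hNn hlog hd hk uid huid hU tok htok adv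
  have hn2 : (2 : ℝ) ≤ n := by exact_mod_cast h2
  have hb : 0 < b := by
    have hl : 1 ≤ Real.logb 2 n := by
      rw [Real.le_logb_iff_rpow_le (by norm_num) (by linarith), Real.rpow_one]
      exact hn2
    exact_mod_cast zero_lt_one.trans_le (hl.trans hlog)
  have hn : n ≤ 2 ^ b := by
    rw [Real.logb_le_iff_le_rpow (by norm_num) (by linarith), Real.rpow_natCast] at hlog
    exact_mod_cast hlog
  -- For d = 0 the main term of the round bound vanishes, but there is only one token of zero bits.
  have hkd : d = 0 → k ≤ 1 := by
    rintro rfl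
    rw [← htok]
    exact (Finset.card_le_univ _).trans (by simp)
  have hfits := NetCoding.par_fits (c := c) (u := u) h2 hnN hb hn hd
  have henc := NetCoding.par_enc_injective (c := c) (u := u) hNn hb hn hd
  have hU' : ∀ v, uid v < (NetCoding.par c u N b d).U := fun v =>
    ((hU v).trans_le (Nat.pow_le_pow_left hnN u)).trans (Nat.lt_succ_self _)
  refine ⟨NetCoding.Par.machine_disseminates hfits huid hU' adv henc, ?_⟩
  have hmain := NetCoding.Par.le_haltProb (tok := tok) hfits (by omega) huid hU' adv henc
    htok hk (NetCoding.forward_failure_le h2 hnN hb) (Real.exp_pos _).le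
    (NetCoding.phaseCount (NetCoding.par c u N b d) c N k)
    (NetCoding.rounds_le h2 hnN hNn hb hlog hd hk hkd)
  refine le_trans ?_ hmain
  linarith [NetCoding.failure_le (c := c) h2 hnN hNn hk (NetCoding.par c u N b d)]
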